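/- For a finite simple graph $G=(V,E)$ write $N_G(v)$ for the set of neighbours of $v$ in $G$. A graph $G$ is $(2,1)$-anonymous if for every vertex $v$ there are at least two vertices $u\neq v$ with $N_G(v)\cap N_G(u)\neq\emptyset$. A graph $G'=(V,E')$ with $E\subseteq E'$ is a strong $(2,1)$-transformation of $G=(V,E)$ if $G'$ is $(2,1)$-anonymous and for every vertex $v$ there are at least two vertices $u\neq v$ with $N_G(v)\cap N_{G'}(u)\neq\emptyset$. The strong $(2,1)$-anonymization problem asks, for a graph $G$ that has a strong $(2,1)$-transformation (so that $G$ has no isolated vertex), for a strong $(2,1)$-transformation $G'$ of $G$ with the least possible number $\mathrm{opt}(G)$ of added edges $|E'\setminus E|$. Algorithms are fixed programs for a random-access machine with unit-cost instructions (constant, copy, increment, decrement, indirect load and store, comparison and branching), whose input is the number $n$ of vertices and a list of the $m$ edges of $G$ in any order, and whose output is the list of the added edges. Theorem. 1. There is an algorithm that, on every graph $G$ with $n$ vertices and $m$ edges that has a strong $(2,1)$-transformation, halts after $O(n+m)$ steps (more precisely, after at most $c\,(n+m+1)$ steps, for a constant $c$) and outputs the added edges of a strong $(2,1)$-transformation of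 $G$ with at most $\mathrm{opt}(G)+2$ added edges. 2. There is an algorithm that, on every such graph $G$, halts after a number of steps polynomial in $n+m$ (at most $c\,(n+m+1)^d$ steps, for constants $c,d$) and outputs the added edges of a strong $(2,1)$-transformation of $G$ with exactly $\mathrm{opt}(G)$ added edges. -/

import Mathlib

namespace GraphAnon

/-! Anonymity of graphs. -/

/-- `G` is `(k, ℓ)`-anonymous: every vertex `v` has at least `k` other vertices each of which
shares at least `ℓ` neighbours with `v`. -/
def IsAnonymous {V : Type*} (k ℓ : ℕ) (G : SimpleGraph V) : Prop :=
  ∀ v : V, ∃ U : Finset V, v ∉ U ∧ k ≤ U.card ∧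
    ∀ u ∈ U, (ℓ : ℕ∞) ≤ (G.neighborSet v ∩ G.neighborSet u).encard

/-- `G'` is a strong `(k, ℓ)`-transformation of `G`: it is obtained by adding edges, it is
`(k, ℓ)`-anonymous, and every vertex `v` has at least `k` other vertices each of which is adjacent
in `G'` to at least `ℓ` of the original neighbours of `v` in `G`. -/
structure IsStrongTransformation {V : Type*} (k ℓ : ℕ) (G G' : SimpleGraph V) : Prop where
  le : G ≤ G'
  anonymous : IsAnonymous k ℓ G'
  strong : ∀ v : V, ∃ U : Finset V, v ∉ U ∧ k ≤ U.card ∧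
    ∀ u ∈ U, (ℓ : ℕ∞) ≤ (G.neighborSet v ∩ G'.neighborSet u).encard

/-- The number of edges of `G'` that are not edges of `G`. -/
noncomputable def addedEdges {n : ℕ} (G G' : SimpleGraph (Fin n)) : ℕ :=
  (G'.edgeSet \ G.edgeSet).ncard

/-! A random-access machine with a finite program, countably many registers, and countably many
arrays, all holding natural numbers. Each elementary instruction and each test takes one step.
The only arithmetic is adding and subtracting one, so a run of `t` steps never creates a number
exceeding the numbers in its input and program by more than `t`; in particular unit cost hides
no computation on long words. -/

/-- A memory state. -/
structure State where
  reg : ℕ → ℕ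
  arr : ℕ → ℕ → ℕ

/-- `s.setReg x v`: register `x` now holds `v`. -/
def State.setReg (s : State) (x v : ℕ) : State :=
  { s with reg := Function.update s.reg x v }

/-- `s.setArr a i v`: cell `i` of array `a` now holds `v`. -/
def State.setArr (s : State) (a i v : ℕ) : State :=
  { s with arr := Function.update s.arr a (Function.update (s.arr a) i v) }

/-- Tests on two registers. -/
inductive Test where
  | eq (x y : ℕ)
  | lt (x y : ℕ)

/-- Truth of a test in a state. -/
def Test.Holds (s : State) : Test → Prop
  | .eq x y => s.reg x = s.reg y
  | .lt x y => s.reg x < s.reg y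

/-- Programs. Register and array names, and constants, are fixed in the program text; only the
cells of an array are addressed indirectly, by the contents of a register. -/
inductive Prog where
  /-- do nothing -/
  | nop
  /-- `x := c` -/
  | const (x c : ℕ)
  /-- `x := y` -/
  | copy (x y : ℕ)
  /-- `x := x + 1` -/
  | incr (x : ℕ)
  /-- `x := x - 1`, where zero stays zero -/
  | decr (x : ℕ)
  /-- `x := a[i]`, the index being the content of register `i` -/
  | load (x a i : ℕ)
  /-- `a[i] := x`, the index being the content of register `i` -/
  | store (a i x : ℕ)
  /-- first `p`, then `q` -/
  | seq (p q : Prog)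
  /-- `if b then p else q` -/
  | ite (b : Test) (p q : Prog)
  /-- `while b do p` -/
  | loop (b : Test) (p : Prog)

/-- `Exec p s t s'`: started in state `s`, the program `p` halts after exactly `t` steps
in state `s'`. -/
inductive Exec : Prog → State → ℕ → State → Prop
  | nop (s : State) : Exec .nop s 1 s
  | const (s : State) (x c : ℕ) : Exec (.const x c) s 1 (s.setReg x c)
  | copy (s : State) (x y : ℕ) : Exec (.copy x y) s 1 (s.setReg x (s.reg y))
  | incr (s : State) (x : ℕ) : Exec (.incr x) s 1 (s.setReg x (s.reg x + 1))
  | decr (s : State) (x : ℕ) : Exec (.decr x) s 1 (s.setReg x (s.reg x - 1))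
  | load (s : State) (x a i : ℕ) : Exec (.load x a i) s 1 (s.setReg x (s.arr a (s.reg i)))
  | store (s : State) (a i x : ℕ) : Exec (.store a i x) s 1 (s.setArr a (s.reg i) (s.reg x))
  | seq {p q : Prog} {s s₁ s₂ : State} {t₁ t₂ : ℕ} :
      Exec p s t₁ s₁ → Exec q s₁ t₂ s₂ → Exec (.seq p q) s (t₁ + t₂) s₂
  | ite_true {b : Test} {p q : Prog} {s s' : State} {t : ℕ} :
      b.Holds s → Exec p s t s' → Exec (.ite b p q) s (t + 1) s'
  | ite_false {b : Test} {p q : Prog} {s s' : State} {t : ℕ} :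
      ¬ b.Holds s → Exec q s t s' → Exec (.ite b p q) s (t + 1) s'
  | loop_true {b : Test} {p : Prog} {s s₁ s₂ : State} {t₁ t₂ : ℕ} :
      b.Holds s → Exec p s t₁ s₁ → Exec (.loop b p) s₁ t₂ s₂ →
        Exec (.loop b p) s (t₁ + t₂ + 1) s₂
  | loop_false {b : Test} {p : Prog} {s : State} :
      ¬ b.Holds s → Exec (.loop b p) s 1 s

/-! Graphs as inputs and outputs. -/

/-- `L` lists every edge in `E` exactly once, in some order and each in one of its two
orientations, and lists nothing else. -/
def IsEdgeList {n : ℕ} (L : List (Fin n × Fin n)) (E : Set (Sym2 (Fin n))) : Prop :=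
  (L.map fun e => s(e.1, e.2)).Nodup ∧ ∀ e, e ∈ (L.map fun e => s(e.1, e.2)) ↔ e ∈ E

/-- The initial state for a graph on the vertices `0, …, n - 1` with edge list `L`: register 0
holds `n`, register 1 holds the number of edges, the arrays 0 and 1 hold the first and the second
end points of the edges, and everything else is zero. -/
def inputState {n : ℕ} (L : List (Fin n × Fin n)) : State where
  reg := fun x => if x = 0 then n else if x = 1 then L.length else 0
  arr := fun a i =>
    if a = 0 then (L[i]?).elim 0 (fun e => (e.1 : ℕ))
    else if a = 1 then (L[i]?).elim 0 (fun e => (e.2 : ℕ))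
    else 0

/-- The output read from a final state is the list `L`: register 2 holds its length, and the
arrays 2 and 3 hold the first and the second end points of its members. -/
def HasOutput {n : ℕ} (s : State) (L : List (Fin n × Fin n)) : Prop :=
  s.reg 2 = L.length ∧
    ∀ (i : ℕ) (h : i < L.length), s.arr 2 i = (L[i].1 : ℕ) ∧ s.arr 3 i = (L[i].2 : ℕ)

/-- The program `P` solves the strong `(k, ℓ)`-anonymization problem within the additive error
`err` and within the time `T n m` for graphs with `n` vertices and `m` edges: on every graph `G`
that has a strong `(k, ℓ)`-transformation, however its edges are listed, `P` halts within that
time, and outputs the edges to be added to `G` to obtain a strong `(k, ℓ)`-transformation whose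
number of added edges exceeds the minimum by at most `err`. -/
def SolvesStrongAnonymization (P : Prog) (k ℓ err : ℕ) (T : ℕ → ℕ → ℕ) : Prop :=
  ∀ (n : ℕ) (G : SimpleGraph (Fin n)) (L : List (Fin n × Fin n)),
    IsEdgeList L G.edgeSet →
    (∃ H : SimpleGraph (Fin n), IsStrongTransformation k ℓ G H) →
    ∃ (t : ℕ) (s : State) (G' : SimpleGraph (Fin n)) (L' : List (Fin n × Fin n)),
      Exec P (inputState L) t s ∧
      t ≤ T n L.length ∧
      HasOutput s L' ∧
      IsEdgeList L' (G'.edgeSet \ G.edgeSet) ∧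
      IsStrongTransformation k ℓ G G' ∧
      ∀ H : SimpleGraph (Fin n), IsStrongTransformation k ℓ G H →
        addedEdges G G' ≤ addedEdges G H + err

end GraphAnon

namespace GraphAnon

/-! ### Running programs -/

-- Since `G` is contained in `G'`, anonymity follows from the strong condition. So all that matters
-- is which vertices a vertex `v` reaches by an old edge followed by an old or a new one: two of
-- them, other than `v`, are needed. If there are no isolated vertices, those lacking this in `G`
-- are of three kinds: the centre of a star component with at least two leaves, the vertices of a
-- two-vertex component, and a vertex from which exactly one vertex is reached. The first needs two
-- ends of new edges among its neighbours, a two-vertex component needs two at each of its vertices,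
-- and the third kind needs one end at a neighbour. When two vertices of the third kind reach only
-- each other, a common neighbour of degree two can serve both, and the smaller one demands for
-- both. The sets of vertices at which the demands of different vertices can be met are disjoint
-- (`Prep.own_unique`). Hence half the total demand is a lower bound for the number of added edges
-- (`Prep.sum_dem_le`), and meeting all demands by non-edges is sufficient
-- (`Prep.strong_of_served`).
--
-- A greedy pass almost attains the bound. A star is served by joining two of its leaves, two
-- two-vertex components by the four edges between them, and two vertices of degree two that demand
-- one end each by an edge between them; three slots suffice to find a nonadjacent partner.
-- `PoolInv` records that every added edge serves two demands. At the end at most three slots and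
-- one component are waiting. Serving them by fresh vertices costs at most two edges more than the
-- lower bound (`PoolInv.last_spec`), which gives the linear-time algorithm.
--
-- For the exact algorithm, an edge `rs` is replaced by `pr` and `qs`, which serves two waiting
-- vertices `p`, `q` for one additional edge (`Config.swap`). If enough edges are available, this
-- attains the lower bound rounded up and alters only the last eleven greedy edges
-- (`PoolInv.exists_completion`); otherwise the optimum is bounded by a constant or the graph is
-- tiny. In every case the greedy list without its last eleven edges extends to an optimum by at
-- most 225 edges, and an exhaustive search of this fixed depth takes polynomial time.
--
-- On the side of the machine, loop-free code is treated by `wp` and `cost`, loops by `Runs.loop`,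
-- and the exhaustive search by compiling formulas with bounded quantifiers (`Fm.compile_runs`).

infixr:60 " ;; " => Prog.seq

/-- Started in `s`, the program `p` halts within `T` steps in a state satisfying `Q`. -/
def Runs (p : Prog) (s : State) (T : ℕ) (Q : State → Prop) : Prop :=
  ∃ t s', Exec p s t s' ∧ t ≤ T ∧ Q s'

theorem Runs.mono {p : Prog} {s : State} {T T' : ℕ} {Q Q' : State → Prop}
    (h : Runs p s T Q) (hT : T ≤ T') (hQ : ∀ s, Q s → Q' s) : Runs p s T' Q' := by
  obtain ⟨t, s', he, ht, hq⟩ := h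
  exact ⟨t, s', he, ht.trans hT, hQ _ hq⟩

theorem Runs.seq {p q : Prog} {s : State} {T₁ T₂ : ℕ} {R Q : State → Prop}
    (h : Runs p s T₁ R) (h' : ∀ s', R s' → Runs q s' T₂ Q) : Runs (p ;; q) s (T₁ + T₂) Q := by
  obtain ⟨t, s', he, ht, hr⟩ := h
  obtain ⟨t', s'', he', ht', hq⟩ := h' s' hr
  exact ⟨_, _, .seq he he', by omega, hq⟩

theorem Runs.ite {b : Test} {p q : Prog} {s : State} {T : ℕ} {Q : State → Prop}
    (h₁ : b.Holds s → Runs p s T Q) (h₂ : ¬ b.Holds s → Runs q s T Q) :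
    Runs (.ite b p q) s (T + 1) Q := by
  by_cases hb : b.Holds s
  · obtain ⟨t, s', he, ht, hq⟩ := h₁ hb
    exact ⟨_, _, .ite_true hb he, by omega, hq⟩
  · obtain ⟨t, s', he, ht, hq⟩ := h₂ hb
    exact ⟨_, _, .ite_false hb he, by omega, hq⟩

/-- A loop that is left as soon as its counter reaches its bound, where the counter may be
advanced by more than one. -/
theorem Runs.loop {i N n T : ℕ} {p : Prog} (Inv : ℕ → State → Prop)
    (hreg : ∀ k s, Inv k s → s.reg i = k ∧ s.reg N = n)
    (hstep : ∀ k s, k < n → Inv k s → Runs p s T fun s' => ∃ k', k < k' ∧ k' ≤ n ∧ Inv k' s')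
    {k : ℕ} (hk : k ≤ n) {s : State} (h : Inv k s) :
    Runs (.loop (.lt i N) p) s ((n - k) * (T + 1) + 1) (Inv n) := by
  induction hd : n - k using Nat.strong_induction_on generalizing k s with
  | _ d ih =>
    subst hd
    obtain ⟨h1, h2⟩ := hreg k s h
    rcases hk.lt_or_eq with hlt | rfl
    · obtain ⟨t, s', he, ht, k', hk1, hk2, hI⟩ := hstep k s hlt h
      obtain ⟨t', s'', he', ht', hq⟩ := ih (n - k') (by omega) hk2 hI rfl
      refine ⟨_, _, .loop_true (by simp [Test.Holds, h1, h2, hlt]) he he', ?_, hq⟩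
      -- A jump of the counter only shortens the run, so the skipped rounds may be charged as well.
      have : (n - k' + 1) * (T + 1) ≤ (n - k) * (T + 1) := Nat.mul_le_mul_right _ (by omega)
      rw [add_mul] at this
      omega
    · exact ⟨1, s, .loop_false (by simp [Test.Holds, h1, h2]), by omega, h⟩

/-- A loop whose counter runs up to its bound. -/
theorem Runs.for {i N n T : ℕ} {p : Prog} (Inv : ℕ → State → Prop)
    (hreg : ∀ k s, Inv k s → s.reg i = k ∧ s.reg N = n)
    (hstep : ∀ k s, k < n → Inv k s → Runs p s T (Inv (k + 1))) {s : State} (h : Inv 0 s) :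
    Runs (.loop (.lt i N) p) s (n * (T + 1) + 1) (Inv n) :=
  Runs.loop Inv hreg (fun k s hk hs => (hstep k s hk hs).mono le_rfl
    fun _ h' => ⟨k + 1, by omega, by omega, h'⟩) (Nat.zero_le n) h

/-- The weakest precondition of a program without loops. -/
def wp : Prog → (State → Prop) → State → Prop
  | .nop, Q, s => Q s
  | .const x c, Q, s => Q (s.setReg x c)
  | .copy x y, Q, s => Q (s.setReg x (s.reg y))
  | .incr x, Q, s => Q (s.setReg x (s.reg x + 1))
  | .decr x, Q, s => Q (s.setReg x (s.reg x - 1))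
  | .load x a i, Q, s => Q (s.setReg x (s.arr a (s.reg i)))
  | .store a i x, Q, s => Q (s.setArr a (s.reg i) (s.reg x))
  | .seq p q, Q, s => wp p (wp q Q) s
  | .ite b p q, Q, s => (b.Holds s → wp p Q s) ∧ (¬ b.Holds s → wp q Q s)
  | .loop _ _, _, _ => False

/-- A bound for the running time of a program without loops. -/
def cost : Prog → ℕ
  | .seq p q => cost p + cost q
  | .ite _ p q => max (cost p) (cost q) + 1
  | _ => 1

/-- Without loops the running time has a bound that can be read off the program text, so later time
estimates for such pieces are mere evaluations of `cost`. -/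
theorem Runs.of_wp {p : Prog} {s : State} {Q : State → Prop} (h : wp p Q s) :
    Runs p s (cost p) Q := by
  induction p generalizing s Q with
  | nop => exact ⟨_, _, .nop s, le_rfl, h⟩
  | const x c => exact ⟨_, _, .const s x c, le_rfl, h⟩
  | copy x y => exact ⟨_, _, .copy s x y, le_rfl, h⟩
  | incr x => exact ⟨_, _, .incr s x, le_rfl, h⟩
  | decr x => exact ⟨_, _, .decr s x, le_rfl, h⟩
  | load x a i => exact ⟨_, _, .load s x a i, le_rfl, h⟩
  | store a i x => exact ⟨_, _, .store s a i x, le_rfl, h⟩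
  | seq p q ihp ihq => exact (ihp h).seq fun s' hs' => ihq hs'
  | ite b p q ihp ihq =>
    exact Runs.ite (fun hb => (ihp (h.1 hb)).mono (le_max_left _ _) fun _ => id)
      fun hb => (ihq (h.2 hb)).mono (le_max_right _ _) fun _ => id
  | loop b p => exact h.elim

theorem wp.mono {p : Prog} {s : State} {Q Q' : State → Prop} (h : wp p Q s)
    (hQ : ∀ s, Q s → Q' s) : wp p Q' s := by
  induction p generalizing s Q Q' with
  | seq p q ihp ihq => exact ihp h fun _ h' => ihq h' hQ
  | ite b p q ihp ihq => exact ⟨fun hb => ihp (h.1 hb) hQ, fun hb => ihq (h.2 hb) hQ⟩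
  | loop b p => exact h.elim
  | _ => exact hQ _ h

@[simp] theorem State.setReg_reg (s : State) (x v y : ℕ) :
    (s.setReg x v).reg y = if y = x then v else s.reg y := by
  simp [State.setReg, Function.update_apply]

@[simp] theorem State.setReg_arr (s : State) (x v : ℕ) : (s.setReg x v).arr = s.arr := rfl

@[simp] theorem State.setArr_reg (s : State) (a i v : ℕ) : (s.setArr a i v).reg = s.reg := rfl

@[simp] theorem State.setArr_arr (s : State) (a i v b j : ℕ) :
    (s.setArr a i v).arr b j = if b = a ∧ j = i then v else s.arr b j := by
  by_cases h : b = a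
  · subst h; simp [State.setArr, Function.update_apply]
  · simp [State.setArr, h]

end GraphAnon

namespace GraphAnon

/-! ### Exhaustive search -/

/-- The register of the `d`-th bound variable. -/
def bvar (d : ℕ) : ℕ := 5 + 2 * d

/-- The loop counter that belongs to the `d`-th bound variable. -/
def bctr (d : ℕ) : ℕ := 6 + 2 * d

/-- Search for a value of the `d`-th bound variable, less than the content of register `N`, for
which `p` sets register 3 to one. -/
def exProg (d N : ℕ) (p : Prog) : Prog :=
  .const (bctr d) 0 ;; .const 3 0 ;;
  .loop (.lt (bctr d) N) (.copy (bvar d) (bctr d) ;; p ;; .const 4 0 ;;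
    .ite (.lt 4 3) (.copy (bctr d) N) (.incr (bctr d)))

/-- `Inv` is what a failed trial has to restore, `Good j` is what a successful trial leaves behind,
and `Bad j` does not mention the state, so that failures accumulate. The closure hypotheses say that
the bookkeeping of the loop itself disturbs neither `Inv` nor `Good`. -/
theorem Runs.exProg {d N n T : ℕ} {p : Prog} {Inv : State → Prop} {Good : ℕ → State → Prop}
    {Bad : ℕ → Prop} (hN : N < 3)
    (hInv : ∀ s x v, x = 3 ∨ x = 4 ∨ x = bvar d ∨ x = bctr d → Inv s → Inv (s.setReg x v))
    (hGood : ∀ j s x v, x = 4 ∨ x = bctr d → Good j s → Good j (s.setReg x v))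
    (hp : ∀ j s, j < n → Inv s → s.reg N = n → s.reg (bvar d) = j →
      Runs p s T fun s' => s'.reg (bctr d) = s.reg (bctr d) ∧ s'.reg N = n ∧
        (s'.reg 3 = 1 ∧ Good j s' ∨ s'.reg 3 = 0 ∧ Bad j ∧ Inv s'))
    {s : State} (hs : Inv s) (hn : s.reg N = n) :
    Runs (exProg d N p) s (n * (T + 5) + 3) fun s' =>
      s'.reg 3 = 1 ∧ (∃ j < n, Good j s') ∨ s'.reg 3 = 0 ∧ (∀ j < n, Bad j) ∧ Inv s' := by
  have e1 : N ≠ bctr d := by unfold bctr; omega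
  have e2 : bctr d ≠ bvar d := by unfold bctr bvar; omega
  have e3 : 3 ≠ bctr d := by unfold bctr; omega
  have e4 : N ≠ bvar d := by unfold bvar; omega
  have e5 : bctr d ≠ 4 := by unfold bctr; omega
  have e6 : N ≠ 4 := by omega
  have e7 : N ≠ 3 := by omega
  have e8 : bctr d ≠ 3 := e3.symm
  -- Either a trial has succeeded and the counter has been moved to the bound, or all values below
  -- the counter have failed.
  let I : ℕ → State → Prop := fun k s => (s.reg (bctr d) = k ∧ s.reg N = n) ∧
    (s.reg 3 = 1 ∧ k = n ∧ (∃ j < n, Good j s) ∨ s.reg 3 = 0 ∧ (∀ j < k, Bad j) ∧ Inv s)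
  refine Runs.mono (T := 1 + (1 + (n * (T + 4 + 1) + 1))) (Q := I n) ?_ (by ring_nf; omega) ?_
  · refine Runs.seq (Runs.of_wp (p := .const (bctr d) 0) (Q := fun s => Inv s ∧ s.reg N = n ∧
      s.reg (bctr d) = 0) ⟨hInv _ _ _ (by simp) hs, by simp [e1, hn], by simp⟩) fun s h => ?_
    refine Runs.seq (Runs.of_wp (p := .const 3 0) (Q := fun s => Inv s ∧ s.reg N = n ∧
      s.reg (bctr d) = 0 ∧ s.reg 3 = 0)
      ⟨hInv _ _ _ (by simp) h.1, by simp [e7, h.2], by simp [e8, h.2.2], by simp⟩) fun s h => ?_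
    refine Runs.mono (Runs.loop (i := bctr d) (N := N) (n := n) (T := T + 4) I
      (fun k s h => h.1) (fun k s hk h => ?_)
      (Nat.zero_le n) ⟨⟨h.2.2.1, h.2.1⟩, .inr ⟨h.2.2.2, by simp, h.1⟩⟩) le_rfl fun _ => id
    obtain ⟨⟨h1, h2⟩, h | ⟨h3, h4, h5⟩⟩ := h
    · omega
    refine Runs.mono (T := 1 + (T + 3)) (Runs.seq (Runs.of_wp (p := .copy (bvar d) (bctr d))
      (Q := fun s => Inv s ∧ s.reg N = n ∧ s.reg (bctr d) = k ∧ s.reg (bvar d) = k)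
      ⟨hInv _ _ _ (by simp) h5, by simp [e4, h2], by simp [e2, h1], by simp [h1]⟩)
      fun s h => Runs.seq (hp k s hk h.1 h.2.1 h.2.2.2) fun s' h' =>
        Runs.of_wp (Q := fun s' => ∃ k', k < k' ∧ k' ≤ n ∧ I k' s') ?_) (by omega) fun _ => id
    obtain ⟨g1, g2, ⟨g3, g4⟩ | ⟨g3, g4, g5⟩⟩ := h' <;>
      simp only [wp, Test.Holds, State.setReg_reg, g3]
    · exact ⟨fun _ => ⟨n, hk, le_rfl, ⟨by simp [e6, g2], by simp [e1, e6, g2]⟩,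
        .inl ⟨by simp [e3, g3], rfl, k, hk, hGood _ _ _ _ (by simp) (hGood _ _ _ _ (by simp) g4)⟩⟩,
        by simp⟩
    · refine ⟨by simp, fun _ => ⟨k + 1, by omega, hk, ⟨by simp [e5, g1, h.2.2.1],
        by simp [e1, e6, g2]⟩, .inr ⟨by simp [e3, g3], fun j hj => ?_,
        hInv _ _ _ (by simp) (hInv _ _ _ (by simp) g5)⟩⟩⟩
      rcases Nat.lt_succ_iff_lt_or_eq.mp hj with hj | rfl
      exacts [h4 j hj, g4]
  · rintro s ⟨-, ⟨h1, -, h2⟩ | h⟩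
    exacts [.inl ⟨h1, h2⟩, .inr h]

/-- Formulas with bounded quantifiers about the contents of a memory. A formula may mention the
registers 0, 1, 2 and its bound variables. -/
inductive Fm where
  /-- equality of two registers -/
  | eq (x y : ℕ)
  /-- negation -/
  | neg (φ : Fm)
  /-- conjunction -/
  | and (φ ψ : Fm)
  /-- a new bound variable denotes `a[i]` -/
  | rd (a i : ℕ) (φ : Fm)
  /-- for some value of a new bound variable, less than the content of register `N` -/
  | ex (N : ℕ) (φ : Fm)

/-- Truth of a formula, the next bound variable being the `d`-th. -/
def Fm.Holds : Fm → ℕ → (ℕ → ℕ) → (ℕ → ℕ → ℕ) → Prop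
  | .eq x y, _, ρ, _ => ρ x = ρ y
  | .neg φ, d, ρ, m => ¬ φ.Holds d ρ m
  | .and φ ψ, d, ρ, m => φ.Holds d ρ m ∧ ψ.Holds d ρ m
  | .rd a i φ, d, ρ, m => φ.Holds (d + 1) (Function.update ρ (bvar d) (m a (ρ i))) m
  | .ex N φ, d, ρ, m => ∃ j < ρ N, φ.Holds (d + 1) (Function.update ρ (bvar d) j) m

/-- The registers that a formula may mention below `d` quantifiers. -/
def Vis (d x : ℕ) : Prop := x < 3 ∨ ∃ i < d, x = bvar i

/-- The registers that are not used below `d` quantifiers. -/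
def Low (d x : ℕ) : Prop := 5 ≤ x ∧ x < bvar d

/-- Only visible registers are mentioned. -/
def Fm.Wf : Fm → ℕ → Prop
  | .eq x y, d => Vis d x ∧ Vis d y
  | .neg φ, d => φ.Wf d
  | .and φ ψ, d => φ.Wf d ∧ ψ.Wf d
  | .rd _ i φ, d => Vis d i ∧ φ.Wf (d + 1)
  | .ex N φ, d => N < 3 ∧ φ.Wf (d + 1)

/-- A program that evaluates a formula and puts its truth value into register 3. -/
def Fm.compile : Fm → ℕ → Prog
  | .eq x y, _ => .ite (.eq x y) (.const 3 1) (.const 3 0)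
  | .neg φ, d => φ.compile d ;; .const 4 0 ;; .ite (.lt 4 3) (.const 3 0) (.const 3 1)
  | .and φ ψ, d => φ.compile d ;; .const 4 0 ;; .ite (.lt 4 3) (ψ.compile d) .nop
  | .rd a i φ, d => .load (bvar d) a i ;; φ.compile (d + 1)
  | .ex N φ, d => exProg d N (φ.compile (d + 1))

/-- A bound for the time to evaluate a formula when the bounds of the quantifiers are at most
`X`. -/
def Fm.time : Fm → ℕ → ℕ
  | .eq _ _, _ => 2
  | .neg φ, X => φ.time X + 3
  | .and φ ψ, X => φ.time X + ψ.time X + 3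
  | .rd _ _ φ, X => φ.time X + 1
  | .ex _ φ, X => X * (φ.time X + 5) + 3

/-- Each quantifier costs one factor `X + 1`. The estimate for conjunctions is wasteful, but it is
only applied to a fixed formula. -/
theorem Fm.time_le (φ : Fm) : ∃ c e, ∀ X, φ.time X ≤ c * (X + 1) ^ e := by
  have key : ∀ c e c' e' X : ℕ, c * (X + 1) ^ e ≤ (c + c') * (X + 1) ^ (e + e') := fun c e c' e' X =>
    Nat.mul_le_mul (by omega) (Nat.pow_le_pow_right (by omega) (by omega))
  have one : ∀ X e : ℕ, 1 ≤ (X + 1) ^ e := fun X e => Nat.one_le_pow _ _ (by omega)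
  induction φ with
  | eq x y => exact ⟨2, 0, fun X => by simp [Fm.time]⟩
  | neg φ ih =>
    obtain ⟨c, e, h⟩ := ih
    refine ⟨c + 3, e, fun X => ?_⟩
    have := h X; have := one X e
    simp only [Fm.time]; nlinarith
  | and φ ψ ihφ ihψ =>
    obtain ⟨c, e, h⟩ := ihφ
    obtain ⟨c', e', h'⟩ := ihψ
    refine ⟨2 * (c + c') + 3, e + e', fun X => ?_⟩
    have h1 := (h X).trans (key c e c' e' X)
    have h2 := (h' X).trans (key c' e' c e X)
    rw [add_comm c' c, add_comm e' e] at h2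
    have := one X (e + e')
    simp only [Fm.time]; nlinarith
  | rd a i φ ih =>
    obtain ⟨c, e, h⟩ := ih
    refine ⟨c + 1, e, fun X => ?_⟩
    have := h X; have := one X e
    simp only [Fm.time]; nlinarith
  | ex N φ ih =>
    obtain ⟨c, e, h⟩ := ih
    refine ⟨c + 8, e + 1, fun X => ?_⟩
    have h1 := h X; have h2 := one X e
    simp only [Fm.time]
    calc X * (φ.time X + 5) + 3 ≤ X * (c * (X + 1) ^ e + 5) + 3 := by gcongr
      _ ≤ (c + 8) * (X + 1) ^ e * (X + 1) := by nlinarith [Nat.zero_le X]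
      _ = _ := by ring

theorem Low.succ {d x : ℕ} (h : Low d x) : Low (d + 1) x := by
  unfold Low bvar at *; omega

theorem Vis.succ {d x : ℕ} (h : Vis d x) : Vis (d + 1) x :=
  h.imp_right fun ⟨i, hi, h⟩ => ⟨i, by omega, h⟩

theorem Vis.lt_or_low {d x : ℕ} (h : Vis d x) : x < 3 ∨ Low d x := by
  rcases h with h | ⟨i, hi, rfl⟩
  · exact .inl h
  · right; unfold Low bvar; omega

/-- Evaluating one subformula overwrites scratch registers. The truth of the next one is unaffected,
since it refers only to visible registers. -/
theorem Fm.holds_congr {φ : Fm} {d : ℕ} {ρ ρ' : ℕ → ℕ} {m : ℕ → ℕ → ℕ} (hw : φ.Wf d)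
    (h : ∀ x, Vis d x → ρ x = ρ' x) : φ.Holds d ρ m ↔ φ.Holds d ρ' m := by
  have key : ∀ {d : ℕ} {ρ ρ' : ℕ → ℕ} (v : ℕ), (∀ x, Vis d x → ρ x = ρ' x) → ∀ x, Vis (d + 1) x →
      Function.update ρ (bvar d) v x = Function.update ρ' (bvar d) v x := by
    intro d ρ ρ' v h x hx
    by_cases h1 : x = bvar d
    · subst h1; simp
    · rw [Function.update_of_ne h1, Function.update_of_ne h1]
      apply h
      rcases hx with hx | ⟨i, hi, rfl⟩
      · exact .inl hx
      · exact .inr ⟨i, lt_of_le_of_ne (by omega) (by rintro rfl; exact h1 rfl), rfl⟩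
  induction φ generalizing d ρ ρ' with
  | eq x y => simp only [Holds, h x hw.1, h y hw.2]
  | neg φ ih => simp only [Holds, ih hw h]
  | and φ ψ ihφ ihψ => simp only [Holds, ihφ hw.1 h, ihψ hw.2 h]
  | rd a i φ ih => simp only [Holds, h i hw.1, ih hw.2 (key (m a (ρ' i)) h)]
  | ex N φ ih => simp only [Holds, h N (.inl hw.1), fun j => ih hw.2 (key j h)]

/-- The induction needs the frame condition on `Low d`: the loops of outer quantifiers keep their
variables and counters there while the inner formula is evaluated. -/
theorem Fm.compile_runs {φ : Fm} {d : ℕ} (hw : φ.Wf d) {X : ℕ} {s : State}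
    (hX : ∀ N < 3, s.reg N ≤ X) :
    Runs (φ.compile d) s (φ.time X) fun s' => s'.arr = s.arr ∧
      (∀ x, x < 3 ∨ Low d x → s'.reg x = s.reg x) ∧
      (s'.reg 3 = 1 ∧ φ.Holds d s.reg s.arr ∨ s'.reg 3 = 0 ∧ ¬ φ.Holds d s.reg s.arr) := by
  have low : ∀ {d x}, x < 3 ∨ Low d x → x ≠ 3 ∧ x ≠ 4 ∧ x ≠ bvar d ∧ x ≠ bctr d := by
    intro d x; unfold Low bvar bctr; omega
  induction φ generalizing d s with
  | eq x y =>
    refine Runs.of_wp (p := .ite (.eq x y) (.const 3 1) (.const 3 0)) ?_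
    simp only [wp, Test.Holds, State.setReg_reg, State.setReg_arr, Fm.Holds]
    exact ⟨fun h => ⟨trivial, fun x hx => by simp [low hx], by simp [h]⟩,
      fun h => ⟨trivial, fun x hx => by simp [low hx], by simp [h]⟩⟩
  | neg φ ih =>
    refine Runs.seq (T₂ := 3) (ih hw hX) fun s' h => Runs.of_wp
      (p := .const 4 0 ;; .ite (.lt 4 3) (.const 3 0) (.const 3 1)) ?_
    obtain ⟨h1, h2, ⟨h3, h4⟩ | ⟨h3, h4⟩⟩ := h <;>
      simp only [wp, Test.Holds, State.setReg_reg, State.setReg_arr, Fm.Holds, h3, h4]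
    · exact ⟨fun _ => ⟨h1, fun x hx => by simp [low hx, h2 x hx], by simp⟩, by simp⟩
    · exact ⟨by simp, fun _ => ⟨h1, fun x hx => by simp [low hx, h2 x hx], by simp⟩⟩
  | and φ ψ ihφ ihψ =>
    refine Runs.mono (T := φ.time X + (1 + (ψ.time X + 1 + 1))) (Runs.seq (ihφ hw.1 hX)
      fun s₁ h => Runs.seq (R := fun s' => (s'.arr = s.arr ∧
      (∀ x, x < 3 ∨ Low d x → s'.reg x = s.reg x)) ∧ s'.reg 4 = 0 ∧
      (s'.reg 3 = 1 ∧ φ.Holds d s.reg s.arr ∨ s'.reg 3 = 0 ∧ ¬ φ.Holds d s.reg s.arr))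
      (Runs.of_wp (p := .const 4 0) ?_) fun s₂ h' => Runs.ite (fun hb => ?_) fun hb => ?_)
      (by simp only [Fm.time]; omega) fun _ => id
    · obtain ⟨h1, h2, h3⟩ := h
      exact ⟨⟨h1, fun x hx => by simp [low hx, h2 x hx]⟩, by simp, by simpa using h3⟩
    · obtain ⟨⟨h1, h2⟩, h3, ⟨h4, h5⟩ | ⟨h4, -⟩⟩ := h'
      · refine (ihψ hw.2 (s := s₂) fun N hN => by rw [h2 N (.inl hN)]; exact hX N hN).mono
          (by omega) fun s₃ ⟨g1, g2, g3⟩ => ⟨g1.trans h1, fun x hx => (g2 x hx).trans (h2 x hx), ?_⟩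
        rw [h1, Fm.holds_congr hw.2 fun x hx => h2 x hx.lt_or_low] at g3
        simpa [Fm.Holds, h5] using g3
      · simp [Test.Holds, h3, h4] at hb
    · obtain ⟨⟨h1, h2⟩, h3, ⟨h4, -⟩ | ⟨h4, h5⟩⟩ := h'
      · simp [Test.Holds, h3, h4] at hb
      · exact (Runs.of_wp (p := .nop) (Q := fun s' => s' = s₂) rfl).mono (by simp [cost])
          fun s' h => by subst h; exact ⟨h1, h2, by simp [Fm.Holds, h4, h5]⟩
  | rd a i φ ih =>
    refine Runs.mono (T := 1 + φ.time X) (Runs.seq (Runs.of_wp (p := .load (bvar d) a i)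
      (Q := fun s' => s' = s.setReg (bvar d) (s.arr a (s.reg i))) rfl) fun s' h => ?_)
      (by simp only [Fm.time]; omega) fun _ => id
    subst h
    refine (ih hw.2 fun N hN => ?_).mono le_rfl fun s' ⟨h1, h2, h3⟩ => ⟨h1, fun x hx => ?_, h3⟩
    · have := low (d := d) (.inl hN); simp [this, hX N hN]
    · have := low hx
      rw [h2 x (hx.imp_right Low.succ)]; simp [this]
  | ex N φ ih =>
    let I : State → Prop := fun s' => s'.arr = s.arr ∧ (∀ x, x < 3 ∨ Low d x → s'.reg x = s.reg x)
    have hI : ∀ s x v, x = 3 ∨ x = 4 ∨ x = bvar d ∨ x = bctr d → I s → I (s.setReg x v) := by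
      rintro s x v hx ⟨h1, h2⟩
      refine ⟨h1, fun y hy => ?_⟩
      have : y ≠ x := by have := low hy; rintro rfl; tauto
      simp [this, h2 y hy]
    refine ((Runs.exProg (n := s.reg N) (T := φ.time X) (Inv := I)
      (Good := fun j s' => I s' ∧ φ.Holds (d + 1) (Function.update s.reg (bvar d) j) s.arr)
      (Bad := fun j => ¬ φ.Holds (d + 1) (Function.update s.reg (bvar d) j) s.arr)
      hw.1 hI (fun j s x v hx h => ⟨hI s x v (by tauto) h.1, h.2⟩)
      (fun j s' hj ⟨h1, h2⟩ h3 h4 => ?_) ⟨rfl, fun _ _ => rfl⟩ rfl)).mono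
      (by have := hX N hw.1; simp only [Fm.time]; gcongr) fun s' h => ?_
    · refine (ih hw.2 fun N hN => by rw [h2 N (.inl hN)]; exact hX N hN).mono le_rfl
        fun s'' ⟨g1, g2, g3⟩ => ⟨g2 _ (.inr (by unfold Low bctr bvar; omega)),
          (g2 _ (.inl hw.1)).trans h3, ?_⟩
      have hI'' : I s'' := ⟨g1.trans h1, fun x hx => (g2 x (hx.imp_right Low.succ)).trans (h2 x hx)⟩
      have : φ.Holds (d + 1) s'.reg s'.arr ↔
          φ.Holds (d + 1) (Function.update s.reg (bvar d) j) s.arr := by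
        rw [h1]
        refine Fm.holds_congr hw.2 fun x hx => ?_
        by_cases hxd : x = bvar d
        · subst hxd; simp [h4]
        · rw [Function.update_of_ne hxd]
          apply h2
          rcases hx with hx | ⟨i, hi, rfl⟩
          · exact .inl hx
          · have : i ≠ d := by rintro rfl; exact hxd rfl
            right; unfold Low bvar; omega
      rw [this] at g3
      tauto
    · rcases h with ⟨h1, j, hj, ⟨h2, h3⟩, h4⟩ | ⟨h1, h2, h3, h4⟩
      · exact ⟨h2, h3, .inl ⟨h1, j, hj, h4⟩⟩
      · exact ⟨h3, h4, .inr ⟨h1, fun ⟨j, hj, h⟩ => h2 j hj h⟩⟩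

end GraphAnon

namespace GraphAnon

/-! ### Graphs as lists of pairs of natural numbers -/

/-- `a` and `b` are the two members of a pair in the list. -/
def LAdj (E : List (ℕ × ℕ)) (a b : ℕ) : Prop := (a, b) ∈ E ∨ (b, a) ∈ E

/-- Some neighbour of `v` in `E` is adjacent to `u` after the pairs in `H` have been added. -/
def Reach (E H : List (ℕ × ℕ)) (v u : ℕ) : Prop :=
  ∃ w, LAdj E v w ∧ w ≠ u ∧ (LAdj E w u ∨ LAdj H w u)

/-- Two vertices other than `v` are reached from `v`. -/
def Sat (E H : List (ℕ × ℕ)) (v : ℕ) : Prop :=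
  ∃ u u', u ≠ u' ∧ u ≠ v ∧ u' ≠ v ∧ Reach E H v u ∧ Reach E H v u'

/-- Adding the pairs in `H` to `E` yields a strong `(2, 1)`-transformation. -/
def Strong (n : ℕ) (E H : List (ℕ × ℕ)) : Prop := ∀ v < n, Sat E H v

/-- All entries are less than `n`. -/
def Below (n : ℕ) (H : List (ℕ × ℕ)) : Prop := ∀ e ∈ H, e.1 < n ∧ e.2 < n

theorem LAdj.symm {E : List (ℕ × ℕ)} {a b : ℕ} (h : LAdj E a b) : LAdj E b a := Or.symm h

theorem lAdj_append {E F : List (ℕ × ℕ)} {a b : ℕ} :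
    LAdj (E ++ F) a b ↔ LAdj E a b ∨ LAdj F a b := by
  simp only [LAdj, List.mem_append]; tauto

theorem LAdj.lt {n : ℕ} {E : List (ℕ × ℕ)} (hE : Below n E) {a b : ℕ} (h : LAdj E a b) :
    a < n ∧ b < n := by
  rcases h with h | h
  · exact hE _ h
  · exact (hE _ h).symm

/-- The arrays `a` and `b` hold the pairs in the list. -/
def Stores (s : State) (a b : ℕ) (E : List (ℕ × ℕ)) : Prop :=
  ∀ i e, E[i]? = some e → s.arr a i = e.1 ∧ s.arr b i = e.2

theorem Stores.append_singleton {s : State} {a b : ℕ} {E : List (ℕ × ℕ)} {e : ℕ × ℕ} :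
    Stores s a b (E ++ [e]) ↔
      Stores s a b E ∧ s.arr a E.length = e.1 ∧ s.arr b E.length = e.2 := by
  constructor
  · intro h
    refine ⟨fun i f hi => h i f ?_, h _ e (by simp)⟩
    rw [List.getElem?_append_left (List.getElem?_eq_some_iff.mp hi).1, hi]
  · rintro ⟨h1, h2⟩ i f hi
    rcases lt_trichotomy i E.length with hlt | rfl | hlt
    · rw [List.getElem?_append_left hlt] at hi; exact h1 i f hi
    · simp at hi; subst hi; exact h2
    · rw [List.getElem?_eq_none (by simp; omega)] at hi; simp at hi

theorem Stores.take {s : State} {a b : ℕ} {E : List (ℕ × ℕ)} (h : Stores s a b E) (k : ℕ) :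
    Stores s a b (E.take k) := by
  intro i e hi
  rw [List.getElem?_take] at hi
  split_ifs at hi
  exact h i e hi

theorem Stores.lAdj_iff {s : State} {a b : ℕ} {E : List (ℕ × ℕ)} (h : Stores s a b E) {x y : ℕ} :
    LAdj E x y ↔ ∃ j < E.length, s.arr a j = x ∧ s.arr b j = y ∨ s.arr a j = y ∧ s.arr b j = x := by
  constructor
  · rintro (hm | hm) <;> obtain ⟨j, hj, he⟩ := List.mem_iff_getElem.mp hm <;>
      have := h j _ (by rw [List.getElem?_eq_getElem hj, he]) <;>
      exact ⟨j, hj, by simp [this]⟩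
  · rintro ⟨j, hj, hh⟩
    have h1 := h j _ (List.getElem?_eq_getElem hj)
    have h2 : (s.arr a j, s.arr b j) ∈ E := by rw [h1.1, h1.2]; exact List.getElem_mem hj
    rcases hh with ⟨rfl, rfl⟩ | ⟨rfl, rfl⟩
    exacts [.inl h2, .inr h2]

/-- The memory holds a graph on `n` vertices with edges `E`, and the list `H` of output edges. -/
structure Rep (n : ℕ) (E H : List (ℕ × ℕ)) (s : State) : Prop where
  reg_zero : s.reg 0 = n
  reg_one : s.reg 1 = E.length
  reg_two : s.reg 2 = H.length
  edges : Stores s 0 1 E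
  output : Stores s 2 3 H

/-! ### The search for a completion -/

/-- The disjunction of two formulas. -/
def Fm.or (φ ψ : Fm) : Fm := .neg (.and (.neg φ) (.neg ψ))

/-- The registers `x` and `y` hold a pair from the arrays `a`, `b` of length register `N`. -/
def adjF (a b N x y d : ℕ) : Fm :=
  .ex N (.rd a (bvar d) (.rd b (bvar d)
    (.or (.and (.eq (bvar (d + 1)) x) (.eq (bvar (d + 2)) y))
      (.and (.eq (bvar (d + 1)) y) (.eq (bvar (d + 2)) x)))))

/-- The vertex in register `u` is reached from the vertex in register `v`. -/
def reachF (v u d : ℕ) : Fm :=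
  .ex 0 (.and (adjF 0 1 1 v (bvar d) (d + 1)) (.and (.neg (.eq (bvar d) u))
    (.or (adjF 0 1 1 (bvar d) u (d + 1)) (adjF 2 3 2 (bvar d) u (d + 1)))))

/-- The output edges yield a strong transformation. -/
def strongF (d : ℕ) : Fm :=
  .neg (.ex 0 (.neg (.ex 0 (.ex 0 (.and (.neg (.eq (bvar (d + 1)) (bvar (d + 2))))
    (.and (.neg (.eq (bvar (d + 1)) (bvar d))) (.and (.neg (.eq (bvar (d + 2)) (bvar d)))
      (.and (reachF (bvar d) (bvar (d + 1)) (d + 3))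
        (reachF (bvar d) (bvar (d + 2)) (d + 3))))))))))

theorem vis_bvar {d i : ℕ} (h : i < d) : Vis d (bvar i) := .inr ⟨i, h, rfl⟩

theorem Vis.ne_bvar {d x i : ℕ} (h : Vis d x) (hi : d ≤ i) : x ≠ bvar i := by
  rcases h with h | ⟨j, hj, rfl⟩ <;> unfold bvar <;> omega

theorem bvar_inj {i j : ℕ} : bvar i = bvar j ↔ i = j := by unfold bvar; omega

theorem adjF_wf {a b N x y d : ℕ} (hN : N < 3) (hx : Vis d x) (hy : Vis d y) :
    (adjF a b N x y d).Wf d := by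
  have h1 := hx.succ.succ.succ; have h2 := hy.succ.succ.succ
  simp [adjF, Fm.Wf, Fm.or, hN, h1, h2, vis_bvar]

theorem adjF_holds {a b N x y d : ℕ} (hx : Vis d x) (hy : Vis d y) {ρ : ℕ → ℕ} {m : ℕ → ℕ → ℕ} :
    (adjF a b N x y d).Holds d ρ m ↔
      ∃ j < ρ N, m a j = ρ x ∧ m b j = ρ y ∨ m a j = ρ y ∧ m b j = ρ x := by
  have h1 := hx.ne_bvar (i := d) le_rfl
  have h2 := hx.ne_bvar (i := d + 1) (by omega)
  have h3 := hx.ne_bvar (i := d + 2) (by omega)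
  have h4 := hy.ne_bvar (i := d) le_rfl
  have h5 := hy.ne_bvar (i := d + 1) (by omega)
  have h6 := hy.ne_bvar (i := d + 2) (by omega)
  simp only [adjF, Fm.or, Fm.Holds, Function.update_apply, h1, h2, h3, h4, h5, h6, if_false,
    bvar_inj, if_true]
  refine exists_congr fun j => and_congr_right fun _ => ?_
  simp
  tauto

theorem reachF_wf {v u d : ℕ} (hv : Vis d v) (hu : Vis d u) : (reachF v u d).Wf d := by
  refine ⟨by omega, adjF_wf (by omega) hv.succ (vis_bvar (by omega)),
    ⟨vis_bvar (by omega), hu.succ⟩, adjF_wf (by omega) (vis_bvar (by omega)) hu.succ,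
    adjF_wf (by omega) (vis_bvar (by omega)) hu.succ⟩

theorem strongF_wf (d : ℕ) : (strongF d).Wf d := by
  refine ⟨by omega, by omega, by omega, ⟨?_, ?_⟩, ⟨?_, ?_⟩, ⟨?_, ?_⟩, reachF_wf ?_ ?_,
    reachF_wf ?_ ?_⟩ <;> exact vis_bvar (by omega)

theorem reachF_holds {n : ℕ} {E H : List (ℕ × ℕ)} (hE : Below n E) {s : State} (hs : Rep n E H s)
    {v u d : ℕ} (hv : Vis d v) (hu : Vis d u) {ρ : ℕ → ℕ} (hρ : ∀ N < 3, ρ N = s.reg N) :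
    (reachF v u d).Holds d ρ s.arr ↔ Reach E H (ρ v) (ρ u) := by
  have h0 : ∀ N < 3, N ≠ bvar d := by unfold bvar; omega
  have h1 := hv.ne_bvar (i := d) le_rfl
  have h2 := hu.ne_bvar (i := d) le_rfl
  have h3 := vis_bvar (d := d + 1) (i := d) (by omega)
  simp only [reachF, Fm.or, Fm.Holds, adjF_holds, hv.succ, hu.succ, h3, Function.update_apply,
    h0 1 (by omega), h0 2 (by omega), h1, h2, if_true, if_false, hρ 0 (by omega), hρ 1 (by omega),
    hρ 2 (by omega), hs.reg_zero, hs.reg_one, hs.reg_two, ← hs.edges.lAdj_iff,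
    ← hs.output.lAdj_iff]
  refine exists_congr fun w => ?_
  rw [← or_iff_not_and_not]
  -- The bound on the witness is automatic, since it occurs in `E`.
  exact ⟨fun h => h.2, fun h => ⟨(h.1.lt hE).2, h⟩⟩

/-- Every reached vertex is an entry of `E` or `H` and so less than `n`; hence the bounded
quantifiers of the formula lose nothing. -/
theorem strongF_holds {n : ℕ} {E H : List (ℕ × ℕ)} (hE : Below n E) (hH : Below n H) {s : State}
    (hs : Rep n E H s) (d : ℕ) : (strongF d).Holds d s.reg s.arr ↔ Strong n E H := by
  have h0 : ∀ i, ∀ N < 3, N ≠ bvar i := by intro i N h; unfold bvar; omega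
  have hlt : ∀ {v u}, Reach E H v u → u < n := by
    rintro v u ⟨w, -, -, h | h⟩
    exacts [(h.lt hE).2, (h.lt hH).2]
  have hr : ∀ {v u d : ℕ} (hv : Vis d v) (hu : Vis d u) {ρ : ℕ → ℕ}
    (_ : ρ 0 = s.reg 0 ∧ ρ 1 = s.reg 1 ∧ ρ 2 = s.reg 2),
      (reachF v u d).Holds d ρ s.arr ↔ Reach E H (ρ v) (ρ u) := by
    intro v u d hv hu ρ ⟨h1, h2, h3⟩
    exact reachF_holds hE hs hv hu fun N hN => by interval_cases N <;> assumption
  simp only [strongF, Fm.Holds]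
  simp only [Function.update_apply, bvar_inj, h0 _ 0 (by omega), hs.reg_zero, if_false, if_true]
  rw [show ∀ P : ℕ → Prop, (¬ ∃ j < n, ¬ P j) ↔ ∀ j < n, P j by simp]
  have hd : d ≠ d + 1 + 1 := by omega
  refine forall₂_congr fun v hv => ?_
  constructor
  · rintro ⟨u, hu, u', hu', h1, h2, h3, h4, h5⟩
    rw [hr (vis_bvar (by omega)) (vis_bvar (by omega))] at h4 h5
    · simp [bvar_inj, hd] at h1 h2 h3 h4 h5
      exact ⟨u, u', h1, h2, h3, h4, h5⟩
    · simp [h0]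
    · simp [h0]
  · rintro ⟨u, u', h1, h2, h3, h4, h5⟩
    refine ⟨u, hlt h4, u', hlt h5, by simpa using h1, by simpa [hd] using h2, by simpa [hd] using h3, ?_⟩
    rw [hr (vis_bvar (by omega)) (vis_bvar (by omega)), hr (vis_bvar (by omega)) (vis_bvar (by omega))]
    · simpa [bvar_inj, Function.update_apply, hd] using ⟨h4, h5⟩
    · simp [h0]
    · simp [h0]

/-- Search for `k` additional output edges that complete a strong transformation. -/
def search : ℕ → ℕ → Prog
  | 0, d => (strongF d).compile d
  | k + 1, d => exProg d 0 (exProg (d + 1) 0 (.store 2 2 (bvar d) ;; .store 3 2 (bvar (d + 1)) ;;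
      .incr 2 ;; search k (d + 2) ;; .const 4 0 ;; .ite (.lt 4 3) .nop (.decr 2)))

/-- A bound for the time of `search k d`, when the numbers in registers 0, 1 and 2 stay below
`X`. -/
def searchTime : ℕ → ℕ → ℕ
  | 0, X => (strongF 0).time X
  | k + 1, X => X * (X * (searchTime k X + 6 + 5) + 3 + 5) + 3

theorem strongF_time (d X : ℕ) : (strongF d).time X = (strongF 0).time X := rfl

theorem Below.append {n : ℕ} {H L : List (ℕ × ℕ)} (hH : Below n H) (hL : Below n L) :
    Below n (H ++ L) := by
  intro e he
  rcases List.mem_append.mp he with h | h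
  exacts [hH e h, hL e h]

theorem Rep.setReg {n : ℕ} {E H : List (ℕ × ℕ)} {s : State} (h : Rep n E H s) {x : ℕ} (hx : 3 ≤ x)
    (v : ℕ) : Rep n E H (s.setReg x v) := by
  refine ⟨?_, ?_, ?_, h.edges, h.output⟩ <;> rw [State.setReg_reg, if_neg (by omega)]
  exacts [h.reg_zero, h.reg_one, h.reg_two]

/-- All ordered pairs of vertices are tried, loops and old edges included, so the search covers
every list of length `k`. After a failure a pair is withdrawn by decrementing register 2 alone:
cells beyond the length are irrelevant to `Rep`. -/
theorem search_runs {n : ℕ} {E : List (ℕ × ℕ)} (hE : Below n E) (k d : ℕ) {X : ℕ} {s : State}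
    {H : List (ℕ × ℕ)} (hs : Rep n E H s) (hH : Below n H) (hn : n ≤ X) (hm : E.length ≤ X)
    (hX : H.length + k ≤ X) :
    Runs (search k d) s (searchTime k X) fun s' => (∀ x, Low d x → s'.reg x = s.reg x) ∧
      s'.reg 0 = n ∧
      (s'.reg 3 = 1 ∧ (∃ L, L.length = k ∧ Below n L ∧ Strong n E (H ++ L) ∧ Rep n E (H ++ L) s') ∨
        s'.reg 3 = 0 ∧ Rep n E H s' ∧
          ∀ L : List (ℕ × ℕ), L.length = k → Below n L → ¬ Strong n E (H ++ L)) := by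
  induction k generalizing d s H with
  | zero =>
    have hreg : ∀ N < 3, s.reg N ≤ X := by
      intro N hN
      interval_cases N
      exacts [hs.reg_zero ▸ hn, hs.reg_one ▸ hm, hs.reg_two ▸ (by omega)]
    refine (Fm.compile_runs (strongF_wf d) hreg).mono (strongF_time d X).le fun s' ⟨h1, h2, h3⟩ => ?_
    have hr : Rep n E H s' := by
      refine ⟨?_, ?_, ?_, fun i e => ?_, fun i e => ?_⟩
      · rw [h2 0 (by omega), hs.reg_zero]
      · rw [h2 1 (by omega), hs.reg_one]
      · rw [h2 2 (by omega), hs.reg_two]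
      · rw [h1]; exact hs.edges i e
      · rw [h1]; exact hs.output i e
    rw [strongF_holds hE hH hs] at h3
    refine ⟨fun x hx => h2 x (.inr hx), hr.reg_zero, h3.imp (fun h => ⟨h.1, [], rfl, ?_, ?_, ?_⟩)
      fun h => ⟨h.1, hr, fun L hL _ => ?_⟩⟩
    · simp [Below]
    · simpa using h.2
    · simpa using hr
    · obtain rfl := List.length_eq_zero_iff.mp hL; simpa using h.2
  | succ k ih =>
    let Done : State → Prop := fun s' => (∀ x, Low d x → s'.reg x = s.reg x) ∧ s'.reg 0 = n ∧
      ∃ L, L.length = k + 1 ∧ Below n L ∧ Strong n E (H ++ L) ∧ Rep n E (H ++ L) s'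
    let None : ℕ → ℕ → Prop := fun u v =>
      ∀ L : List (ℕ × ℕ), L.length = k → Below n L → ¬ Strong n E (H ++ (u, v) :: L)
    let I : State → Prop := fun s' => (∀ x, Low d x → s'.reg x = s.reg x) ∧ Rep n E H s'
    have hI : ∀ s x v, x = 3 ∨ x = 4 ∨ x = bvar d ∨ x = bctr d → I s → I (s.setReg x v) := by
      rintro s x v hx ⟨h1, h2⟩
      have hx' : 3 ≤ x ∧ ¬ Low d x := by unfold Low bvar bctr at *; omega
      refine ⟨fun y hy => ?_, h2.setReg hx'.1 v⟩
      rw [State.setReg_reg, if_neg (by rintro rfl; exact hx'.2 hy), h1 y hy]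
    have hD : ∀ s x v, x = 4 ∨ x = bctr d → Done s → Done (s.setReg x v) := by
      rintro s x v hx ⟨h1, h2, L, h3, h4, h5, h6⟩
      have hx' : 3 ≤ x ∧ ¬ Low d x := by unfold Low bvar bctr at *; omega
      have h7 := h6.setReg hx'.1 v
      refine ⟨fun y hy => ?_, h7.reg_zero, L, h3, h4, h5, h7⟩
      rw [State.setReg_reg, if_neg (by rintro rfl; exact hx'.2 hy), h1 y hy]
    refine Runs.mono (Runs.exProg (n := n) (T := n * (searchTime k X + 6 + 5) + 3) (Inv := I)
      (Good := fun _ s' => Done s') (Bad := fun u => ∀ v < n, None u v) (by omega) hI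
      (fun _ => hD) (fun u s₁ hu h₁ hn₁ hu₁ => ?_) ⟨fun _ _ => rfl, hs⟩ hs.reg_zero)
      (by simp only [searchTime]; gcongr) ?_
    · let J : State → Prop := fun s' => I s' ∧ s'.reg (bvar d) = u ∧ s'.reg (bctr d) = s₁.reg (bctr d)
      have hIJ : ∀ x, x = 3 ∨ x = 4 ∨ x = bvar (d + 1) ∨ x = bctr (d + 1) →
          3 ≤ x ∧ ¬ Low d x ∧ bvar d ≠ x ∧ bctr d ≠ x := by unfold Low bvar bctr; omega
      refine Runs.mono (Runs.exProg (n := n) (T := searchTime k X + 6) (Inv := J)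
        (Good := fun _ s' => Done s' ∧ s'.reg (bctr d) = s₁.reg (bctr d))
        (Bad := fun v => None u v) (by omega) ?_ ?_ (fun v s₂ hv h₂ hn₂ hv₂ => ?_)
        ⟨h₁, hu₁, rfl⟩ hn₁) le_rfl ?_
      · rintro s x v hx ⟨⟨h1, h2⟩, h3, h4⟩
        obtain ⟨a, b, e, f⟩ := hIJ x hx
        refine ⟨⟨fun y hy => ?_, h2.setReg a v⟩, ?_, ?_⟩
        · rw [State.setReg_reg, if_neg (by rintro rfl; exact b hy), h1 y hy]
        · rw [State.setReg_reg, if_neg e, h3]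
        · rw [State.setReg_reg, if_neg f, h4]
      · rintro _ s x v hx ⟨⟨h1, h2, L, h3, h4, h5, h6⟩, h7⟩
        obtain ⟨a, b, e, f⟩ := hIJ x (by tauto)
        refine ⟨⟨fun y hy => ?_, ?_, L, h3, h4, h5, h6.setReg a v⟩, ?_⟩
        · rw [State.setReg_reg, if_neg (by rintro rfl; exact b hy), h1 y hy]
        · exact (h6.setReg a v).reg_zero
        · rw [State.setReg_reg, if_neg f, h7]
      · obtain ⟨⟨g1, g2⟩, g3, g4⟩ := h₂
        have q1 : bvar d ≠ 2 ∧ bvar (d + 1) ≠ 2 := by unfold bvar; omega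
        have q2 : ∀ x, Low d x ∨ x = bctr d ∨ x = bctr (d + 1) ∨ x = bvar d →
            Low (d + 2) x ∧ x ≠ 2 ∧ x ≠ 4 := by
          unfold Low bvar bctr; omega
        have q3 : Below n (H ++ [(u, v)]) := hH.append (by simpa [Below] using ⟨hu, hv⟩)
        let s₃ : State := ((s₂.setArr 2 (s₂.reg 2) (s₂.reg (bvar d))).setArr 3 (s₂.reg 2)
          (s₂.reg (bvar (d + 1)))).setReg 2 (s₂.reg 2 + 1)
        have h₃ : Rep n E (H ++ [(u, v)]) s₃ := by
          refine ⟨?_, ?_, ?_, fun i e he => ?_, Stores.append_singleton.mpr ⟨fun i e he => ?_, ?_, ?_⟩⟩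
          · simpa [s₃] using g2.reg_zero
          · simpa [s₃] using g2.reg_one
          · simp [s₃, g2.reg_two]
          · simpa [s₃] using g2.edges i e he
          · have hi : i ≠ H.length := (List.getElem?_eq_some_iff.mp he).1.ne
            simpa [s₃, g2.reg_two, hi] using g2.output i e he
          · simp [s₃, g2.reg_two, g3]
          · simp [s₃, g2.reg_two, hv₂]
        refine Runs.mono (T := 1 + (1 + (1 + (searchTime k X + 3)))) ?_ (by omega) fun _ => id
        refine Runs.seq (Runs.of_wp (p := .store 2 2 (bvar d))
          (Q := fun s' => s' = s₂.setArr 2 (s₂.reg 2) (s₂.reg (bvar d))) rfl) ?_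
        rintro _ rfl
        refine Runs.seq (Runs.of_wp (p := .store 3 2 (bvar (d + 1))) (Q := fun s' => s' =
          (s₂.setArr 2 (s₂.reg 2) (s₂.reg (bvar d))).setArr 3 (s₂.reg 2) (s₂.reg (bvar (d + 1))))
          rfl) ?_
        rintro _ rfl
        refine Runs.seq (Runs.of_wp (p := .incr 2) (Q := fun s' => s' = s₃) rfl) ?_
        rintro _ rfl
        refine Runs.seq (ih (d + 2) h₃ q3 (by simp; omega)) fun s₄ ⟨r1, r2, r3⟩ =>
          Runs.of_wp (p := .const 4 0 ;; .ite (.lt 4 3) .nop (.decr 2)) ?_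
        have r4 : ∀ x, Low d x ∨ x = bctr d ∨ x = bctr (d + 1) ∨ x = bvar d →
            s₄.reg x = s₂.reg x := by
          intro x hx
          obtain ⟨a, b, -⟩ := q2 x hx
          rw [r1 x a]; simp [s₃, b]
        rcases r3 with ⟨r5, L, r6, r7, r8, r9⟩ | ⟨r5, r6, r7⟩ <;>
          simp only [wp, Test.Holds, State.setReg_reg, r5]
        · refine ⟨fun _ => ⟨?_, ?_, .inl ⟨by simp, ⟨fun y hy => ?_, ?_, (u, v) :: L, ?_, ?_, ?_,
            ?_⟩, ?_⟩⟩, by simp⟩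
          · rw [if_neg (q2 _ (by tauto)).2.2, r4 _ (by tauto)]
          · simpa using r2
          · rw [State.setReg_reg, if_neg (q2 y (by tauto)).2.2, r4 y (by tauto), g1 y hy]
          · simpa using r2
          · simp [r6]
          · intro e he
            rcases List.mem_cons.mp he with rfl | he
            exacts [⟨hu, hv⟩, r7 e he]
          · simpa using r8
          · simpa using r9.setReg (x := 4) (by omega) 0
          · rw [if_neg (q2 _ (by tauto)).2.2, r4 _ (by tauto), g4]
        · refine ⟨by simp, fun _ => ⟨?_, ?_, .inr ⟨by simp, fun L hL hb hS => ?_, ⟨fun y hy => ?_,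
            ?_⟩, ?_, ?_⟩⟩⟩
          · rw [if_neg (q2 _ (by tauto)).2.1, if_neg (q2 _ (by tauto)).2.2, r4 _ (by tauto)]
          · simpa using r2
          · exact r7 L hL hb (by simpa using hS)
          · rw [State.setReg_reg, State.setReg_reg, if_neg (q2 y (by tauto)).2.1,
              if_neg (q2 y (by tauto)).2.2, r4 y (by tauto), g1 y hy]
          · refine ⟨?_, ?_, ?_, r6.edges, (Stores.append_singleton.mp r6.output).1⟩
            · simpa using r6.reg_zero
            · simpa using r6.reg_one
            · simp [r6.reg_two]
          · rw [State.setReg_reg, State.setReg_reg, if_neg (q2 _ (by tauto)).2.1,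
              if_neg (q2 _ (by tauto)).2.2, r4 _ (by tauto), g3]
          · rw [State.setReg_reg, State.setReg_reg, if_neg (q2 _ (by tauto)).2.1,
              if_neg (q2 _ (by tauto)).2.2, r4 _ (by tauto), g4]
      · rintro s₄ (⟨r1, v, -, r2, r3⟩ | ⟨r1, r2, r3, r4, r5⟩)
        · exact ⟨r3, r2.2.1, .inl ⟨r1, r2⟩⟩
        · exact ⟨r5, r3.2.reg_zero, .inr ⟨r1, r2, r3⟩⟩
    · rintro s' (⟨h1, -, -, h2, h3, h4⟩ | ⟨h1, h2, h3, h4⟩)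
      · exact ⟨h2, h3, .inl ⟨h1, h4⟩⟩
      · refine ⟨h3, h4.reg_zero, .inr ⟨h1, h4, fun L hL hb => ?_⟩⟩
        obtain ⟨⟨u, v⟩, L, rfl⟩ := List.exists_cons_of_length_eq_add_one hL
        have := hb (u, v) (by simp)
        exact h2 u this.1 v this.2 L (by simpa using hL) fun e he => hb e (by simp [he])

/-- Each additional pair means two nested loops and raises the exponent by two. -/
theorem searchTime_le (k : ℕ) : ∃ c e, ∀ X, searchTime k X ≤ c * (X + 1) ^ e := by
  induction k with
  | zero => exact Fm.time_le _
  | succ k ih =>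
    obtain ⟨c, e, h⟩ := ih
    refine ⟨c + 22, e + 2, fun X => ?_⟩
    have h1 := h X
    have h2 : 1 ≤ (X + 1) ^ e := Nat.one_le_pow _ _ (by omega)
    simp only [searchTime]
    generalize hY : (X + 1) ^ e = Y at *
    calc X * (X * (searchTime k X + 6 + 5) + 3 + 5) + 3
        ≤ X * (X * (c * Y + 6 + 5) + 3 + 5) + 3 := by gcongr
      _ ≤ (c + 22) * (Y * (X + 1) ^ 2) := by nlinarith [Nat.zero_le (X * X * c * Y), Nat.zero_le (X * c * Y), Nat.mul_le_mul_left (X * X) h2, Nat.mul_le_mul_left X h2, Nat.zero_le (c * Y)]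
      _ = _ := by rw [← hY]; ring

/-- Search for the least number, at most `K`, of additional output edges that complete a strong
transformation. -/
def searchUpTo : ℕ → Prog
  | 0 => search 0 0
  | K + 1 => searchUpTo K ;; .const 4 0 ;; .ite (.lt 4 3) .nop (search (K + 1) 0)

/-- The lengths are tried in increasing order, so the failures recorded before the first success
show that the completion found is a shortest one. -/
theorem searchUpTo_runs {n : ℕ} {E : List (ℕ × ℕ)} (hE : Below n E) (K : ℕ) {X : ℕ} {s : State}
    {H : List (ℕ × ℕ)} (hs : Rep n E H s) (hH : Below n H) (hn : n ≤ X) (hm : E.length ≤ X)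
    (hX : H.length + K ≤ X) (hX' : 0 < X) :
    Runs (searchUpTo K) s ((K + 1) * (searchTime K X + 2)) fun s' =>
      (s'.reg 3 = 1 ∧ (∃ L, Below n L ∧ Strong n E (H ++ L) ∧ Rep n E (H ++ L) s' ∧
        ∀ L', Below n L' → Strong n E (H ++ L') → L.length ≤ L'.length)) ∨
      s'.reg 3 = 0 ∧ Rep n E H s' ∧
          ∀ L : List (ℕ × ℕ), L.length ≤ K → Below n L → ¬ Strong n E (H ++ L) := by
  -- For positive `X` the deepest search is the most expensive one, so its time can be charged for
  -- each depth.
  have hmono : ∀ k, searchTime k X ≤ searchTime (k + 1) X := by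
    intro k
    simp only [searchTime]
    calc searchTime k X ≤ searchTime k X + 6 + 5 := by omega
      _ ≤ X * (searchTime k X + 6 + 5) := Nat.le_mul_of_pos_left _ hX'
      _ ≤ X * (searchTime k X + 6 + 5) + 3 + 5 := by omega
      _ ≤ X * (X * (searchTime k X + 6 + 5) + 3 + 5) := Nat.le_mul_of_pos_left _ hX'
      _ ≤ _ := by omega
  induction K with
  | zero =>
    refine (search_runs hE 0 0 hs hH hn hm hX).mono (by omega) ?_
    rintro s' ⟨-, -, ⟨h1, L, h2, h3, h4, h5⟩ | ⟨h1, h2, h3⟩⟩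
    · exact .inl ⟨h1, L, h3, h4, h5, fun L' _ _ => by omega⟩
    · exact .inr ⟨h1, h2, fun L hL => h3 L (by omega)⟩
  | succ K ih =>
    refine Runs.mono (Runs.seq (ih (by omega)) fun s₁ h₁ => Runs.seq (T₁ := 1)
      (R := fun s₂ => s₂ = s₁.setReg 4 0) (Runs.of_wp (p := .const 4 0) rfl)
      (T₂ := searchTime (K + 1) X + 1) ?_) (by have := hmono K; nlinarith [Nat.mul_le_mul_left (K+1) this])
      fun _ => id
    rintro _ rfl
    rcases h₁ with ⟨h1, L, h2, h3, h4, h5⟩ | ⟨h1, h2, h3⟩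
    · refine Runs.ite (fun _ => ?_) fun h => ?_
      · refine (Runs.of_wp (p := .nop) (Q := fun s' => s' = s₁.setReg 4 0) rfl).mono
          (by simp only [cost, searchTime]; omega) fun s' h => .inl ?_
        subst h
        exact ⟨by simpa using h1, L, h2, h3, h4.setReg (by omega) 0, h5⟩
      · simp [Test.Holds, h1] at h
    · refine Runs.ite (fun h => ?_) fun _ => ?_
      · simp [Test.Holds, h1] at h
      · refine (search_runs hE (K + 1) 0 (h2.setReg (x := 4) (by omega) 0) hH hn hm hX).mono le_rfl ?_
        rintro s' ⟨-, -, ⟨g1, L, g2, g3, g4, g5⟩ | ⟨g1, g2, g3⟩⟩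
        · refine .inl ⟨g1, L, g3, g4, g5, fun L' hb hS => ?_⟩
          by_contra hlt
          exact h3 L' (by omega) hb hS
        · refine .inr ⟨g1, g2, fun L hL hb => ?_⟩
          rcases Nat.le_succ_iff.mp hL with hL | hL
          exacts [h3 L hL hb, g3 L hL hb]

end GraphAnon

namespace GraphAnon

/-! ### Deficient vertices -/

/-- What the first two passes over the edges compute. -/
structure Data where
  /-- the degree -/
  deg : ℕ → ℕ
  /-- the first neighbour -/
  nb1 : ℕ → ℕ
  /-- the second neighbour -/
  nb2 : ℕ → ℕ
  /-- whether two vertices are known to be reached -/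
  ok : ℕ → ℕ
  /-- zero, or one more than the only vertex that is reached -/
  xx : ℕ → ℕ
  /-- a neighbour of degree two through which it is reached -/
  tt : ℕ → ℕ

/-- The data is correct for the graph on `n` vertices with edges `E`, which has no isolated
vertices. -/
structure Prep (n : ℕ) (E : List (ℕ × ℕ)) (d : Data) : Prop where
  below : Below n E
  irrefl : ∀ v, ¬ LAdj E v v
  nb1 : ∀ v < n, LAdj E v (d.nb1 v)
  deg_one : ∀ v < n, d.deg v < 2 → ∀ w, LAdj E v w → w = d.nb1 v
  nb2 : ∀ v < n, 2 ≤ d.deg v → LAdj E v (d.nb2 v) ∧ d.nb1 v ≠ d.nb2 v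
  deg_two : ∀ v < n, d.deg v = 2 → ∀ w, LAdj E v w → w = d.nb1 v ∨ w = d.nb2 v
  sat : ∀ v < n, d.ok v ≠ 0 → Sat E [] v
  reach : ∀ v < n, d.ok v = 0 → ∀ w, LAdj E v w → ∀ u, LAdj E w u → u ≠ v → d.xx v = u + 1
  tt : ∀ v < n, d.ok v = 0 → d.xx v ≠ 0 → LAdj E v (d.tt v) ∧ d.deg (d.tt v) = 2 ∧
    LAdj E (d.tt v) (d.xx v - 1) ∧ d.xx v - 1 ≠ v

namespace Data

/-- `v` is the centre of a component that is a star with at least two leaves. -/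
def Star (d : Data) (v : ℕ) : Prop := d.ok v = 0 ∧ d.xx v = 0 ∧ 2 ≤ d.deg v

/-- `v` is the smaller vertex of a component with two vertices. -/
def Pair (d : Data) (v : ℕ) : Prop := d.ok v = 0 ∧ d.xx v = 0 ∧ d.deg v < 2 ∧ v < d.nb1 v

/-- Exactly one vertex is reached from `v`, and it is larger if the same holds for it. -/
def Lead (d : Data) (v : ℕ) : Prop :=
  d.ok v = 0 ∧ d.xx v ≠ 0 ∧ ¬ (d.xx v - 1 < v ∧ d.ok (d.xx v - 1) = 0)

/-- The number of ends of added edges that `v` demands. -/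
def dem (d : Data) (v : ℕ) : ℕ :=
  if d.ok v = 0 then
    if d.xx v = 0 then
      if d.deg v < 2 then if v < d.nb1 v then 4 else 0 else 2
    else if d.xx v - 1 < v ∧ d.ok (d.xx v - 1) = 0 then 0 else 1
  else 0

/-- The vertices that can serve the demand of `v`. -/
def Own (d : Data) (E : List (ℕ × ℕ)) (v z : ℕ) : Prop :=
  (d.Star v ∨ d.Lead v) ∧ LAdj E v z ∨ d.Pair v ∧ (z = v ∨ z = d.nb1 v)

theorem dem_cases (d : Data) (v : ℕ) : d.Star v ∧ d.dem v = 2 ∨ d.Pair v ∧ d.dem v = 4 ∨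
    d.Lead v ∧ d.dem v = 1 ∨ d.dem v = 0 ∧ ¬ d.Star v ∧ ¬ d.Pair v ∧ ¬ d.Lead v := by
  unfold Star Pair Lead dem
  by_cases h1 : d.ok v = 0 <;> by_cases h2 : d.xx v = 0 <;> by_cases h3 : d.deg v < 2 <;>
    by_cases h4 : v < d.nb1 v <;> by_cases h5 : d.xx v - 1 < v ∧ d.ok (d.xx v - 1) = 0 <;>
    simp [h1, h2, h3, h4, h5] <;> omega

end Data

section
variable {n : ℕ} {E : List (ℕ × ℕ)} {d : Data}

/-- When nothing is reached from `v`, every walk of length two from `v` returns to `v`; the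
component is a star centred at `v`. -/
theorem Prep.pair_nb (hp : Prep n E d) {v : ℕ} (hv : v < n) (h : d.ok v = 0) (h' : d.xx v = 0)
    {w u : ℕ} (hw : LAdj E v w) (hu : LAdj E w u) : u = v := by
  by_contra hne
  have := hp.reach v hv h w hw u hu hne
  omega

/-- The two vertices of a component with two vertices have the same data. -/
theorem Prep.pair_symm (hp : Prep n E d) {v w : ℕ} (hv : v < n) (h : d.ok v = 0) (h' : d.xx v = 0)
    (h2 : d.deg v < 2) (hw : w = d.nb1 v) : w < n ∧ d.ok w = 0 ∧ d.xx w = 0 ∧ d.deg w < 2 ∧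
      d.nb1 w = v := by
  subst hw
  have hvw := hp.nb1 v hv
  have hw := (hvw.lt hp.below).2
  have h3 : d.nb1 (d.nb1 v) = v := hp.pair_nb hv h h' hvw (hp.nb1 _ hw)
  have h4 : d.deg (d.nb1 v) < 2 := by
    by_contra hc
    have := hp.nb2 _ hw (by omega)
    -- A second neighbour of `nb1 v` would also have to be `v`.
    exact this.2 (h3.trans (hp.pair_nb hv h h' hvw this.1).symm)
  have h5 : d.ok (d.nb1 v) = 0 := by
    by_contra hc
    obtain ⟨u, u', h6, h7, h8, ⟨x, hx, hxu, hx'⟩, -⟩ := hp.sat _ hw hc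
    obtain rfl := hp.pair_nb hv h h' hvw hx
    rcases hx' with hx' | hx'
    · exact h7 (hp.deg_one _ hv h2 _ hx')
    · simp [LAdj] at hx'
  refine ⟨hw, h5, ?_, h4, h3⟩
  by_contra hc
  have h6 := hp.tt _ hw h5 hc
  have := hp.pair_nb hv h h' hvw h6.1
  rw [this] at h6
  omega

theorem Prep.own_lt (hp : Prep n E d) {v z : ℕ} (hv : v < n) (h : d.Own E v z) : z < n := by
  rcases h with ⟨-, h⟩ | ⟨-, rfl | rfl⟩
  exacts [(h.lt hp.below).2, hv, ((hp.nb1 v hv).lt hp.below).2]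

/-- If `v` and `v'` have a common neighbour, each is reached from the other. A star centre reaches
nothing, and of two vertices that reach only each other just one leads. The vertices of a two-vertex
component have no neighbours outside it. This disjointness drives the lower bound, and it also keeps
the greedy steps from interfering with one another. -/
theorem Prep.own_unique (hp : Prep n E d) {v v' z : ℕ} (hv : v < n) (hv' : v' < n)
    (h : d.Own E v z) (h' : d.Own E v' z) : v = v' := by
  have key : ∀ {v v'}, v < n → v' < n → d.Pair v → d.Own E v' z → z = v ∨ z = d.nb1 v → v = v' := by
    rintro v v' hv hv' hP h hz
    obtain ⟨g1, g2, g3, g4⟩ := hP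
    obtain ⟨k1, k2, k3, k4, k5⟩ := hp.pair_symm hv g1 g2 g3 rfl
    rcases h with ⟨h, hz'⟩ | ⟨h, hz'⟩
    · have hz' := hz'.symm
      exfalso
      have : v' = v ∨ v' = d.nb1 v := by
        rcases hz with rfl | rfl
        · exact .inr (hp.deg_one _ hv g3 _ hz')
        · exact .inl ((hp.deg_one _ k1 k4 _ hz').trans k5)
      rcases this with rfl | rfl
      · rcases h with h | h
        · exact absurd h.2.2 (by omega)
        · exact h.2.1 g2
      · rcases h with h | h
        · exact absurd h.2.2 (by omega)
        · exact h.2.1 k3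
    · obtain ⟨g1', g2', g3', g4'⟩ := h
      obtain ⟨k1', k2', k3', k4', k5'⟩ := hp.pair_symm hv' g1' g2' g3' rfl
      rcases hz with rfl | rfl <;> rcases hz' with hz' | hz'
      · exact hz'
      · rw [← hz'] at k5'; omega
      · rw [hz'] at k5; omega
      · rw [← k5, ← k5', hz']
  rcases h with ⟨h, hz⟩ | ⟨h, hz⟩
  · rcases h' with ⟨h', hz'⟩ | ⟨h', hz'⟩
    · by_contra hne
      have h0 : d.ok v = 0 := h.elim (·.1) (·.1)
      have h0' : d.ok v' = 0 := h'.elim (·.1) (·.1)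
      have h1 := hp.reach v hv h0 z hz v' hz'.symm (Ne.symm hne)
      have h2 := hp.reach v' hv' h0' z hz' v hz.symm hne
      rcases h with h | h
      · have := h.2.1; omega
      · rcases h' with h' | h'
        · have := h'.2.1; omega
        -- Each is the only vertex reached from the other and neither is known to be satisfied, so
        -- leading would give both `v ≤ v'` and `v' ≤ v`.
        · have a := h.2.2; have b := h'.2.2
          rw [h1, Nat.add_sub_cancel] at a
          rw [h2, Nat.add_sub_cancel] at b
          simp only [h0, h0', and_true] at a b
          omega
    · exact (key hv' hv h' (.inl ⟨h, hz⟩) hz').symm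
  · exact key hv hv' h h' hz

/-! ### Serving the demands is sufficient -/

/-- Two different vertices are joined by `H` to `x` and to `y`. -/
def Spread (H : List (ℕ × ℕ)) (x y : ℕ) : Prop := ∃ u u', u ≠ u' ∧ LAdj H x u ∧ LAdj H y u'

/-- The pairs in `H` join different vertices that are not adjacent. -/
def NonEdges (E H : List (ℕ × ℕ)) : Prop := ∀ x y, LAdj H x y → x ≠ y ∧ ¬ LAdj E x y

/-- A new edge at a neighbour `b` of `v` ends in a vertex not adjacent to `b` in `E`, hence neither
in `v` nor in a vertex that was reached through `b` before. So each new edge in the right place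
yields a genuinely new reached vertex. -/
theorem Prep.strong_of_served (hp : Prep n E d) {H : List (ℕ × ℕ)} (hH : NonEdges E H)
    (hS : ∀ v < n, d.Star v → Spread H (d.nb1 v) (d.nb2 v))
    (hP : ∀ v < n, d.Pair v → Spread H v v ∧ Spread H (d.nb1 v) (d.nb1 v))
    (hL : ∀ v < n, d.Lead v → ∃ u, LAdj H (d.tt v) u) : Strong n E H := by
  have hpair : ∀ {v w : ℕ}, LAdj E v w → Spread H w w → Sat E H v := by
    rintro v w hvw ⟨u, u', h1, h2, h3⟩
    exact ⟨u, u', h1, fun h => (hH _ _ h2).2 (h ▸ hvw.symm), fun h => (hH _ _ h3).2 (h ▸ hvw.symm),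
      ⟨w, hvw, (hH _ _ h2).1, .inr h2⟩, ⟨w, hvw, (hH _ _ h3).1, .inr h3⟩⟩
  have hlead : ∀ {v b y u : ℕ}, LAdj E v b → LAdj E b y → y ≠ v → LAdj H b u → Sat E H v := by
    intro v b y u h1 h2 h3 h4
    have h5 := hH _ _ h4
    exact ⟨y, u, fun h => h5.2 (h ▸ h2), h3, fun h => h5.2 (h ▸ h1.symm),
      ⟨b, h1, fun h => hp.irrefl b (by rw [← h] at h2; exact h2), .inl h2⟩, ⟨b, h1, h5.1, .inr h4⟩⟩
  intro v hv
  by_cases h0 : d.ok v = 0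
  swap
  · obtain ⟨u, u', h1, h2, h3, ⟨w, h4, h5, h6⟩, ⟨w', h4', h5', h6'⟩⟩ := hp.sat v hv h0
    simp only [LAdj, List.not_mem_nil, or_false] at h6 h6'
    exact ⟨u, u', h1, h2, h3, ⟨w, h4, h5, .inl h6⟩, ⟨w', h4', h5', .inl h6'⟩⟩
  by_cases h1 : d.xx v = 0
  · rcases Nat.lt_or_ge (d.deg v) 2 with h2 | h2
    · obtain ⟨k1, k2, k3, k4, k5⟩ := hp.pair_symm hv h0 h1 h2 rfl
      have hvw := hp.nb1 v hv
      rcases lt_trichotomy v (d.nb1 v) with hlt | heq | hlt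
      · exact hpair hvw (hP v hv ⟨h0, h1, h2, hlt⟩).2
      · rw [← heq] at hvw; exact (hp.irrefl v hvw).elim
      · exact hpair hvw (hP (d.nb1 v) k1 ⟨k2, k3, k4, by omega⟩).1
    · obtain ⟨u, u', g1, g2, g3⟩ := hS v hv ⟨h0, h1, h2⟩
      have k1 := hp.nb1 v hv
      have k2 := (hp.nb2 v hv h2).1
      exact ⟨u, u', g1, fun h => (hH _ _ g2).2 (h ▸ k1.symm), fun h => (hH _ _ g3).2 (h ▸ k2.symm),
        ⟨_, k1, (hH _ _ g2).1, .inr g2⟩, ⟨_, k2, (hH _ _ g3).1, .inr g3⟩⟩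
  · obtain ⟨g1, g2, g3, g4⟩ := hp.tt v hv h0 h1
    by_cases h2 : d.xx v - 1 < v ∧ d.ok (d.xx v - 1) = 0
    · set y := d.xx v - 1 with hy
      have hyn : y < n := by omega
      -- The walk through `tt v` read backwards shows that `v` is the only vertex reached from `y`.
      -- So `y` leads, and `tt y`, being adjacent to `v` as well, serves both.
      have hxy : d.xx y = v + 1 := hp.reach y hyn h2.2 _ g3.symm v g1.symm g4.symm
      have hLy : d.Lead y := by
        refine ⟨h2.2, by omega, fun h => ?_⟩
        rw [hxy, Nat.add_sub_cancel] at h; omega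
      obtain ⟨k1, k2, k3, k4⟩ := hp.tt y hyn h2.2 (by omega)
      rw [hxy, Nat.add_sub_cancel] at k3
      obtain ⟨u, hu⟩ := hL y hyn hLy
      exact hlead k3.symm k1.symm g4 hu
    · obtain ⟨u, hu⟩ := hL v hv ⟨h0, h1, h2⟩
      exact hlead g1 g3 g4 hu

/-! ### The lower bound -/

/-- The number of occurrences of `z` in the pairs of `H`. -/
def ends (H : List (ℕ × ℕ)) (z : ℕ) : ℕ :=
  H.countP (fun e => e.1 = z) + H.countP (fun e => e.2 = z)

theorem ends_append (H L : List (ℕ × ℕ)) (z : ℕ) : ends (H ++ L) z = ends H z + ends L z := by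
  simp only [ends, List.countP_append]; omega

theorem sum_ends_le (S : Finset ℕ) (H : List (ℕ × ℕ)) : ∑ z ∈ S, ends H z ≤ 2 * H.length := by
  induction H with
  | nil => simp [ends]
  | cons e H ih =>
    have : ∀ z, ends (e :: H) z = ends H z + ((if e.1 = z then 1 else 0) + if e.2 = z then 1 else 0) := by
      intro z; simp only [ends, List.countP_cons, decide_eq_true_eq]; omega
    simp only [this, Finset.sum_add_distrib, Finset.sum_ite_eq, List.length_cons]
    split_ifs <;> omega

theorem one_le_ends {H : List (ℕ × ℕ)} {z u : ℕ} (h : LAdj H z u) : 1 ≤ ends H z := by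
  rcases h with h | h
  · have : 0 < H.countP (fun e => e.1 = z) := List.countP_pos_iff.mpr ⟨_, h, by simp⟩
    unfold ends; omega
  · have : 0 < H.countP (fun e => e.2 = z) := List.countP_pos_iff.mpr ⟨_, h, by simp⟩
    unfold ends; omega

theorem ends_eq_zero {H : List (ℕ × ℕ)} {z : ℕ} (h : ∀ u, ¬ LAdj H z u) : ends H z = 0 := by
  unfold ends
  rw [Nat.add_eq_zero_iff, List.countP_eq_zero, List.countP_eq_zero]
  constructor <;> rintro ⟨a, b⟩ hm hz <;> simp at hz <;> subst hz
  exacts [h _ (.inl hm), h _ (.inr hm)]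

theorem List.two_le_countP {α : Type*} {p : α → Bool} {l : List α} {a b : α} (ha : a ∈ l)
    (hb : b ∈ l) (hab : a ≠ b) (hpa : p a) (hpb : p b) : 2 ≤ l.countP p := by
  classical
  rw [List.countP_eq_length_filter]
  refine le_trans ?_ (List.toFinset_card_le _)
  rw [← Finset.card_pair hab]
  refine Finset.card_le_card fun x hx => ?_
  simp only [Finset.mem_insert, Finset.mem_singleton] at hx
  rcases hx with rfl | rfl <;> simp [*]

theorem two_le_ends {H : List (ℕ × ℕ)} {z u u' : ℕ} (h : LAdj H z u) (h' : LAdj H z u')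
    (hne : u ≠ u') : 2 ≤ ends H z := by
  rcases h with h | h <;> rcases h' with h' | h'
  · have := List.two_le_countP (p := fun e => e.1 = z) h h' (by simpa using hne) (by simp) (by simp)
    unfold ends; omega
  · have h1 : 0 < H.countP (fun e => e.1 = z) := List.countP_pos_iff.mpr ⟨_, h, by simp⟩
    have h2 : 0 < H.countP (fun e => e.2 = z) := List.countP_pos_iff.mpr ⟨_, h', by simp⟩
    unfold ends; omega
  · have h1 : 0 < H.countP (fun e => e.2 = z) := List.countP_pos_iff.mpr ⟨_, h, by simp⟩
    have h2 : 0 < H.countP (fun e => e.1 = z) := List.countP_pos_iff.mpr ⟨_, h', by simp⟩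
    unfold ends; omega
  · have := List.two_le_countP (p := fun e => e.2 = z) h h' (by simpa using hne) (by simp) (by simp)
    unfold ends; omega

open Classical in
/-- Every strong transformation adds at least half as many edges as there are demanded ends. -/
theorem Prep.sum_dem_le (hp : Prep n E d) {H : List (ℕ × ℕ)} (hS : Strong n E H) :
    ∑ v ∈ Finset.range n, d.dem v ≤ 2 * H.length := by
  -- The places where the demand of `v` can be met. New edges must have at least `d.dem v` ends
  -- there, and these sets are disjoint.
  let S : ℕ → Finset ℕ := fun v => (Finset.range n).filter (d.Own E v)
  have hle : ∀ v ∈ Finset.range n, d.dem v ≤ ∑ z ∈ S v, ends H z := by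
    intro v hv
    rw [Finset.mem_range] at hv
    have h1 : ∀ {z}, d.Own E v z → z ∈ S v := fun {z} h =>
      Finset.mem_filter.mpr ⟨Finset.mem_range.mpr (hp.own_lt hv h), h⟩
    have hone : ∀ {z}, d.Own E v z → ends H z ≤ ∑ z ∈ S v, ends H z := fun h =>
      Finset.single_le_sum (f := ends H) (fun _ _ => Nat.zero_le _) (h1 h)
    have htwo : ∀ {z z'}, d.Own E v z → d.Own E v z' → z ≠ z' →
        ends H z + ends H z' ≤ ∑ z ∈ S v, ends H z := by
      intro z z' h h' hne
      rw [← Finset.sum_pair (f := ends H) hne]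
      refine Finset.sum_le_sum_of_subset fun x hx => ?_
      simp only [Finset.mem_insert, Finset.mem_singleton] at hx
      rcases hx with rfl | rfl
      exacts [h1 h, h1 h']
    have hreach : ∀ v < n, d.ok v = 0 → d.xx v = 0 → ∀ {u}, u ≠ v → Reach E H v u →
        ∃ w, LAdj E v w ∧ LAdj H w u := by
      rintro v hv h h' u hu ⟨w, hw, -, h2 | h2⟩
      · exact (hu (hp.pair_nb hv h h' hw h2)).elim
      · exact ⟨w, hw, h2⟩
    have hpair : ∀ v < n, d.ok v = 0 → d.xx v = 0 → d.deg v < 2 → 2 ≤ ends H (d.nb1 v) := by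
      intro v hv g1 g2 g3
      obtain ⟨u, u', k1, k2, k3, k4, k5⟩ := hS v hv
      obtain ⟨w, q1, q2⟩ := hreach v hv g1 g2 k2 k4
      obtain ⟨w', q1', q2'⟩ := hreach v hv g1 g2 k3 k5
      obtain rfl := hp.deg_one v hv g3 _ q1
      obtain rfl := hp.deg_one v hv g3 _ q1'
      exact two_le_ends q2 q2' k1
    obtain ⟨u, u', k1, k2, k3, k4, k5⟩ := hS v hv
    rcases d.dem_cases v with ⟨h, e⟩ | ⟨h, e⟩ | ⟨h, e⟩ | ⟨e, -⟩ <;> rw [e]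
    · obtain ⟨w, q1, q2⟩ := hreach v hv h.1 h.2.1 k2 k4
      obtain ⟨w', q1', q2'⟩ := hreach v hv h.1 h.2.1 k3 k5
      have o : d.Own E v w := .inl ⟨.inl h, q1⟩
      have o' : d.Own E v w' := .inl ⟨.inl h, q1'⟩
      -- Either one leaf has two new neighbours, or two leaves have one each.
      by_cases hww : w = w'
      · subst hww
        exact (two_le_ends q2 q2' k1).trans (hone o)
      · have := htwo o o' hww
        have := one_le_ends q2
        have := one_le_ends q2'
        omega
    · obtain ⟨g1, g2, g3, g4⟩ := id h
      obtain ⟨l1, l2, l3, l4, l5⟩ := hp.pair_symm hv g1 g2 g3 rfl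
      have e1 := hpair v hv g1 g2 g3
      have e2 := hpair _ l1 l2 l3 l4
      rw [l5] at e2
      have := htwo (z := v) (z' := d.nb1 v) (.inr ⟨h, .inl rfl⟩) (.inr ⟨h, .inr rfl⟩) g4.ne
      omega
    · obtain ⟨g1, g2, g3⟩ := id h
      -- One of the two reached vertices is not the old one, so a new edge at a neighbour of `v`
      -- leads to it.
      have : ∃ u, u ≠ v ∧ u + 1 ≠ d.xx v ∧ Reach E H v u := by
        by_cases hu : u + 1 = d.xx v
        · exact ⟨u', k3, by omega, k5⟩
        · exact ⟨u, k2, hu, k4⟩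
      obtain ⟨u, m1, m2, w, m3, -, m4 | m4⟩ := this
      · exact (m2 (hp.reach v hv g1 w m3 u m4 m1).symm).elim
      · exact (one_le_ends m4).trans (hone (.inl ⟨.inr h, m3⟩))
    · exact Nat.zero_le _
  calc ∑ v ∈ Finset.range n, d.dem v ≤ ∑ v ∈ Finset.range n, ∑ z ∈ S v, ends H z :=
        Finset.sum_le_sum hle
    _ = ∑ z ∈ (Finset.range n).biUnion S, ends H z := by
        rw [Finset.sum_biUnion]
        intro v hv v' hv' hne
        rw [Function.onFun, Finset.disjoint_left]
        intro z hz hz'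
        simp only [Finset.coe_range, Set.mem_Iio] at hv hv'
        exact hne (hp.own_unique hv hv' (Finset.mem_filter.mp hz).2 (Finset.mem_filter.mp hz').2)
    _ ≤ _ := sum_ends_le _ _

end

end GraphAnon

namespace GraphAnon

/-! ### Pairing the demanded ends -/

/-- The edges added so far, three slots for ends that wait for a partner (zero or one more than a
vertex), and likewise the smaller vertex of a component with two vertices that waits for another
such component. -/
structure Pool where
  /-- the added edges -/
  out : List (ℕ × ℕ)
  /-- the slots -/
  c : ℕ → ℕ
  /-- the waiting component -/
  pend : ℕ

namespace Pool

/-- Nothing has been done. -/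
def empty : Pool := ⟨[], fun _ => 0, 0⟩

/-- Join `t` to the vertex in slot `j`, or put it there if the slot is empty. -/
def useSlot (M : Pool) (t j : ℕ) : Pool :=
  if M.c j = 0 then { M with c := Function.update M.c j (t + 1) }
  else { M with out := M.out ++ [(M.c j - 1, t)], c := Function.update M.c j 0 }

/-- The first slot that does not hold a neighbour of `t`. -/
def slotFor (M : Pool) (d : Data) (t : ℕ) : ℕ :=
  if M.c 0 ≠ d.nb1 t + 1 ∧ M.c 0 ≠ d.nb2 t + 1 then 0
  else if M.c 1 ≠ d.nb1 t + 1 ∧ M.c 1 ≠ d.nb2 t + 1 then 1 else 2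

/-- Join the two vertices of the component of `v` to those of the waiting component. -/
def usePair (M : Pool) (d : Data) (v : ℕ) : Pool :=
  if M.pend = 0 then { M with pend := v + 1 }
  else { M with
    out := M.out ++ [(M.pend - 1, v), (M.pend - 1, d.nb1 v), (d.nb1 (M.pend - 1), v),
      (d.nb1 (M.pend - 1), d.nb1 v)]
    pend := 0 }

/-- Serve the demand of `v`. -/
def step (M : Pool) (d : Data) (v : ℕ) : Pool :=
  if d.ok v = 0 then
    if d.xx v = 0 then
      if d.deg v < 2 then if v < d.nb1 v then M.usePair d v else M
      else { M with out := M.out ++ [(d.nb1 v, d.nb2 v)] }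
    else if d.xx v - 1 < v ∧ d.ok (d.xx v - 1) = 0 then M
    else M.useSlot (d.tt v) (M.slotFor d (d.tt v))
  else M

/-- Serve the demands of the vertices less than `i`. -/
def upTo (d : Data) : ℕ → Pool
  | 0 => empty
  | i + 1 => (upTo d i).step d i

end Pool

/-- The list of edges, the pairs being regarded as unordered. -/
def unord (H : List (ℕ × ℕ)) : List (Sym2 ℕ) := H.map fun e => s(e.1, e.2)

theorem mem_unord {H : List (ℕ × ℕ)} {x y : ℕ} : s(x, y) ∈ unord H ↔ LAdj H x y := by
  simp only [unord, List.mem_map, Sym2.eq_iff, LAdj, Prod.exists]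
  constructor
  · rintro ⟨a, b, h, ⟨rfl, rfl⟩ | ⟨rfl, rfl⟩⟩
    exacts [.inl h, .inr h]
  · rintro (h | h)
    exacts [⟨_, _, h, .inl ⟨rfl, rfl⟩⟩, ⟨_, _, h, .inr ⟨rfl, rfl⟩⟩]

theorem unord_nodup_append {H F : List (ℕ × ℕ)} (hH : (unord H).Nodup) (hF : (unord F).Nodup)
    (h : ∀ x y, LAdj F x y → ¬ LAdj H x y) : (unord (H ++ F)).Nodup := by
  rw [unord, List.map_append]
  refine List.Nodup.append hH hF fun e he he' => ?_
  induction e with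
  | h x y => exact h x y (mem_unord.mp he') (mem_unord.mp he)

theorem lAdj_singleton {a b x y : ℕ} : LAdj [(a, b)] x y ↔ x = a ∧ y = b ∨ x = b ∧ y = a := by
  simp [LAdj]; tauto

theorem NonEdges.append {E H F : List (ℕ × ℕ)} (hH : NonEdges E H) (hF : NonEdges E F) :
    NonEdges E (H ++ F) := fun x y h => (lAdj_append.mp h).elim (hH x y) (hF x y)

theorem NonEdges.singleton {E : List (ℕ × ℕ)} {a b : ℕ} (h : a ≠ b) (h' : ¬ LAdj E a b) :
    NonEdges E [(a, b)] := by
  intro x y hxy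
  rcases lAdj_singleton.mp hxy with ⟨rfl, rfl⟩ | ⟨rfl, rfl⟩
  exacts [⟨h, h'⟩, ⟨h.symm, fun hc => h' hc.symm⟩]

theorem Spread.append {H F : List (ℕ × ℕ)} {x y : ℕ} (h : Spread H x y) : Spread (H ++ F) x y := by
  obtain ⟨u, u', h1, h2, h3⟩ := h
  exact ⟨u, u', h1, lAdj_append.mpr (.inl h2), lAdj_append.mpr (.inl h3)⟩

/-- No pair of `H` contains `z`. -/
def Untouched (H : List (ℕ × ℕ)) (z : ℕ) : Prop := ∀ u, ¬ LAdj H z u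

theorem Untouched.append_singleton {H : List (ℕ × ℕ)} {z a b : ℕ} (h : Untouched H z) (ha : z ≠ a)
    (hb : z ≠ b) : Untouched (H ++ [(a, b)]) z := by
  intro u hu
  rcases lAdj_append.mp hu with hu | hu
  · exact h u hu
  · rcases lAdj_singleton.mp hu with ⟨rfl, -⟩ | ⟨rfl, -⟩
    exacts [ha rfl, hb rfl]

section
variable {n : ℕ} {E : List (ℕ × ℕ)} {d : Data}

/-- The demands of the vertices less than `i` are served by the added edges, the slots, and the
waiting component, in the most economical way. -/
structure PoolInv (n : ℕ) (E : List (ℕ × ℕ)) (d : Data) (i : ℕ) (M : Pool) : Prop where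
  count : ∑ v ∈ Finset.range i, d.dem v = 2 * M.out.length +
    (∑ j ∈ Finset.range 3, if M.c j = 0 then 0 else 1) + if M.pend = 0 then 0 else 4
  owned : ∀ z u, LAdj M.out z u → ∃ v < i, d.Own E v z
  nonEdges : NonEdges E M.out
  nodup : (unord M.out).Nodup
  ends_le : ∀ z, ends M.out z ≤ 2
  slot : ∀ j < 3, ∀ z, M.c j = z + 1 → Untouched M.out z ∧ ∃ v < i, d.Lead v ∧ d.tt v = z
  slot_inj : ∀ j < 3, ∀ k < 3, M.c j = M.c k → M.c j ≠ 0 → j = k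
  pend : ∀ v, M.pend = v + 1 →
    v < i ∧ d.Pair v ∧ Untouched M.out v ∧ Untouched M.out (d.nb1 v)
  star : ∀ v < i, d.Star v → LAdj M.out (d.nb1 v) (d.nb2 v)
  star_unique : ∀ v < n, d.Star v → (∀ u, LAdj M.out (d.nb1 v) u → u = d.nb2 v) ∧
    ∀ u, LAdj M.out (d.nb2 v) u → u = d.nb1 v
  pair : ∀ v < i, d.Pair v → M.pend = v + 1 ∨
    Spread M.out v v ∧ Spread M.out (d.nb1 v) (d.nb1 v)
  lead : ∀ v < i, d.Lead v → (∃ j < 3, M.c j = d.tt v + 1) ∨ ∃ u, LAdj M.out (d.tt v) u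

theorem Data.Lead.own (hp : Prep n E d) {v : ℕ} (hv : v < n) (h : d.Lead v) :
    d.Own E v (d.tt v) := .inl ⟨.inr h, (hp.tt v hv h.1 h.2.1).1⟩

theorem Data.Lead.not_star {v : ℕ} (h : d.Lead v) : ¬ d.Star v := fun h' => h.2.1 h'.2.1

theorem Data.Lead.not_pair {v : ℕ} (h : d.Lead v) : ¬ d.Pair v := fun h' => h.2.1 h'.2.1

theorem Data.Star.not_pair {v : ℕ} (h : d.Star v) : ¬ d.Pair v := fun h' => by
  have := h.2.2; have := h'.2.2.1; omega

theorem PoolInv.empty : PoolInv n E d 0 Pool.empty := by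
  constructor <;> simp [Pool.empty, LAdj, NonEdges, unord, ends]

/-- A vertex that demands nothing can be skipped. -/
theorem PoolInv.skip {i : ℕ} {M : Pool} (h : PoolInv n E d i M) (h0 : d.dem i = 0)
    (h1 : ¬ d.Star i) (h2 : ¬ d.Pair i) (h3 : ¬ d.Lead i) : PoolInv n E d (i + 1) M := by
  have key : ∀ {v}, v < i + 1 → v < i ∨ v = i := fun h => Nat.lt_succ_iff_lt_or_eq.mp h
  refine ⟨?_, ?_, h.nonEdges, h.nodup, h.ends_le, ?_, h.slot_inj, ?_, ?_, h.star_unique, ?_, ?_⟩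
  · rw [Finset.sum_range_succ, h.count, h0, add_zero]
  · intro z u hz
    obtain ⟨v, hv, h⟩ := h.owned z u hz
    exact ⟨v, by omega, h⟩
  · intro j hj z hz
    obtain ⟨h4, v, hv, h⟩ := h.slot j hj z hz
    exact ⟨h4, v, by omega, h⟩
  · intro v hv
    obtain ⟨h4, h⟩ := h.pend v hv
    exact ⟨by omega, h⟩
  · intro v hv hs
    rcases key hv with hv | rfl
    exacts [h.star v hv hs, (h1 hs).elim]
  · intro v hv hs
    rcases key hv with hv | rfl
    exacts [h.pair v hv hs, (h2 hs).elim]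
  · intro v hv hs
    rcases key hv with hv | rfl
    exacts [h.lead v hv hs, (h3 hs).elim]

/-- What an unserved vertex owns is untouched. -/
theorem PoolInv.untouched (hp : Prep n E d) {i : ℕ} {M : Pool} (h : PoolInv n E d i M) (hi : i < n)
    {z : ℕ} (hz : d.Own E i z) : Untouched M.out z := by
  intro u hu
  obtain ⟨v, hv, ho⟩ := h.owned z u hu
  exact hv.ne (hp.own_unique (hv.trans hi) hi ho hz)

/-- An edge between two leaves serves both demanded ends of the centre, since each leaf becomes
reached through the other. -/
theorem PoolInv.star_step (hp : Prep n E d) {i : ℕ} {M : Pool} (h : PoolInv n E d i M) (hi : i < n)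
    (hs : d.Star i) (hd : d.dem i = 2) :
    PoolInv n E d (i + 1) { M with out := M.out ++ [(d.nb1 i, d.nb2 i)] } := by
  obtain ⟨hb, hne⟩ := hp.nb2 i hi hs.2.2
  have ha := hp.nb1 i hi
  have oa : d.Own E i (d.nb1 i) := .inl ⟨.inl hs, ha⟩
  have ob : d.Own E i (d.nb2 i) := .inl ⟨.inl hs, hb⟩
  have ua := h.untouched hp hi oa
  have ub := h.untouched hp hi ob
  have hE : ¬ LAdj E (d.nb1 i) (d.nb2 i) := fun hc =>
    hp.irrefl i (by have := hp.pair_nb hi hs.1 hs.2.1 ha hc; rwa [this] at hb)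
  have key : ∀ {v}, v < i + 1 → v < i ∨ v = i := fun h => Nat.lt_succ_iff_lt_or_eq.mp h
  have hun : ∀ z v, v < n → v ≠ i → d.Own E v z → z ≠ d.nb1 i ∧ z ≠ d.nb2 i := by
    intro z v hv hvi ho
    constructor <;> rintro rfl
    exacts [hvi (hp.own_unique hv hi ho oa), hvi (hp.own_unique hv hi ho ob)]
  refine ⟨?_, ?_, ?_, ?_, ?_, ?_, h.slot_inj, ?_, ?_, ?_, ?_, ?_⟩
  · rw [Finset.sum_range_succ, h.count, hd]; simp; ring
  · intro z u hz
    rcases lAdj_append.mp hz with hz | hz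
    · obtain ⟨v, hv, h⟩ := h.owned z u hz
      exact ⟨v, by omega, h⟩
    · rcases lAdj_singleton.mp hz with ⟨rfl, rfl⟩ | ⟨rfl, rfl⟩
      exacts [⟨i, by omega, oa⟩, ⟨i, by omega, ob⟩]
  · exact h.nonEdges.append (.singleton hne hE)
  · refine unord_nodup_append h.nodup (by simp [unord]) fun x y hx hx' => ?_
    rcases lAdj_singleton.mp hx with ⟨rfl, rfl⟩ | ⟨rfl, rfl⟩
    exacts [ua _ hx', ub _ hx']
  · intro z
    rw [ends_append]
    by_cases hz : z = d.nb1 i ∨ z = d.nb2 i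
    · have : ends M.out z = 0 := by
        rcases hz with rfl | rfl
        exacts [ends_eq_zero ua, ends_eq_zero ub]
      rw [this]; simp only [ends, List.countP_singleton]; split_ifs <;> omega
    · have := h.ends_le z
      have h0 : ends [(d.nb1 i, d.nb2 i)] z = 0 := by
        refine ends_eq_zero fun u hu => hz ?_
        rcases lAdj_singleton.mp hu with ⟨rfl, -⟩ | ⟨rfl, -⟩ <;> simp
      omega
  · intro j hj z hz
    obtain ⟨h4, v, hv, hl, rfl⟩ := h.slot j hj z hz
    have := hun _ v (hv.trans hi) hv.ne (hl.own hp (hv.trans hi))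
    exact ⟨h4.append_singleton this.1 this.2, v, by omega, hl, rfl⟩
  · intro v hv
    obtain ⟨h4, h5, h6, h7⟩ := h.pend v hv
    have a := hun v v (h4.trans hi) h4.ne (.inr ⟨h5, .inl rfl⟩)
    have b := hun _ v (h4.trans hi) h4.ne (.inr ⟨h5, .inr rfl⟩)
    exact ⟨by omega, h5, h6.append_singleton a.1 a.2, h7.append_singleton b.1 b.2⟩
  · intro v hv hs
    rcases key hv with hv | rfl
    · exact lAdj_append.mpr (.inl (h.star v hv hs))
    · exact lAdj_append.mpr (.inr (lAdj_singleton.mpr (.inl ⟨rfl, rfl⟩)))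
  · intro v hv hs'
    obtain ⟨h8, h9⟩ := h.star_unique v hv hs'
    by_cases hvi : v = i
    · subst hvi
      refine ⟨fun u hu => ?_, fun u hu => ?_⟩
      · rcases lAdj_append.mp hu with hu | hu
        · exact h8 u hu
        · rcases lAdj_singleton.mp hu with ⟨-, hu⟩ | ⟨hc, -⟩
          exacts [hu, (hne hc).elim]
      · rcases lAdj_append.mp hu with hu | hu
        · exact h9 u hu
        · rcases lAdj_singleton.mp hu with ⟨hc, -⟩ | ⟨-, hu⟩
          exacts [(hne hc.symm).elim, hu]
    · have a := hun _ v hv hvi (.inl ⟨.inl hs', hp.nb1 v hv⟩)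
      have b := hun _ v hv hvi (.inl ⟨.inl hs', (hp.nb2 v hv hs'.2.2).1⟩)
      refine ⟨fun u hu => ?_, fun u hu => ?_⟩
      · rcases lAdj_append.mp hu with hu | hu
        · exact h8 u hu
        · rcases lAdj_singleton.mp hu with ⟨hc, -⟩ | ⟨hc, -⟩
          exacts [(a.1 hc).elim, (a.2 hc).elim]
      · rcases lAdj_append.mp hu with hu | hu
        · exact h9 u hu
        · rcases lAdj_singleton.mp hu with ⟨hc, -⟩ | ⟨hc, -⟩
          exacts [(b.1 hc).elim, (b.2 hc).elim]
  · intro v hv hs'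
    rcases key hv with hv | rfl
    · exact (h.pair v hv hs').imp_right fun h => ⟨h.1.append, h.2.append⟩
    · exact (hs.not_pair hs').elim
  · intro v hv hs'
    rcases key hv with hv | rfl
    · exact (h.lead v hv hs').imp_right fun ⟨u, h⟩ => ⟨u, lAdj_append.mpr (.inl h)⟩
    · exact (hs'.not_star hs).elim

end
end GraphAnon

namespace GraphAnon

/-! ### Greedy steps for two-vertex components and for slots -/

section
variable {n : ℕ} {E : List (ℕ × ℕ)} {d : Data}

/-- By disjointness, ends owned by vertices other than star centres miss the leaves of stars. That a
star edge shares no end with other added edges is needed when edges are exchanged. -/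
theorem PoolInv.star_unique_append (hp : Prep n E d) {i : ℕ} {M : Pool} (h : PoolInv n E d i M)
    {F : List (ℕ × ℕ)} (hF : ∀ z u, LAdj F z u → ∃ v < n, d.Own E v z ∧ ¬ d.Star v) :
    ∀ v < n, d.Star v → (∀ u, LAdj (M.out ++ F) (d.nb1 v) u → u = d.nb2 v) ∧
      ∀ u, LAdj (M.out ++ F) (d.nb2 v) u → u = d.nb1 v := by
  intro v hv hs
  obtain ⟨h1, h2⟩ := h.star_unique v hv hs
  have key : ∀ z, LAdj E v z → ∀ u, ¬ LAdj F z u := by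
    intro z hz u hu
    obtain ⟨v', hv', ho, hn⟩ := hF z u hu
    rw [hp.own_unique hv' hv ho (.inl ⟨.inl hs, hz⟩)] at hn
    exact hn hs
  exact ⟨fun u hu => (lAdj_append.mp hu).elim (h1 u) fun hu => (key _ (hp.nb1 v hv) u hu).elim,
    fun u hu => (lAdj_append.mp hu).elim (h2 u) fun hu =>
      (key _ (hp.nb2 v hv hs.2.2).1 u hu).elim⟩

theorem lAdj_block {p q v w x y : ℕ} : LAdj [(p, v), (p, w), (q, v), (q, w)] x y ↔
    (x = p ∨ x = q) ∧ (y = v ∨ y = w) ∨ (y = p ∨ y = q) ∧ (x = v ∨ x = w) := by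
  simp only [LAdj, List.mem_cons, Prod.mk.injEq, List.not_mem_nil, or_false]
  grind

theorem ends_block {p q v w : ℕ} (z : ℕ) (h1 : p ≠ q) (h2 : v ≠ w) (h3 : p ≠ v) (h4 : p ≠ w)
    (h5 : q ≠ v) (h6 : q ≠ w) : ends [(p, v), (p, w), (q, v), (q, w)] z ≤ 2 := by
  simp only [ends, List.countP_cons, List.countP_nil, decide_eq_true_eq]
  by_cases a : p = z
  · subst a; simp [h1.symm, h3.symm, h4.symm]
  by_cases b : q = z
  · subst b; simp [h5.symm, h6.symm, a]
  by_cases c : v = z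
  · subst c; simp [a, b, h2.symm]
  · simp only [a, b, c, if_false]; split_ifs <;> omega

/-- The four edges between two such components give each of the four vertices two new neighbours:
eight ends for a demand of four and four. A component without a partner has to wait. -/
theorem PoolInv.pair_step (hp : Prep n E d) {i : ℕ} {M : Pool} (h : PoolInv n E d i M) (hi : i < n)
    (hP : d.Pair i) (hd : d.dem i = 4) : PoolInv n E d (i + 1) (M.usePair d i) := by
  have key : ∀ {v}, v < i + 1 → v < i ∨ v = i := fun h => Nat.lt_succ_iff_lt_or_eq.mp h
  have oa : d.Own E i i := .inr ⟨hP, .inl rfl⟩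
  have ob : d.Own E i (d.nb1 i) := .inr ⟨hP, .inr rfl⟩
  have ua := h.untouched hp hi oa
  have ub := h.untouched hp hi ob
  unfold Pool.usePair
  split_ifs with h0
  · refine ⟨?_, ?_, h.nonEdges, h.nodup, h.ends_le, ?_, h.slot_inj, ?_, ?_, h.star_unique, ?_, ?_⟩
    · rw [Finset.sum_range_succ, h.count, hd, h0]; simp
    · intro z u hz
      obtain ⟨v, hv, h⟩ := h.owned z u hz
      exact ⟨v, by omega, h⟩
    · intro j hj z hz
      obtain ⟨h4, v, hv, h⟩ := h.slot j hj z hz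
      exact ⟨h4, v, by omega, h⟩
    · intro v hv
      obtain rfl : i = v := Nat.succ_injective hv
      exact ⟨by omega, hP, ua, ub⟩
    · intro v hv hs
      rcases key hv with hv | rfl
      exacts [h.star v hv hs, (hs.not_pair hP).elim]
    · intro v hv hs
      rcases key hv with hv | rfl
      · exact .inr ((h.pair v hv hs).resolve_left (by omega))
      · exact .inl rfl
    · intro v hv hs
      rcases key hv with hv | rfl
      exacts [h.lead v hv hs, (hs.not_pair hP).elim]
  · obtain ⟨p, hpd⟩ := Nat.exists_eq_succ_of_ne_zero h0
    obtain ⟨hpi, hPp, up, uq⟩ := h.pend p hpd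
    have hpn := hpi.trans hi
    have op : d.Own E p p := .inr ⟨hPp, .inl rfl⟩
    have oq : d.Own E p (d.nb1 p) := .inr ⟨hPp, .inr rfl⟩
    simp only [hpd, Nat.succ_eq_add_one, Nat.add_sub_cancel]
    have hpq := hPp.2.2.2.ne
    have hiw := hP.2.2.2.ne
    have epq := hp.nb1 p hpn
    have eiw := hp.nb1 i hi
    set q := d.nb1 p
    set w := d.nb1 i
    have cross : ∀ {x y}, d.Own E p x → d.Own E i y → x ≠ y :=
      fun hx hy hxy => hpi.ne (hp.own_unique hpn hi (hxy ▸ hx) hy)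
    have n1 := cross op oa
    have n2 := cross op ob
    have n3 := cross oq oa
    have n4 := cross oq ob
    obtain ⟨g1, g2, g3, g4⟩ := id hPp
    have g5 := hp.pair_symm hpn g1 g2 g3 rfl
    -- In `E` the vertices of the waiting component are adjacent only to each other.
    have nE : ∀ {x y}, x = p ∨ x = q → d.Own E i y → ¬ LAdj E x y := by
      rintro x y hx hy hxy
      have : y = q ∨ y = p := by
        rcases hx with rfl | rfl
        · exact .inl (hp.deg_one _ hpn g3 _ hxy)
        · exact .inr ((hp.deg_one _ g5.1 g5.2.2.2.1 _ hxy).trans g5.2.2.2.2)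
      rcases this with rfl | rfl
      exacts [cross oq hy rfl, cross op hy rfl]
    set F := [(p, i), (p, w), (q, i), (q, w)] with hFdef
    have hF : ∀ {x y}, LAdj F x y ↔ (x = p ∨ x = q) ∧ (y = i ∨ y = w) ∨
        (y = p ∨ y = q) ∧ (x = i ∨ x = w) := lAdj_block
    have hFu : ∀ {x y}, LAdj F x y → Untouched M.out x := by
      intro x y hxy
      rcases hF.mp hxy with ⟨rfl | rfl, -⟩ | ⟨-, rfl | rfl⟩ <;> assumption
    have hFo : ∀ {x y}, LAdj F x y → ∃ v < n, d.Own E v x ∧ d.Pair v ∧ v < i + 1 := by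
      intro x y hxy
      rcases hF.mp hxy with ⟨rfl | rfl, -⟩ | ⟨-, rfl | rfl⟩
      exacts [⟨x, hpn, op, hPp, by omega⟩, ⟨p, hpn, oq, hPp, by omega⟩, ⟨x, hi, oa, hP, by omega⟩,
        ⟨i, hi, ob, hP, by omega⟩]
    have hadd : ∀ {x y}, LAdj F x y → LAdj (M.out ++ F) x y := fun h => lAdj_append.mpr (.inr h)
    refine ⟨?_, ?_, ?_, ?_, ?_, ?_, h.slot_inj, by simp, ?_, ?_, ?_, ?_⟩
    · rw [Finset.sum_range_succ, h.count, hd, hpd]; simp [F]; ring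
    · intro z u hz
      rcases lAdj_append.mp hz with hz | hz
      · obtain ⟨v, hv, h⟩ := h.owned z u hz
        exact ⟨v, by omega, h⟩
      · obtain ⟨v, -, h1, -, h2⟩ := hFo hz
        exact ⟨v, h2, h1⟩
    · refine h.nonEdges.append fun x y hxy => ?_
      have o : ∀ {y}, y = i ∨ y = w → d.Own E i y := by rintro y (rfl | rfl); exacts [oa, ob]
      have o' : ∀ {y}, y = p ∨ y = q → d.Own E p y := by rintro y (rfl | rfl); exacts [op, oq]
      rcases hF.mp hxy with ⟨hx, hy⟩ | ⟨hy, hx⟩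
      · exact ⟨cross (o' hx) (o hy), nE hx (o hy)⟩
      · exact ⟨(cross (o' hy) (o hx)).symm, fun hc => nE hy (o hx) hc.symm⟩
    · refine unord_nodup_append h.nodup ?_ fun x y hx => hFu hx y
      simp [unord, F, n1, n2, n4, n1.symm, n3.symm, n4.symm, hpq, hiw, hiw.symm]
    · intro z
      rw [ends_append]
      by_cases hz : ∃ u, LAdj F z u
      · obtain ⟨u, hu⟩ := hz
        rw [ends_eq_zero (hFu hu)]
        have : ends F z ≤ 2 := ends_block z hpq hiw n1 n2 n3 n4
        omega
      · push Not at hz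
        rw [ends_eq_zero hz]; exact h.ends_le z
    · intro j hj z hz
      obtain ⟨h4, v, hv, hl, rfl⟩ := h.slot j hj z hz
      refine ⟨fun u hu => ?_, v, by omega, hl, rfl⟩
      rcases lAdj_append.mp hu with hu | hu
      · exact h4 u hu
      · obtain ⟨v', h5, h6, h7, -⟩ := hFo hu
        rw [hp.own_unique h5 (hv.trans hi) h6 (hl.own hp (hv.trans hi))] at h7
        exact hl.not_pair h7
    · intro v hv hs
      rcases key hv with hv | rfl
      exacts [lAdj_append.mpr (.inl (h.star v hv hs)), (hs.not_pair hP).elim]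
    · refine h.star_unique_append hp fun z u hz => ?_
      obtain ⟨v, h1, h2, h3, -⟩ := hFo hz
      exact ⟨v, h1, h2, fun hs => hs.not_pair h3⟩
    · intro v hv hs
      right
      rcases key hv with hv | rfl
      · rcases h.pair v hv hs with hv' | hv'
        · obtain rfl : p = v := by omega
          exact ⟨⟨i, w, hiw, hadd (hF.mpr (by simp)), hadd (hF.mpr (by simp))⟩,
            ⟨i, w, hiw, hadd (hF.mpr (by simp [q])), hadd (hF.mpr (by simp [q]))⟩⟩
        · exact ⟨hv'.1.append, hv'.2.append⟩
      · exact ⟨⟨p, q, hpq, hadd (hF.mpr (by simp)), hadd (hF.mpr (by simp))⟩,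
            ⟨p, q, hpq, hadd (hF.mpr (by simp [w])), hadd (hF.mpr (by simp [w]))⟩⟩
    · intro v hv hs
      rcases key hv with hv | rfl
      · exact (h.lead v hv hs).imp_right fun ⟨u, h⟩ => ⟨u, lAdj_append.mpr (.inl h)⟩
      · exact (hs.not_pair hP).elim

/-- The vertex `tt i` has just two neighbours and the occupied slots hold distinct vertices, so some
slot is free of neighbours of `tt i`. If it is empty, `tt i` waits there; otherwise one edge serves
two demands. -/
theorem PoolInv.lead_step (hp : Prep n E d) {i : ℕ} {M : Pool} (h : PoolInv n E d i M) (hi : i < n)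
    (hL : d.Lead i) (hd : d.dem i = 1) :
    PoolInv n E d (i + 1) (M.useSlot (d.tt i) (M.slotFor d (d.tt i))) := by
  have key : ∀ {v}, v < i + 1 → v < i ∨ v = i := fun h => Nat.lt_succ_iff_lt_or_eq.mp h
  have ot := hL.own hp hi
  have ut := h.untouched hp hi ot
  obtain ⟨-, hdt, -, -⟩ := hp.tt i hi hL.1 hL.2.1
  set t := d.tt i with ht
  have htn := hp.own_lt hi ot
  have hslt : ∀ {j z}, j < 3 → M.c j = z + 1 → z ≠ t := by
    rintro j z hj hz rfl
    obtain ⟨-, v, hv, hl, h2⟩ := h.slot j hj _ hz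
    exact hv.ne (hp.own_unique (hv.trans hi) hi (h2 ▸ hl.own hp (hv.trans hi)) ot)
  obtain ⟨hj, hjn⟩ : M.slotFor d t < 3 ∧ ∀ q, M.c (M.slotFor d t) = q + 1 → ¬ LAdj E q t := by
    have hnb : ∀ {c q}, c ≠ d.nb1 t + 1 ∧ c ≠ d.nb2 t + 1 → c = q + 1 → ¬ LAdj E q t := by
      rintro c q ⟨h1, h2⟩ rfl hc
      rcases hp.deg_two t htn hdt q hc.symm with rfl | rfl <;> simp at h1 h2
    unfold Pool.slotFor
    split_ifs with h1 h2
    · exact ⟨by omega, fun q => hnb h1⟩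
    · exact ⟨by omega, fun q => hnb h2⟩
    -- Here the first two slots hold the two neighbours of `t`, and the third cannot repeat either
    -- of them.
    · refine ⟨by omega, fun q => hnb ⟨fun h3 => ?_, fun h3 => ?_⟩⟩
      · have a := h.slot_inj 2 (by omega) 0 (by omega)
        have b := h.slot_inj 2 (by omega) 1 (by omega)
        have c := h.slot_inj 1 (by omega) 0 (by omega)
        omega
      · have a := h.slot_inj 2 (by omega) 0 (by omega)
        have b := h.slot_inj 2 (by omega) 1 (by omega)
        have c := h.slot_inj 1 (by omega) 0 (by omega)
        omega
  generalize M.slotFor d t = j at hj hjn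
  -- The change in the number of occupied slots, in a form free of subtraction.
  have hsum : ∀ x, (∑ k ∈ Finset.range 3, if Function.update M.c j x k = 0 then 0 else 1) +
      (if M.c j = 0 then 0 else 1) =
      (∑ k ∈ Finset.range 3, if M.c k = 0 then 0 else 1) + if x = 0 then 0 else 1 := by
    intro x
    simp only [Finset.sum_range_succ, Finset.sum_range_zero]
    interval_cases j <;> simp <;> ring
  unfold Pool.useSlot
  split_ifs with h0
  · refine ⟨?_, ?_, h.nonEdges, h.nodup, h.ends_le, ?_, ?_, ?_, ?_, h.star_unique, ?_, ?_⟩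
    · have := hsum (t + 1)
      rw [Finset.sum_range_succ, h.count, hd]
      simp only [h0] at this ⊢
      simp at this ⊢
      omega
    · intro z u hz
      obtain ⟨v, hv, h⟩ := h.owned z u hz
      exact ⟨v, by omega, h⟩
    · intro k hk z hz
      by_cases hkj : k = j
      · subst hkj
        obtain rfl : t = z := by simpa using hz
        exact ⟨ut, i, by omega, hL, rfl⟩
      · simp only [Function.update_of_ne hkj] at hz
        obtain ⟨h4, v, hv, h⟩ := h.slot k hk z hz
        exact ⟨h4, v, by omega, h⟩
    · intro k hk l hl
      by_cases hkj : k = j <;> by_cases hlj : l = j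
      · intros; rw [hkj, hlj]
      · subst hkj
        simp only [Function.update_self, Function.update_of_ne hlj]
        intro he
        exact (hslt hl he.symm rfl).elim
      · subst hlj
        simp only [Function.update_self, Function.update_of_ne hkj]
        intro he
        exact (hslt hk he rfl).elim
      · simp only [Function.update_of_ne hkj, Function.update_of_ne hlj]
        exact h.slot_inj k hk l hl
    · intro v hv
      obtain ⟨h4, h⟩ := h.pend v hv
      exact ⟨by omega, h⟩
    · intro v hv hs
      rcases key hv with hv | rfl
      exacts [h.star v hv hs, (hL.not_star hs).elim]
    · intro v hv hs
      rcases key hv with hv | rfl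
      exacts [h.pair v hv hs, (hL.not_pair hs).elim]
    · intro v hv hs
      rcases key hv with hv | rfl
      · rcases h.lead v hv hs with ⟨k, hk, h1⟩ | h1
        · have : k ≠ j := by rintro rfl; omega
          exact .inl ⟨k, hk, by simp [Function.update_of_ne this, h1]⟩
        · exact .inr h1
      · exact .inl ⟨j, hj, by simp [ht]⟩
  · obtain ⟨q, hq⟩ := Nat.exists_eq_succ_of_ne_zero h0
    obtain ⟨uq, v₀, hv₀, hl₀, rfl⟩ := h.slot j hj q hq
    have hqt := hslt hj hq
    have hE := hjn _ hq
    have oq := hl₀.own hp (hv₀.trans hi)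
    simp only [hq, Nat.succ_eq_add_one, Nat.add_sub_cancel]
    set q := d.tt v₀ with hqdef
    have hFo : ∀ {x y}, LAdj [(q, t)] x y → ∃ v < n, d.Own E v x ∧ d.Lead v ∧ v < i + 1 := by
      intro x y hxy
      rcases lAdj_singleton.mp hxy with ⟨rfl, -⟩ | ⟨rfl, -⟩
      exacts [⟨v₀, hv₀.trans hi, oq, hl₀, by omega⟩, ⟨i, hi, ot, hL, by omega⟩]
    have hne : ∀ {z v}, v < n → d.Own E v z → ¬ d.Lead v → z ≠ q ∧ z ≠ t := by
      intro z v hv ho hl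
      constructor <;> rintro rfl
      · rw [hp.own_unique hv (hv₀.trans hi) ho oq] at hl; exact hl hl₀
      · rw [hp.own_unique hv hi ho ot] at hl; exact hl hL
    refine ⟨?_, ?_, ?_, ?_, ?_, ?_, ?_, ?_, ?_, ?_, ?_, ?_⟩
    · have := hsum 0
      rw [Finset.sum_range_succ, h.count, hd]
      simp [hq] at this ⊢
      omega
    · intro z u hz
      rcases lAdj_append.mp hz with hz | hz
      · obtain ⟨v, hv, h⟩ := h.owned z u hz
        exact ⟨v, by omega, h⟩
      · obtain ⟨v, -, h1, -, h2⟩ := hFo hz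
        exact ⟨v, h2, h1⟩
    · exact h.nonEdges.append (.singleton hqt hE)
    · refine unord_nodup_append h.nodup (by simp [unord]) fun x y hx hx' => ?_
      rcases lAdj_singleton.mp hx with ⟨rfl, rfl⟩ | ⟨rfl, rfl⟩
      exacts [uq _ hx', ut _ hx']
    · intro z
      rw [ends_append]
      by_cases hz : z = q ∨ z = t
      · have : ends M.out z = 0 := by
          rcases hz with rfl | rfl
          exacts [ends_eq_zero uq, ends_eq_zero ut]
        rw [this]; simp only [ends, List.countP_singleton]; split_ifs <;> omega
      · have := h.ends_le z
        have h0 : ends [(q, t)] z = 0 := by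
          refine ends_eq_zero fun u hu => hz ?_
          rcases lAdj_singleton.mp hu with ⟨rfl, -⟩ | ⟨rfl, -⟩ <;> simp
        omega
    · intro k hk z hz
      have hkj : k ≠ j := by rintro rfl; simp at hz
      simp only [Function.update_of_ne hkj] at hz
      have h1 : z ≠ q := by
        rintro rfl
        exact hkj (h.slot_inj k hk j hj (by omega) (by omega))
      obtain ⟨h4, v, hv, h⟩ := h.slot k hk z hz
      exact ⟨h4.append_singleton h1 (hslt hk hz), v, by omega, h⟩
    · intro k hk l hl
      by_cases hkj : k = j <;> by_cases hlj : l = j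
      · intros; rw [hkj, hlj]
      · subst hkj; simp
      · subst hlj; simp +contextual
      · simp only [Function.update_of_ne hkj, Function.update_of_ne hlj]
        exact h.slot_inj k hk l hl
    · intro v hv
      obtain ⟨h4, h5, h6, h7⟩ := h.pend v hv
      have hnl : ¬ d.Lead v := fun hl => hl.not_pair h5
      have a := hne (h4.trans hi) (.inr ⟨h5, .inl rfl⟩) hnl
      have b := hne (h4.trans hi) (.inr ⟨h5, .inr rfl⟩) hnl
      exact ⟨by omega, h5, h6.append_singleton a.1 a.2, h7.append_singleton b.1 b.2⟩
    · intro v hv hs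
      rcases key hv with hv | rfl
      exacts [lAdj_append.mpr (.inl (h.star v hv hs)), (hL.not_star hs).elim]
    · refine h.star_unique_append hp fun z u hz => ?_
      obtain ⟨v, h1, h2, h3, -⟩ := hFo hz
      exact ⟨v, h1, h2, h3.not_star⟩
    · intro v hv hs
      rcases key hv with hv | rfl
      · exact (h.pair v hv hs).imp_right fun h => ⟨h.1.append, h.2.append⟩
      · exact (hL.not_pair hs).elim
    · intro v hv hs
      rcases key hv with hv | rfl
      · rcases h.lead v hv hs with ⟨k, hk, h1⟩ | ⟨u, h1⟩
        · by_cases hkj : k = j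
          · subst hkj
            have : d.tt v = q := by omega
            exact .inr ⟨t, lAdj_append.mpr (.inr (lAdj_singleton.mpr (.inl ⟨this, rfl⟩)))⟩
          · exact .inl ⟨k, hk, by simp [Function.update_of_ne hkj, h1]⟩
        · exact .inr ⟨u, lAdj_append.mpr (.inl h1)⟩
      · exact .inr ⟨q, lAdj_append.mpr (.inr (lAdj_singleton.mpr (.inr ⟨rfl, rfl⟩)))⟩

theorem PoolInv.step (hp : Prep n E d) {i : ℕ} {M : Pool} (h : PoolInv n E d i M) (hi : i < n) :
    PoolInv n E d (i + 1) (M.step d i) := by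
  unfold Pool.step
  rcases d.dem_cases i with ⟨hk, hd⟩ | ⟨hk, hd⟩ | ⟨hk, hd⟩ | ⟨hd, h1, h2, h3⟩
  · rw [if_pos hk.1, if_pos hk.2.1, if_neg (by have := hk.2.2; omega)]
    exact h.star_step hp hi hk hd
  · rw [if_pos hk.1, if_pos hk.2.1, if_pos hk.2.2.1, if_pos hk.2.2.2]
    exact h.pair_step hp hi hk hd
  · rw [if_pos hk.1, if_neg hk.2.1, if_neg hk.2.2]
    exact h.lead_step hp hi hk hd
  · have := h.skip hd h1 h2 h3
    split_ifs with a b c e f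
    · exact absurd ⟨a, b, c, e⟩ h2
    · exact this
    · exact absurd ⟨a, b, by omega⟩ h1
    · exact this
    · exact absurd ⟨a, b, f⟩ h3
    · exact this

theorem PoolInv.upTo (hp : Prep n E d) : ∀ i ≤ n, PoolInv n E d i (Pool.upTo d i)
  | 0, _ => PoolInv.empty
  | i + 1, hi => (PoolInv.upTo hp i (by omega)).step hp (by omega)

end
end GraphAnon

namespace GraphAnon

/-! ### What the invariant says after the last vertex -/

section
variable {n : ℕ} {E : List (ℕ × ℕ)} {d : Data}

theorem Spread.mono {H H' : List (ℕ × ℕ)} (h : ∀ a b, LAdj H a b → LAdj H' a b) {x y : ℕ}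
    (hs : Spread H x y) : Spread H' x y := by
  obtain ⟨u, u', h1, h2, h3⟩ := hs
  exact ⟨u, u', h1, h _ _ h2, h _ _ h3⟩

theorem NonEdges.ne {H : List (ℕ × ℕ)} (h : NonEdges E H) {a b : ℕ} (hab : LAdj H a b) : a ≠ b :=
  (h a b hab).1

/-- A waiting vertex has just two neighbours. -/
theorem PoolInv.slot_nb (hp : Prep n E d) {M : Pool} (h : PoolInv n E d n M) {j z : ℕ} (hj : j < 3)
    (hz : M.c j = z + 1) : z < n ∧ (∀ y, LAdj E z y → y = d.nb1 z ∨ y = d.nb2 z) ∧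
      ∀ v < n, d.Pair v → z ≠ v ∧ z ≠ d.nb1 v := by
  obtain ⟨-, v, hv, hl, rfl⟩ := h.slot j hj z hz
  have ho := hl.own hp hv
  have hzn := hp.own_lt hv ho
  refine ⟨hzn, fun y => hp.deg_two _ hzn (hp.tt v hv hl.1 hl.2.1).2.1 y, fun w hw hP => ?_⟩
  have key : ∀ x, d.Own E w x → d.tt v ≠ x := by
    rintro x hx rfl
    rw [hp.own_unique hv hw ho hx] at hl
    exact hl.not_pair hP
  exact ⟨key _ (.inr ⟨hP, .inl rfl⟩), key _ (.inr ⟨hP, .inr rfl⟩)⟩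

theorem Prep.pair_adj (hp : Prep n E d) {v : ℕ} (hv : v < n) (hP : d.Pair v) {y : ℕ} :
    (LAdj E v y → y = d.nb1 v) ∧ (LAdj E (d.nb1 v) y → y = v) := by
  obtain ⟨h1, h2, h3, -⟩ := hP
  obtain ⟨g1, g2, g3, g4, g5⟩ := hp.pair_symm hv h1 h2 h3 rfl
  exact ⟨hp.deg_one v hv h3 y, fun h => (hp.deg_one _ g1 g4 y h).trans g5⟩

theorem PoolInv.below (hp : Prep n E d) {i : ℕ} {M : Pool} (h : PoolInv n E d i M) (hi : i ≤ n) :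
    Below n M.out := by
  intro e he
  obtain ⟨v, hv, ho⟩ := h.owned e.1 e.2 (.inl he)
  obtain ⟨v', hv', ho'⟩ := h.owned e.2 e.1 (.inr he)
  exact ⟨hp.own_lt (by omega) ho, hp.own_lt (by omega) ho'⟩

theorem PoolInv.star_spread {i : ℕ} {M : Pool} (h : PoolInv n E d i M) {v : ℕ} (hv : v < i)
    (hs : d.Star v) : Spread M.out (d.nb1 v) (d.nb2 v) :=
  ⟨d.nb2 v, d.nb1 v, (h.nonEdges.ne (h.star v hv hs)).symm, h.star v hv hs, (h.star v hv hs).symm⟩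

/-! ### Serving the waiting ends by arbitrary vertices -/

/-- The edge from the vertex in slot `j`, if there is one, to `f j`. -/
def Pool.slotEdge (M : Pool) (f : ℕ → ℕ) (j : ℕ) : List (ℕ × ℕ) :=
  if M.c j = 0 then [] else [(M.c j - 1, f j)]

/-- The vertex in slot `j`, or `f j`. -/
def Pool.partner (M : Pool) (f : ℕ → ℕ) (j : ℕ) : ℕ := if M.c j = 0 then f j else M.c j - 1

/-- The edges that serve what is waiting. -/
def Pool.last (M : Pool) (d : Data) (f : ℕ → ℕ) : List (ℕ × ℕ) :=
  if M.pend = 0 then M.slotEdge f 0 ++ M.slotEdge f 1 ++ M.slotEdge f 2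
  else [(M.pend - 1, M.partner f 0), (M.pend - 1, M.partner f 1),
    (d.nb1 (M.pend - 1), M.partner f 2), (d.nb1 (M.pend - 1), f 3)]

/-- The vertices that are to be avoided when the waiting ends are served. -/
def Pool.marks (M : Pool) (d : Data) : List ℕ :=
  [M.c 0 - 1, d.nb1 (M.c 0 - 1), d.nb2 (M.c 0 - 1), M.c 1 - 1, d.nb1 (M.c 1 - 1),
    d.nb2 (M.c 1 - 1), M.c 2 - 1, d.nb1 (M.c 2 - 1), d.nb2 (M.c 2 - 1), M.pend - 1,
    d.nb1 (M.pend - 1)]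

theorem mem_slotEdges {M : Pool} {f : ℕ → ℕ} {e : ℕ × ℕ} :
    e ∈ M.slotEdge f 0 ++ M.slotEdge f 1 ++ M.slotEdge f 2 ↔
      ∃ j < 3, M.c j = e.1 + 1 ∧ e.2 = f j := by
  have h : ∀ j, e ∈ M.slotEdge f j ↔ M.c j = e.1 + 1 ∧ e.2 = f j := by
    intro j
    unfold Pool.slotEdge
    split_ifs with h
    · simp; omega
    · obtain ⟨x, y⟩ := e
      simp only [List.mem_singleton, Prod.mk.injEq]
      constructor <;> rintro ⟨h1, h2⟩ <;> exact ⟨by omega, h2⟩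
  simp only [List.mem_append, h]
  constructor
  · rintro ((h | h) | h)
    exacts [⟨0, by omega, h⟩, ⟨1, by omega, h⟩, ⟨2, by omega, h⟩]
  · rintro ⟨j, hj, h⟩
    interval_cases j <;> simp [h]

/-- Let `k ≤ 3` slots be occupied. Without a waiting component they cost `k` edges, and `2 * k ≤ k +
4`. With one, four edges at its two vertices suffice, because waiting vertices can be the far ends
of three of them, and `8 ≤ k + 4 + 4`. The marks keep the fresh vertices away from the waiting ones
and their neighbours. Together with the lower bound this leaves an excess of at most two edges. -/
theorem PoolInv.last_spec (hp : Prep n E d) {M : Pool} (h : PoolInv n E d n M) {f : ℕ → ℕ}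
    (hf : ∀ j < 4, f j < n ∧ f j ∉ M.marks d) (hinj : ∀ j < 4, ∀ k < 4, f j = f k → j = k) :
    NonEdges E (M.out ++ M.last d f) ∧ (unord (M.out ++ M.last d f)).Nodup ∧
      Below n (M.out ++ M.last d f) ∧ Strong n E (M.out ++ M.last d f) ∧
      2 * (M.out ++ M.last d f).length ≤ ∑ v ∈ Finset.range n, d.dem v + 4 := by
  have hslot : ∀ j < 3, ∀ k < 4, ∀ z, M.c j = z + 1 → f k ≠ z ∧ f k ≠ d.nb1 z ∧ f k ≠ d.nb2 z := by
    intro j hj k hk z hz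
    have h1 := (hf k hk).2
    have h2 : z = M.c j - 1 := by omega
    rw [h2]
    simp only [Pool.marks, List.mem_cons, not_or] at h1
    interval_cases j <;> tauto
  -- Only the new edges need examination. They repeat no earlier edge, because each has an end that
  -- was untouched before.
  suffices hs : NonEdges E (M.last d f) ∧ (unord (M.last d f)).Nodup ∧ Below n (M.last d f) ∧
      (∀ x y, LAdj (M.last d f) x y → Untouched M.out x ∨ Untouched M.out y) ∧
      (∀ v, M.pend = v + 1 → Spread (M.last d f) v v ∧ Spread (M.last d f) (d.nb1 v) (d.nb1 v)) ∧
      (∀ j < 3, ∀ z, M.c j = z + 1 → ∃ u, LAdj (M.last d f) z u) ∧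
      2 * (M.last d f).length ≤ (∑ j ∈ Finset.range 3, if M.c j = 0 then 0 else 1) +
        (if M.pend = 0 then 0 else 4) + 4 by
    obtain ⟨h1, h2, h3, h4, h5, h6, h7⟩ := hs
    have hright : ∀ {x y}, Spread (M.last d f) x y → Spread (M.out ++ M.last d f) x y :=
      Spread.mono fun _ _ h => lAdj_append.mpr (.inr h)
    refine ⟨h.nonEdges.append h1, unord_nodup_append h.nodup h2 fun x y hxy hxy' => ?_,
      (h.below hp le_rfl).append h3, hp.strong_of_served (h.nonEdges.append h1)
        (fun v hv hs => (h.star_spread hv hs).append) (fun v hv hs => ?_) (fun v hv hl => ?_), ?_⟩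
    · rcases h4 x y hxy with h | h
      exacts [h y hxy', h x hxy'.symm]
    · rcases h.pair v hv hs with h | h
      · exact ⟨hright (h5 v h).1, hright (h5 v h).2⟩
      · exact ⟨h.1.append, h.2.append⟩
    · rcases h.lead v hv hl with ⟨j, hj, h⟩ | ⟨u, h⟩
      · obtain ⟨u, h⟩ := h6 j hj _ h
        exact ⟨u, lAdj_append.mpr (.inr h)⟩
      · exact ⟨u, lAdj_append.mpr (.inl h)⟩
    · rw [List.length_append, h.count]; omega
  by_cases h0 : M.pend = 0
  · have hmem : ∀ e, e ∈ M.last d f ↔ ∃ j < 3, M.c j = e.1 + 1 ∧ e.2 = f j := by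
      intro e; rw [Pool.last, if_pos h0, mem_slotEdges]
    have hne : ∀ x y, (x, y) ∈ M.last d f → x ≠ y ∧ ¬ LAdj E x y := by
      intro x y hxy
      obtain ⟨j, hj, h1, h2⟩ := (hmem _).mp hxy
      have h3 := hslot j hj j (by omega) x h1
      simp only at h1 h2
      refine ⟨fun hc => h3.1 (by rw [← h2, hc]), fun hc => ?_⟩
      rcases (h.slot_nb hp hj h1).2.1 y hc with h4 | h4
      exacts [h3.2.1 (h2 ▸ h4), h3.2.2 (h2 ▸ h4)]
    refine ⟨?_, ?_, ?_, ?_, fun v hv => by omega, ?_, ?_⟩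
    · rintro x y (hxy | hxy)
      exacts [hne x y hxy, ⟨(hne y x hxy).1.symm, fun hc => (hne y x hxy).2 hc.symm⟩]
    · have i1 := h.slot_inj 0 (by omega) 1 (by omega)
      have i2 := h.slot_inj 0 (by omega) 2 (by omega)
      have i3 := h.slot_inj 1 (by omega) 2 (by omega)
      have k1 := hinj 0 (by omega) 1 (by omega)
      have k2 := hinj 0 (by omega) 2 (by omega)
      have k3 := hinj 1 (by omega) 2 (by omega)
      have s : ∀ j < 3, ∀ k < 3, M.c j ≠ 0 → f k ≠ M.c j - 1 := by
        intro j hj k hk h0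
        exact (hslot j hj k (by omega) (M.c j - 1) (by omega)).1
      have s1 := s 0 (by omega) 1 (by omega)
      have s2 := s 0 (by omega) 2 (by omega)
      have s3 := s 1 (by omega) 2 (by omega)
      rw [Pool.last, if_pos h0, unord, List.map_append, List.map_append]
      unfold Pool.slotEdge
      split_ifs with a b c c b c c <;> simp <;> omega
    · intro e he
      obtain ⟨j, hj, h1, h2⟩ := (hmem _).mp he
      exact ⟨(h.slot_nb hp hj h1).1, h2 ▸ (hf j (by omega)).1⟩
    · rintro x y (hxy | hxy)
      · obtain ⟨j, hj, h1, h2⟩ := (hmem _).mp hxy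
        exact .inl (h.slot j hj x h1).1
      · obtain ⟨j, hj, h1, h2⟩ := (hmem _).mp hxy
        exact .inr (h.slot j hj y h1).1
    · intro j hj z hz
      exact ⟨f j, .inl ((hmem _).mpr ⟨j, hj, hz, rfl⟩)⟩
    · rw [Pool.last, if_pos h0, if_pos h0]
      unfold Pool.slotEdge
      simp only [Finset.sum_range_succ, Finset.sum_range_zero]
      split_ifs <;> simp
  · obtain ⟨p, hpd⟩ := Nat.exists_eq_succ_of_ne_zero h0
    obtain ⟨hpn, hP, up, uq⟩ := h.pend p hpd
    have hpart : ∀ j < 3, M.partner f j < n ∧ M.partner f j ≠ p ∧ M.partner f j ≠ d.nb1 p ∧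
        ∀ k < 4, k ≠ j → f k ≠ M.partner f j := by
      intro j hj
      unfold Pool.partner
      split_ifs with hc
      · have := (hf j (by omega)).2
        simp only [Pool.marks, List.mem_cons, not_or, hpd, Nat.succ_eq_add_one,
          Nat.add_sub_cancel] at this
        exact ⟨(hf j (by omega)).1, by tauto, by tauto, fun k hk hkj he =>
          hkj (hinj k hk j (by omega) he)⟩
      · have hz : M.c j = (M.c j - 1) + 1 := by omega
        have := h.slot_nb hp hj hz
        exact ⟨this.1, (this.2.2 p hpn hP).1, (this.2.2 p hpn hP).2, fun k hk _ =>
          (hslot j hj k hk _ hz).1⟩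
    have hf3 : f 3 ≠ p ∧ f 3 ≠ d.nb1 p := by
      have := (hf 3 (by omega)).2
      simp only [Pool.marks, List.mem_cons, not_or, hpd, Nat.succ_eq_add_one,
        Nat.add_sub_cancel] at this
      tauto
    obtain ⟨a1, a2, a3, a4⟩ := hpart 0 (by omega)
    obtain ⟨b1, b2, b3, b4⟩ := hpart 1 (by omega)
    obtain ⟨c1, c2, c3, c4⟩ := hpart 2 (by omega)
    -- Contents of different slots differ, fresh vertices differ, and no fresh vertex is in a slot.
    have hab : M.partner f 0 ≠ M.partner f 1 := by
      intro he
      have i1 : ¬ (M.c 0 = M.c 1 ∧ M.c 0 ≠ 0) := fun ⟨a, b⟩ =>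
        absurd (h.slot_inj 0 (by omega) 1 (by omega) a b) (by omega)
      have := a4 1 (by omega) (by omega)
      have := b4 0 (by omega) (by omega)
      unfold Pool.partner at *
      split_ifs at * <;> omega
    have hc3 := c4 3 (by omega) (by omega)
    have hpq := hP.2.2.2.ne
    have hlast : M.last d f = [(p, M.partner f 0), (p, M.partner f 1), (d.nb1 p, M.partner f 2),
        (d.nb1 p, f 3)] := by
      rw [Pool.last, if_neg h0, hpd]; rfl
    have hz : ∀ j < 3, ∀ z, M.c j = z + 1 → M.partner f j = z := by
      intro j hj z hz
      rw [Pool.partner, if_neg (by omega)]; omega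
    rw [hlast]
    have hqn := ((hp.nb1 p hpn).lt hp.below).2
    generalize hx0 : M.partner f 0 = x0 at *
    generalize hx1 : M.partner f 1 = x1 at *
    generalize hx2 : M.partner f 2 = x2 at *
    have hadj := @Prep.pair_adj _ _ _ hp _ hpn hP
    generalize hq : d.nb1 p = q at *
    have hne : ∀ x y, (x, y) ∈ [(p, x0), (p, x1), (q, x2), (q, f 3)] →
        (x = p ∨ x = q) ∧ y ≠ p ∧ y ≠ q := by
      intro x y hxy
      simp only [List.mem_cons, Prod.mk.injEq, List.not_mem_nil, or_false] at hxy
      rcases hxy with ⟨rfl, rfl⟩ | ⟨rfl, rfl⟩ | ⟨rfl, rfl⟩ | ⟨rfl, rfl⟩ <;> tauto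
    have hne' : ∀ x y, (x, y) ∈ [(p, x0), (p, x1), (q, x2), (q, f 3)] → x ≠ y ∧ ¬ LAdj E x y := by
      intro x y hxy
      obtain ⟨rfl | rfl, h2, h3⟩ := hne x y hxy
      · exact ⟨h2.symm, fun hc => h3 (hadj.1 hc)⟩
      · exact ⟨h3.symm, fun hc => h2 (hadj.2 hc)⟩
    have hu : ∀ {x}, x = p ∨ x = q → Untouched M.out x := by
      rintro x (rfl | rfl) <;> assumption
    refine ⟨?_, ?_, ?_, ?_, ?_, ?_, ?_⟩
    · rintro x y (hxy | hxy)
      exacts [hne' x y hxy, ⟨(hne' y x hxy).1.symm, fun hc => (hne' y x hxy).2 hc.symm⟩]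
    · simp [unord, hab, hpq, a2, a3, b3, c3, hc3.symm]
    · simp [Below, hpn, hqn, a1, b1, c1, hf 3]
    · rintro x y (hxy | hxy)
      exacts [.inl (hu (hne x y hxy).1), .inr (hu (hne y x hxy).1)]
    · intro v hv
      obtain rfl : p = v := by omega
      rw [hq]
      exact ⟨⟨x0, x1, hab, .inl (by simp), .inl (by simp)⟩,
        ⟨x2, f 3, hc3.symm, .inl (by simp), .inl (by simp)⟩⟩
    · intro j hj z hz'
      have := hz j hj z hz'
      interval_cases j
      · exact ⟨p, .inr (by simp [← this, hx0])⟩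
      · exact ⟨p, .inr (by simp [← this, hx1])⟩
      · exact ⟨q, .inr (by simp [← this, hx2])⟩
    · rw [if_neg h0]; simp

/-! ### Serving the waiting ends in the most economical way -/

/-- Each member of `F` spoils at most two pairs. -/
theorem exists_mem_avoiding {C : List (ℕ × ℕ)} (hC : ∀ z, ends C z ≤ 2) (F : Finset ℕ)
    (hF : 2 * F.card < C.length) : ∃ e ∈ C, e.1 ∉ F ∧ e.2 ∉ F := by
  by_contra! hc
  have h1 : ∀ C : List (ℕ × ℕ), (∀ e ∈ C, e.1 ∉ F → e.2 ∈ F) → C.length ≤ ∑ z ∈ F, ends C z := by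
    intro C
    induction C with
    | nil => simp
    | cons e C ih =>
      intro h
      have h2 : ∀ z, ends (e :: C) z = ends [e] z + ends C z := fun z => ends_append [e] C z
      have h3 := ih fun e he => h e (by simp [he])
      have h4 : ∃ z ∈ F, 1 ≤ ends [e] z := by
        by_cases h5 : e.1 ∈ F
        · exact ⟨_, h5, by simp [ends]⟩
        · exact ⟨_, h e (by simp) h5, by simp [ends]⟩
      obtain ⟨z, hz, h5⟩ := h4
      have h6 : ends [e] z ≤ ∑ z ∈ F, ends [e] z :=
        Finset.single_le_sum (f := ends [e]) (fun _ _ => Nat.zero_le _) hz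
      simp only [h2, Finset.sum_add_distrib, List.length_cons]
      omega
  have h2 := h1 C hc
  have h3 : ∑ z ∈ F, ends C z ≤ F.card * 2 := Finset.sum_le_card_nsmul _ _ _ fun z _ => hC z
  omega

/-- Replacing the edge `rs` by `pr` and `qs` keeps `x` and `y` spread. -/
theorem Spread.swap {H H' : List (ℕ × ℕ)} {p q r s x y : ℕ} (hpq : p ≠ q) (hrs : r ≠ s)
    (hkeep : ∀ a b, LAdj H a b → s(a, b) ≠ s(r, s) → LAdj H' a b)
    (hpr : LAdj H' p r) (hqs : LAdj H' q s) (hp : ¬ LAdj H p r ∧ ¬ LAdj H p s)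
    (hq : ¬ LAdj H q r ∧ ¬ LAdj H q s) (hmate : x = r ∨ x = s ↔ y = r ∨ y = s)
    (h : Spread H x y) : Spread H' x y := by
  obtain ⟨u, u', h1, h2, h3⟩ := h
  simp only [ne_eq, Sym2.eq_iff] at hkeep
  have hpr' := hpr.symm
  have hqs' := hqs.symm
  by_cases hx : x = r ∨ x = s
  · have hy := hmate.mp hx
    -- At `r` the partner `s` is replaced by `p`, at `s` the partner `r` by `q`. The partners that
    -- remain are neither `p` nor `q`, since these were joined to neither `r` nor `s`; so partners
    -- that differed still differ.
    have key : ∀ x u, x = r ∨ x = s → LAdj H x u → ∃ u₁, LAdj H' x u₁ ∧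
        (x = r ∧ u = s ∧ u₁ = p ∨ x = s ∧ u = r ∧ u₁ = q ∨ u₁ = u ∧ u ≠ p ∧ u ≠ q ∧
          ¬ (x = r ∧ u = s) ∧ ¬ (x = s ∧ u = r)) := by
      intro x u hx hxu
      by_cases h4 : x = r ∧ u = s
      · exact ⟨p, h4.1 ▸ hpr', .inl ⟨h4.1, h4.2, rfl⟩⟩
      by_cases h5 : x = s ∧ u = r
      · exact ⟨q, h5.1 ▸ hqs', .inr (.inl ⟨h5.1, h5.2, rfl⟩)⟩
      refine ⟨u, hkeep _ _ hxu (by tauto), .inr (.inr ⟨rfl, ?_, ?_, h4, h5⟩)⟩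
      · rintro rfl
        rcases hx with rfl | rfl
        exacts [hp.1 hxu.symm, hp.2 hxu.symm]
      · rintro rfl
        rcases hx with rfl | rfl
        exacts [hq.1 hxu.symm, hq.2 hxu.symm]
    obtain ⟨u₁, k1, k2⟩ := key x u hx h2
    obtain ⟨u₁', k1', k2'⟩ := key y u' hy h3
    refine ⟨u₁, u₁', ?_, k1, k1'⟩
    rintro rfl
    rcases k2 with ⟨rfl, rfl, rfl⟩ | ⟨rfl, rfl, rfl⟩ | ⟨rfl, k2⟩ <;>
      rcases k2' with ⟨a, b, c⟩ | ⟨a, b, c⟩ | ⟨a, k2'⟩ <;> subst_vars <;> tauto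
  · have hy : ¬ (y = r ∨ y = s) := fun h => hx (hmate.mpr h)
    exact ⟨u, u', h1, hkeep _ _ h2 (by tauto), hkeep _ _ h3 (by tauto)⟩

/-- The edges `B ++ C ++ Z` serve everything but the vertices in `W` and the components of the
vertices in `P`; those in `C` may be replaced. -/
structure Config (n : ℕ) (E : List (ℕ × ℕ)) (d : Data) (O B C Z : List (ℕ × ℕ)) (W P : ℕ → Prop) :
    Prop where
  nonEdges : NonEdges E (B ++ C ++ Z)
  below : Below n (C ++ Z)
  star : ∀ v < n, d.Star v → Spread (B ++ C ++ Z) (d.nb1 v) (d.nb2 v)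
  pair : ∀ v < n, d.Pair v → P v ∨ Spread (B ++ C ++ Z) v v ∧ Spread (B ++ C ++ Z) (d.nb1 v) (d.nb1 v)
  lead : ∀ v < n, d.Lead v → W (d.tt v) ∨ ∃ u, LAdj (B ++ C ++ Z) (d.tt v) u
  wait : ∀ z, W z → Untouched (B ++ C ++ Z) z
  old : ∀ e ∈ C, e ∈ O
  ends_le : ∀ z, ends C z ≤ 2

theorem Config.strong (hp : Prep n E d) {O B C Z : List (ℕ × ℕ)} {W P : ℕ → Prop}
    (h : Config n E d O B C Z W P) (hW : ∀ z, ¬ W z) (hP : ∀ z, ¬ P z) :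
    Strong n E (B ++ C ++ Z) :=
  hp.strong_of_served h.nonEdges h.star (fun v hv hs => (h.pair v hv hs).resolve_left (hP v))
    fun v hv hs => (h.lead v hv hs).resolve_left (hW _)

/-- Serve `p` and `q` at the expense of the edge `rs`. -/
theorem Config.swap {O B C₁ C₂ Z : List (ℕ × ℕ)} {W P : ℕ → Prop} {r s p q : ℕ}
    (h : Config n E d O B (C₁ ++ (r, s) :: C₂) Z W P)
    (hO : ∀ v < n, d.Star v → (∀ u, LAdj O (d.nb1 v) u → u = d.nb2 v) ∧
      ∀ u, LAdj O (d.nb2 v) u → u = d.nb1 v) (hpn : p < n) (hqn : q < n) (hpq : p ≠ q)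
    (hEp : ¬ LAdj E p r) (hEq : ¬ LAdj E q s)
    (hp : ¬ LAdj (B ++ (C₁ ++ (r, s) :: C₂) ++ Z) p r ∧ ¬ LAdj (B ++ (C₁ ++ (r, s) :: C₂) ++ Z) p s)
    (hq : ¬ LAdj (B ++ (C₁ ++ (r, s) :: C₂) ++ Z) q r ∧ ¬ LAdj (B ++ (C₁ ++ (r, s) :: C₂) ++ Z) q s)
    (hpr : p ≠ r) (hqs : q ≠ s) :
    Config n E d O B (C₁ ++ C₂) (Z ++ [(p, r), (q, s)]) (fun z => W z ∧ z ≠ p ∧ z ≠ q) P ∧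
    ∀ a b, LAdj (B ++ (C₁ ++ C₂) ++ (Z ++ [(p, r), (q, s)])) a b →
      LAdj (B ++ (C₁ ++ (r, s) :: C₂) ++ Z) a b ∨ LAdj [(p, r), (q, s)] a b := by
  set H := B ++ (C₁ ++ (r, s) :: C₂) ++ Z with hH
  set H' := B ++ (C₁ ++ C₂) ++ (Z ++ [(p, r), (q, s)]) with hH'
  have hrs : LAdj H r s := .inl (by simp [hH])
  have hkeep : ∀ a b, LAdj H a b → s(a, b) ≠ s(r, s) → LAdj H' a b := by
    intro a b hab hne
    simp only [ne_eq, Sym2.eq_iff] at hne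
    simp only [LAdj, hH, hH', List.mem_append, List.mem_cons, Prod.mk.injEq] at hab ⊢
    tauto
  have hpr' : LAdj H' p r := .inl (by simp [hH'])
  have hqs' : LAdj H' q s := .inl (by simp [hH'])
  have hback : ∀ a b, LAdj H' a b → LAdj H a b ∨ LAdj [(p, r), (q, s)] a b := by
    intro a b hab
    simp only [LAdj, hH, hH', List.mem_append, List.mem_cons] at hab ⊢
    tauto
  have hnew : ∀ {a b}, LAdj [(p, r), (q, s)] a b →
      a = p ∧ b = r ∨ a = r ∧ b = p ∨ a = q ∧ b = s ∨ a = s ∧ b = q := by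
    intro a b hab
    simp only [LAdj, List.mem_cons, Prod.mk.injEq, List.not_mem_nil, or_false] at hab
    tauto
  have hrsne := h.nonEdges.ne hrs
  have hspread : ∀ {x y}, (x = r ∨ x = s ↔ y = r ∨ y = s) → Spread H x y → Spread H' x y :=
    fun hm hs => hs.swap hpq hrsne hkeep hpr' hqs' hp hq hm
  have hOrs : LAdj O r s := .inl (h.old _ (by simp))
  refine ⟨⟨?_, ?_, ?_, ?_, ?_, ?_, ?_, ?_⟩, hback⟩
  · intro x y hxy
    rcases hback x y hxy with h' | h'
    · exact h.nonEdges x y h'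
    · rcases hnew h' with ⟨rfl, rfl⟩ | ⟨rfl, rfl⟩ | ⟨rfl, rfl⟩ | ⟨rfl, rfl⟩
      exacts [⟨hpr, hEp⟩, ⟨hpr.symm, fun hc => hEp hc.symm⟩, ⟨hqs, hEq⟩,
        ⟨hqs.symm, fun hc => hEq hc.symm⟩]
  · have hrsn := h.below (r, s) (by simp)
    intro e he
    simp only [List.mem_append, List.mem_cons, List.not_mem_nil, or_false] at he
    rcases he with (he | he) | he | rfl | rfl
    · exact h.below e (by simp [he])
    · exact h.below e (by simp [he])
    · exact h.below e (by simp [he])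
    · exact ⟨hpn, hrsn.1⟩
    · exact ⟨hqn, hrsn.2⟩
  · intro v hv hs
    obtain ⟨h1, h2⟩ := hO v hv hs
    -- In `O` the two chosen leaves of a star are joined only to each other, so `rs` contains both
    -- or neither.
    refine hspread ⟨?_, ?_⟩ (h.star v hv hs)
    · rintro (h3 | h3)
      · exact .inr (h1 s (h3 ▸ hOrs)).symm
      · exact .inl (h1 r (h3 ▸ hOrs.symm)).symm
    · rintro (h3 | h3)
      · exact .inr (h2 s (h3 ▸ hOrs)).symm
      · exact .inl (h2 r (h3 ▸ hOrs.symm)).symm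
  · exact fun v hv hs => (h.pair v hv hs).imp_right fun h => ⟨hspread Iff.rfl h.1, hspread Iff.rfl h.2⟩
  · intro v hv hs
    by_cases h1 : d.tt v = p
    · exact .inr ⟨r, by rw [h1]; exact hpr'⟩
    by_cases h2 : d.tt v = q
    · exact .inr ⟨s, by rw [h2]; exact hqs'⟩
    rcases h.lead v hv hs with h3 | ⟨u, h3⟩
    · exact .inl ⟨h3, h1, h2⟩
    · right
      -- A vertex served by the edge that disappears is now joined to `p` or `q`.
      by_cases h4 : s(d.tt v, u) = s(r, s)
      · rcases Sym2.eq_iff.mp h4 with ⟨h4, -⟩ | ⟨h4, -⟩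
        exacts [⟨p, by rw [h4]; exact hpr'.symm⟩, ⟨q, by rw [h4]; exact hqs'.symm⟩]
      · exact ⟨u, hkeep _ _ h3 h4⟩
  · rintro z ⟨h1, h2, h3⟩ u hu
    have h4 := h.wait z h1
    rcases hback z u hu with h' | h'
    · exact h4 u h'
    · rcases hnew h' with ⟨rfl, rfl⟩ | ⟨rfl, rfl⟩ | ⟨rfl, rfl⟩ | ⟨rfl, rfl⟩
      exacts [h2 rfl, h4 _ hrs, h3 rfl, h4 _ hrs.symm]
  · intro e he
    refine h.old e ?_
    simp only [List.mem_append, List.mem_cons] at he ⊢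
    tauto
  · intro z
    have h1 := h.ends_le z
    rw [show C₁ ++ (r, s) :: C₂ = C₁ ++ ([(r, s)] ++ C₂) by simp, ends_append, ends_append] at h1
    rw [ends_append]
    omega

end
end GraphAnon

namespace GraphAnon

/-! ### Exchanges attain the lower bound up to rounding -/

section
variable {n : ℕ} {E : List (ℕ × ℕ)} {d : Data}

/-- A single remaining vertex is served by any non-neighbour; the other end of that edge is the only
one wasted. -/
theorem Config.serve_last (hp : Prep n E d) {O B C Z : List (ℕ × ℕ)} {W P : ℕ → Prop}
    (h : Config n E d O B C Z W P) {c f : ℕ} (hW : ∀ z, W z → z = c) (hP : ∀ z, ¬ P z)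
    (hcf : c ≠ f) (hE : ¬ LAdj E c f) : Strong n E (B ++ C ++ (Z ++ [(c, f)])) := by
  rw [← List.append_assoc]
  refine hp.strong_of_served (h.nonEdges.append (.singleton hcf hE))
    (fun v hv hs => (h.star v hv hs).append) (fun v hv hs => ?_) fun v hv hs => ?_
  · have := (h.pair v hv hs).resolve_left (hP v)
    exact ⟨this.1.append, this.2.append⟩
  · rcases h.lead v hv hs with h | ⟨u, h⟩
    · exact ⟨f, lAdj_append.mpr (.inr (lAdj_singleton.mpr (.inl ⟨hW _ h, rfl⟩)))⟩
    · exact ⟨u, lAdj_append.mpr (.inl h)⟩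

/-- One exchange serves two waiting vertices and adds one edge to the total; an odd vertex left over
gets an edge of its own. The edge exchanged must avoid the at most four neighbours of the two
vertices, which excludes at most eight edges; hence the bound on `C`. -/
theorem Config.serve_list (hp : Prep n E d) (hn : 4 ≤ n) {O B C Z : List (ℕ × ℕ)}
    {W P : ℕ → Prop} (h : Config n E d O B C Z W P)
    (hO : ∀ v < n, d.Star v → (∀ u, LAdj O (d.nb1 v) u → u = d.nb2 v) ∧
      ∀ u, LAdj O (d.nb2 v) u → u = d.nb1 v) (hP : ∀ z, ¬ P z) (hC : 8 < C.length)
    {ws : List ℕ} (hws : ∀ z, W z ↔ z ∈ ws) (hnd : ws.Nodup) (hlen : ws.length ≤ 3)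
    (hnb : ∀ z ∈ ws, z < n ∧ ∀ y, LAdj E z y → y = d.nb1 z ∨ y = d.nb2 z) :
    ∃ Y, Below n Y ∧ Strong n E (B ++ Y) ∧ Y.length = C.length + Z.length + (ws.length + 1) / 2 := by
  -- A waiting vertex has at most two neighbours, so among four vertices there is another one not
  -- adjacent to it.
  have hfresh : ∀ z ∈ ws, ∃ f < n, z ≠ f ∧ ¬ LAdj E z f := by
    intro z hz
    have : ({z, d.nb1 z, d.nb2 z} : Finset ℕ).card < (Finset.range n).card := by
      rw [Finset.card_range]; exact lt_of_le_of_lt Finset.card_le_three (by omega)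
    obtain ⟨f, hf, hf'⟩ := Finset.exists_mem_notMem_of_card_lt_card this
    simp only [Finset.mem_insert, Finset.mem_singleton, not_or, Finset.mem_range] at hf hf'
    exact ⟨f, hf, Ne.symm hf'.1, fun hc => by have := (hnb z hz).2 f hc; tauto⟩
  have hswap : ∀ p ∈ ws, ∀ q ∈ ws, p ≠ q → ∃ C' Z' : List (ℕ × ℕ),
      Config n E d O B C' Z' (fun z => W z ∧ z ≠ p ∧ z ≠ q) P ∧
        C'.length + Z'.length = C.length + Z.length + 1 := by
    intro p hpw q hqw hpq
    obtain ⟨⟨r, s⟩, he, hr, hs⟩ := exists_mem_avoiding h.ends_le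
      ({d.nb1 p, d.nb2 p, d.nb1 q, d.nb2 q} : Finset ℕ)
      (by have : ({d.nb1 p, d.nb2 p, d.nb1 q, d.nb2 q} : Finset ℕ).card ≤ 4 := Finset.card_le_four
          omega)
    simp only [Finset.mem_insert, Finset.mem_singleton, not_or] at hr hs
    obtain ⟨C₁, C₂, rfl⟩ := List.append_of_mem he
    have hup := h.wait p ((hws p).mpr hpw)
    have huq := h.wait q ((hws q).mpr hqw)
    have hrs : LAdj (B ++ (C₁ ++ (r, s) :: C₂) ++ Z) r s := .inl (by simp)
    refine ⟨C₁ ++ C₂, _, (h.swap hO (hnb p hpw).1 (hnb q hqw).1 hpq (fun hc => ?_) (fun hc => ?_)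
      ⟨hup _, hup _⟩ ⟨huq _, huq _⟩ (fun hc => ?_) (fun hc => ?_)).1, ?_⟩
    · have := (hnb p hpw).2 r hc; tauto
    · have := (hnb q hqw).2 s hc; tauto
    · exact hup s (hc ▸ hrs)
    · exact huq r (hc ▸ hrs.symm)
    · simp; omega
  match ws, hlen with
  | [], _ =>
    exact ⟨C ++ Z, h.below, by simpa using h.strong hp (by simp [hws]) hP, by simp⟩
  | [a], _ =>
    obtain ⟨f, hf, haf, hE⟩ := hfresh a (by simp)
    refine ⟨C ++ (Z ++ [(a, f)]), ?_, ?_, by simp; omega⟩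
    · rw [← List.append_assoc]
      exact h.below.append (by simpa [Below] using ⟨(hnb a (by simp)).1, hf⟩)
    · rw [← List.append_assoc]
      exact h.serve_last hp (by simp [hws]) hP haf hE
  | [a, b], _ =>
    obtain ⟨C', Z', h', hl⟩ := hswap a (by simp) b (by simp) (by simpa using hnd)
    exact ⟨C' ++ Z', h'.below, by
      simpa using h'.strong hp (by simp only [hws, List.mem_cons, List.not_mem_nil]; tauto) hP,
      by simp; omega⟩
  | [a, b, c], _ =>
    obtain ⟨C', Z', h', hl⟩ := hswap a (by simp) b (by simp) (by simp at hnd; tauto)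
    obtain ⟨f, hf, hcf, hE⟩ := hfresh c (by simp)
    refine ⟨C' ++ (Z' ++ [(c, f)]), ?_, ?_, by simp; omega⟩
    · rw [← List.append_assoc]
      exact h'.below.append (by simpa [Below] using ⟨(hnb c (by simp)).1, hf⟩)
    · rw [← List.append_assoc]
      exact h'.serve_last hp (by simp only [hws, List.mem_cons, List.not_mem_nil]; tauto) hP hcf hE
  | _ :: _ :: _ :: _ :: _, hlen => simp at hlen; omega

/-- A waiting component is served by two exchanges, four ends for two additional edges, and the
slots by `Config.serve_list`; at most one end is wasted in all. Only the last `J` edges take part,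
which bounds the number of edges to be searched for. The condition `10 < J` leaves more than eight
exchangeable edges after the first two exchanges. -/
theorem PoolInv.exists_completion (hp : Prep n E d) {M : Pool} (h : PoolInv n E d n M) (hn : 4 ≤ n)
    {J : ℕ} (hJ : 10 < J) (hlen : J ≤ M.out.length) :
    ∃ Y, Below n Y ∧ Strong n E (M.out.take (M.out.length - J) ++ Y) ∧
      2 * (M.out.length - J + Y.length) ≤ ∑ v ∈ Finset.range n, d.dem v + 1 ∧
      Y.length ≤ J + 4 := by
  set B := M.out.take (M.out.length - J) with hB
  set C := M.out.drop (M.out.length - J) with hC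
  have hBC : B ++ C ++ [] = M.out := by simp [hB, hC]
  have hCl : C.length = J := by simp [hC]; omega
  let W : ℕ → Prop := fun z => ∃ j < 3, M.c j = z + 1
  have h₀ : Config n E d M.out B C [] W (fun v => M.pend = v + 1) := by
    refine ⟨?_, ?_, ?_, ?_, ?_, ?_, ?_, ?_⟩
    · rw [hBC]; exact h.nonEdges
    · rw [List.append_nil]
      exact fun e he => h.below hp le_rfl e (List.mem_of_mem_drop he)
    · rw [hBC]; exact fun v hv => h.star_spread hv
    · rw [hBC]; exact h.pair
    · rw [hBC]; exact h.lead
    · rw [hBC]; rintro z ⟨j, hj, hz⟩; exact (h.slot j hj z hz).1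
    · exact fun e he => List.mem_of_mem_drop he
    · intro z
      have := h.ends_le z
      rw [← hBC, List.append_nil, ends_append] at this
      omega
  obtain ⟨C', Z', h₁, hC', hl⟩ : ∃ C' Z', Config n E d M.out B C' Z' W (fun _ => False) ∧
      8 < C'.length ∧ C'.length + Z'.length = J + if M.pend = 0 then 0 else 2 := by
    by_cases h0 : M.pend = 0
    · exact ⟨C, [], ⟨h₀.nonEdges, h₀.below, h₀.star, fun v hv hs => (h₀.pair v hv hs).imp_left
        (by omega), h₀.lead, h₀.wait, h₀.old, h₀.ends_le⟩, by omega, by simp [h0, hCl]⟩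
    · obtain ⟨p, hpd⟩ := Nat.exists_eq_succ_of_ne_zero h0
      obtain ⟨hpn, hP, up, uq⟩ := h.pend p hpd
      have hpq : p ≠ d.nb1 p := hP.2.2.2.ne
      have hadj := fun y => @Prep.pair_adj _ _ _ hp _ hpn hP y
      have hqn := ((hp.nb1 p hpn).lt hp.below).2
      have hWp : ∀ z, W z → z ≠ p ∧ z ≠ d.nb1 p := by
        rintro z ⟨j, hj, hz⟩
        exact (h.slot_nb hp hj hz).2.2 p hpn hP
      have hpair : ∀ v, M.pend = v + 1 → v = p := fun v hv => by omega
      set q := d.nb1 p with hq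
      -- Any edge will do at first, since `p` and `q` are untouched and adjacent in `E` only to each
      -- other.
      obtain ⟨⟨r₁, s₁⟩, he₁, -⟩ := exists_mem_avoiding h₀.ends_le ∅ (by simp; omega)
      obtain ⟨A₁, A₂, hA⟩ := List.append_of_mem he₁
      have hr₁ : LAdj M.out r₁ s₁ := .inl (h₀.old _ he₁)
      rw [hA] at h₀ hBC
      obtain ⟨h₁, hb₁⟩ := h₀.swap h.star_unique hpn hqn hpq
        (fun hc => uq s₁ ((hadj _).1 hc ▸ hr₁)) (fun hc => up r₁ ((hadj _).2 hc ▸ hr₁.symm))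
        (by rw [hBC]; exact ⟨up _, up _⟩) (by rw [hBC]; exact ⟨uq _, uq _⟩)
        (fun hc => up s₁ (hc ▸ hr₁)) (fun hc => uq r₁ (hc ▸ hr₁.symm))
      rw [hBC] at hb₁
      have hl₁ : A₁.length + A₂.length + 1 = J := by rw [← hCl, hA]; simp; omega
      -- The second edge is disjoint from the first, so that `p` gets the different partners `r₁`,
      -- `r₂`, and `q` gets `s₁`, `s₂`.
      obtain ⟨⟨r₂, s₂⟩, he₂, hr, hs⟩ := exists_mem_avoiding h₁.ends_le {r₁, s₁}
        (by have := Finset.card_le_two (a := r₁) (b := s₁); simp only [List.length_append]; omega)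
      simp only [Finset.mem_insert, Finset.mem_singleton, not_or] at hr hs
      obtain ⟨D₁, D₂, hD⟩ := List.append_of_mem he₂
      have hr₂ : LAdj M.out r₂ s₂ := .inl (h₁.old _ he₂)
      have hpr₂ : p ≠ r₂ ∧ p ≠ s₂ := ⟨fun hc => up s₂ (hc ▸ hr₂), fun hc => up r₂ (hc ▸ hr₂.symm)⟩
      have hqr₂ : q ≠ r₂ ∧ q ≠ s₂ := ⟨fun hc => uq s₂ (hc ▸ hr₂), fun hc => uq r₂ (hc ▸ hr₂.symm)⟩
      rw [hD] at h₁ hb₁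
      have hnew : ∀ {a b}, LAdj [(p, r₁), (q, s₁)] a b →
          a = p ∧ b = r₁ ∨ a = r₁ ∧ b = p ∨ a = q ∧ b = s₁ ∨ a = s₁ ∧ b = q := by
        intro a b hab
        simp only [LAdj, List.mem_cons, Prod.mk.injEq, List.not_mem_nil, or_false] at hab
        tauto
      have hno : ∀ x, x = p ∨ x = q → ∀ y, y = r₂ ∨ y = s₂ →
          ¬ LAdj (B ++ (D₁ ++ (r₂, s₂) :: D₂) ++ ([] ++ [(p, r₁), (q, s₁)])) x y := by
        intro x hx y hy hxy
        rcases hb₁ x y hxy with h' | h'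
        · rcases hx with rfl | rfl
          exacts [up y h', uq y h']
        · rcases hy with rfl | rfl <;> rcases hnew h' with ⟨-, h'⟩ | ⟨-, h'⟩ | ⟨-, h'⟩ | ⟨-, h'⟩
          exacts [hr.1 h', hpr₂.1 h'.symm, hr.2 h', hqr₂.1 h'.symm, hs.1 h', hpr₂.2 h'.symm,
            hs.2 h', hqr₂.2 h'.symm]
      obtain ⟨h₂, -⟩ := h₁.swap h.star_unique hpn hqn hpq
        (fun hc => hqr₂.1 ((hadj _).1 hc).symm) (fun hc => hpr₂.2 ((hadj _).2 hc).symm)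
        ⟨hno p (.inl rfl) r₂ (.inl rfl), hno p (.inl rfl) s₂ (.inr rfl)⟩
        ⟨hno q (.inr rfl) r₂ (.inl rfl), hno q (.inr rfl) s₂ (.inr rfl)⟩ hpr₂.1 hqr₂.2
      have hl₂ : D₁.length + D₂.length + 2 = J := by
        have := congrArg List.length hD
        simp only [List.length_append, List.length_cons] at this
        omega
      refine ⟨D₁ ++ D₂, _, ⟨h₂.nonEdges, h₂.below, h₂.star, fun v hv hv' => ?_, fun v hv hv' => ?_,
        fun z hz => h₂.wait z ?_, h₂.old, h₂.ends_le⟩, ?_, ?_⟩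
      · right
        rcases h₂.pair v hv hv' with h' | h'
        · obtain rfl := hpair v h'
          exact ⟨⟨r₁, r₂, Ne.symm hr.1, .inl (by simp), .inl (by simp)⟩,
            ⟨s₁, s₂, Ne.symm hs.2, .inl (by simp [hq]), .inl (by simp [hq])⟩⟩
        · exact h'
      · exact (h₂.lead v hv hv').imp_left fun h => h.1.1
      · exact ⟨⟨hz, hWp z hz⟩, hWp z hz⟩
      · simp only [List.length_append]; omega
      · simp [h0]; omega
  let ws := ((List.range 3).filter fun j => M.c j ≠ 0).map fun j => M.c j - 1
  have hmem : ∀ {j}, j ∈ (List.range 3).filter (fun j => M.c j ≠ 0) ↔ j < 3 ∧ M.c j ≠ 0 := by simp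
  have hws : ∀ z, W z ↔ z ∈ ws := by
    intro z
    simp only [W, ws, List.mem_map, hmem]
    constructor
    · rintro ⟨j, hj, hz⟩; exact ⟨j, ⟨hj, by omega⟩, by omega⟩
    · rintro ⟨j, ⟨hj, h1⟩, hz⟩; exact ⟨j, hj, by omega⟩
  obtain ⟨Y, hY1, hY2, hY3⟩ := h₁.serve_list hp hn h.star_unique (by simp) hC' hws
    (List.Nodup.map_on (fun j hj k hk hjk => by
      rw [hmem] at hj hk
      exact h.slot_inj j hj.1 k hk.1 (by omega) hj.2) (List.nodup_range.filter _))
    (by simpa [ws] using List.length_filter_le (fun j => decide (M.c j ≠ 0)) (List.range 3))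
    (fun z hz => by
      obtain ⟨j, hj, hz⟩ := (hws z).mpr hz
      exact ⟨(h.slot_nb hp hj hz).1, (h.slot_nb hp hj hz).2.1⟩)
  have hk : ws.length = ∑ j ∈ Finset.range 3, if M.c j = 0 then 0 else 1 := by
    simp only [ws, Finset.sum_range_succ, Finset.sum_range_zero, List.length_map, List.range_succ,
      List.range_zero, List.nil_append, List.filter_append, List.length_append]
    by_cases a : M.c 0 = 0 <;> by_cases b : M.c 1 = 0 <;> by_cases c : M.c 2 = 0 <;> simp [a, b, c]
  have hk3 : ws.length ≤ 3 := by
    simpa [ws] using List.length_filter_le (fun j => decide (M.c j ≠ 0)) (List.range 3)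
  refine ⟨Y, hY1, hY2, ?_, ?_⟩
  · rw [h.count, ← hk, hY3, hl]
    split_ifs <;> omega
  · rw [hY3, hl]
    split_ifs <;> omega

end
end GraphAnon

namespace GraphAnon

/-! ### The passes over the edges -/

namespace Data

/-- All entries are zero. -/
def zero : Data := ⟨fun _ => 0, fun _ => 0, fun _ => 0, fun _ => 0, fun _ => 0, fun _ => 0⟩

/-- Record the neighbour `w` of `v`. -/
def add (d : Data) (v w : ℕ) : Data :=
  { d with
    deg := Function.update d.deg v (d.deg v + 1)
    nb1 := if d.deg v = 0 then Function.update d.nb1 v w else d.nb1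
    nb2 := if d.deg v = 1 then Function.update d.nb2 v w else d.nb2 }

/-- The neighbour other than `v` of a vertex `w` of degree two. -/
def other (d : Data) (v w : ℕ) : ℕ := if d.nb1 w = v then d.nb2 w else d.nb1 w

/-- Record what is reached from `v` through its neighbour `w`. -/
def visit (d : Data) (v w : ℕ) : Data :=
  if 2 < d.deg w then { d with ok := Function.update d.ok v 1 }
  else if d.deg w = 2 then
    if d.xx v = 0 then
      { d with xx := Function.update d.xx v (d.other v w + 1), tt := Function.update d.tt v w }
    else if d.xx v = d.other v w + 1 then d else { d with ok := Function.update d.ok v 1 }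
  else d

/-- Apply `f` to both orientations of each edge. -/
def pass (f : Data → ℕ → ℕ → Data) (d : Data) (E : List (ℕ × ℕ)) : Data :=
  E.foldl (fun d e => f (f d e.1 e.2) e.2 e.1) d

/-- The data computed by the two passes. -/
def compute (E : List (ℕ × ℕ)) : Data := pass visit (pass add zero E) E

end Data

/-- The neighbours of `v` in the order of the edges. -/
def nbl (E : List (ℕ × ℕ)) (v : ℕ) : List ℕ :=
  E.flatMap fun e => (if e.1 = v then [e.2] else []) ++ if e.2 = v then [e.1] else []

theorem mem_nbl {E : List (ℕ × ℕ)} {v w : ℕ} : w ∈ nbl E v ↔ LAdj E v w := by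
  simp only [nbl, List.mem_flatMap, List.mem_append, Prod.exists, LAdj]
  constructor
  · rintro ⟨a, b, h, h' | h'⟩ <;> split_ifs at h' with h0 <;> simp at h' <;> subst h0 h'
    exacts [.inl h, .inr h]
  · rintro (h | h)
    exacts [⟨_, _, h, .inl (by simp)⟩, ⟨_, _, h, .inr (by simp)⟩]

/-- This is where simplicity of the graph enters: lengths of these lists are true degrees, and the
first two entries are different neighbours. -/
theorem nbl_nodup {E : List (ℕ × ℕ)} (hE : (unord E).Nodup) (hi : ∀ v, ¬ LAdj E v v) (v : ℕ) :
    (nbl E v).Nodup := by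
  induction E with
  | nil => simp [nbl]
  | cons e E ih =>
    obtain ⟨a, b⟩ := e
    rw [unord, List.map_cons, List.nodup_cons] at hE
    have h1 := ih hE.2 fun v hv => hi v (by simp only [LAdj, List.mem_cons] at hv ⊢; tauto)
    have hab : a ≠ b := by rintro rfl; exact hi a (.inl (by simp))
    have h2 : ¬ LAdj E a b := fun h => hE.1 (mem_unord.mpr h)
    rw [nbl, List.flatMap_cons]
    change (_ ++ nbl E v).Nodup
    simp only
    split_ifs with h3 h4 h4
    · exact (hab (h3.trans h4.symm)).elim
    · subst h3
      simp [h1, mem_nbl, h2]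
    · subst h4
      simp [h1, mem_nbl]
      exact fun h => h2 h.symm
    · simpa using h1

theorem nbl_append_singleton (E : List (ℕ × ℕ)) (e : ℕ × ℕ) (v : ℕ) : nbl (E ++ [e]) v =
    nbl E v ++ ((if e.1 = v then [e.2] else []) ++ if e.2 = v then [e.1] else []) := by
  simp [nbl]

/-- The degrees and the first two neighbours agree with the lists of neighbours. -/
def Lists (d : Data) (N : ℕ → List ℕ) : Prop :=
  ∀ v, d.deg v = (N v).length ∧ d.nb1 v = (N v).getD 0 0 ∧ d.nb2 v = (N v).getD 1 0

/-- Entries not yet written are zero, in agreement with the default of `getD`, so lists of length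
zero, one and more match the branches of `Data.add`. -/
theorem Lists.add {d : Data} {N : ℕ → List ℕ} (h : Lists d N) (v w : ℕ) :
    Lists (d.add v w) fun x => N x ++ if v = x then [w] else [] := by
  intro x
  obtain ⟨h1, h2, h3⟩ := h x
  by_cases hx : v = x
  · subst hx
    simp only [Data.add, if_true, Function.update_self, List.length_append, List.length_singleton, h1]
    refine ⟨trivial, ?_, ?_⟩
    · match hN : N v with
      | [] => simp
      | a :: l => rw [hN] at h2; simp [h2]
    · match hN : N v with
      | [] => rw [hN] at h3; simp [h3]
      | [a] => simp
      | a :: b :: l => rw [hN] at h3; simp [h3]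
  · have hx' : x ≠ v := fun h => hx h.symm
    simp only [Data.add, hx, if_false, List.append_nil, Function.update_of_ne hx']
    refine ⟨h1, ?_, ?_⟩ <;> split_ifs <;> simp [Function.update_of_ne hx', h2, h3]

theorem lists_pass_add (E : List (ℕ × ℕ)) : Lists (Data.pass Data.add Data.zero E) (nbl E) ∧
    (Data.pass Data.add Data.zero E).ok = (fun _ => 0) ∧
    (Data.pass Data.add Data.zero E).xx = fun _ => 0 := by
  induction E using List.reverseRecOn with
  | nil => simp [Data.pass, Lists, nbl, Data.zero]
  | append_singleton E e ih =>
    simp only [Data.pass, List.foldl_append, List.foldl_cons, List.foldl_nil] at ih ⊢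
    refine ⟨?_, ih.2⟩
    have := (ih.1.add e.1 e.2).add e.2 e.1
    intro v
    rw [nbl_append_singleton, ← List.append_assoc]
    exact this v

/-- The data `d` is correct as far as the neighbours visited are concerned. -/
structure VisInv (E : List (ℕ × ℕ)) (d : Data) (V : ℕ → ℕ → Prop) : Prop where
  lists : Lists d (nbl E)
  sat : ∀ v, d.ok v ≠ 0 → Sat E [] v
  reach : ∀ v, d.ok v = 0 → ∀ w, V v w → d.deg w ≤ 2 ∧ ∀ u, LAdj E w u → u ≠ v → d.xx v = u + 1
  tt : ∀ v, d.xx v ≠ 0 → LAdj E v (d.tt v) ∧ d.deg (d.tt v) = 2 ∧ LAdj E (d.tt v) (d.xx v - 1) ∧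
    d.xx v - 1 ≠ v

/-- A neighbour of degree above two settles `v` at once, one of degree two contributes exactly the
vertex `d.other v w`, and a leaf contributes nothing. It is therefore enough to remember one reached
vertex: a second, different one settles `v`. -/
theorem VisInv.visit {E : List (ℕ × ℕ)} {d : Data} {V : ℕ → ℕ → Prop} (h : VisInv E d V)
    (hE : (unord E).Nodup) (hi : ∀ v, ¬ LAdj E v v) {v w : ℕ} (hvw : LAdj E v w) :
    VisInv E (d.visit v w) fun a b => V a b ∨ a = v ∧ b = w := by
  have hreach : ∀ {w u}, LAdj E v w → LAdj E w u → Reach E [] v u := fun {w u} h1 h2 =>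
    ⟨w, h1, fun hc => hi w (by rw [← hc] at h2; exact h2), .inl h2⟩
  have hok : Sat E [] v → VisInv E { d with ok := Function.update d.ok v 1 }
      fun a b => V a b ∨ a = v ∧ b = w := by
    intro hs
    refine ⟨h.lists, fun x hx => ?_, fun x hx y hy => ?_, h.tt⟩
    · by_cases hxv : x = v
      · exact hxv ▸ hs
      · exact h.sat x (by simpa [Function.update_of_ne hxv] using hx)
    · by_cases hxv : x = v
      · subst hxv; simp at hx
      · exact h.reach x (by simpa [Function.update_of_ne hxv] using hx) y (by tauto)
  obtain ⟨l1, l2, l3⟩ := h.lists w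
  have hnd := nbl_nodup hE hi w
  have hm : v ∈ nbl E w := mem_nbl.mpr hvw.symm
  have hother : d.deg w = 2 → LAdj E w (d.other v w) ∧ d.other v w ≠ v ∧
      ∀ u, LAdj E w u → u ≠ v → u = d.other v w := by
    intro h2
    obtain ⟨a, b, hab⟩ := List.length_eq_two.mp (l1.symm.trans h2)
    rw [hab] at hnd hm l2 l3
    simp at hnd hm l2 l3
    have hadj : ∀ u, LAdj E w u ↔ u = a ∨ u = b := by intro u; rw [← mem_nbl, hab]; simp
    unfold Data.other
    rw [l2, l3, hadj]
    split_ifs with hav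
    · exact ⟨.inr rfl, fun hc => hnd (hav.trans hc.symm), fun u hu huv => by
        rcases (hadj u).mp hu with rfl | rfl
        exacts [(huv hav).elim, rfl]⟩
    · refine ⟨.inl rfl, hav, fun u hu huv => ?_⟩
      rcases (hadj u).mp hu with rfl | rfl
      · rfl
      · rcases hm with hm | hm
        exacts [(hav hm.symm).elim, (huv hm.symm).elim]
  unfold Data.visit
  split_ifs with h1 h2 h3 h4
  · apply hok
    have hc : 1 < ((nbl E w).toFinset.erase v).card := by
      rw [Finset.card_erase_of_mem (by simpa using hm), List.toFinset_card_of_nodup hnd]; omega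
    obtain ⟨a, ha, b, hb, hab⟩ := Finset.one_lt_card.mp hc
    simp only [Finset.mem_erase, List.mem_toFinset, mem_nbl] at ha hb
    exact ⟨a, b, hab, ha.1, hb.1, hreach hvw ha.2, hreach hvw hb.2⟩
  · refine ⟨h.lists, h.sat, fun x hx y hy => ?_, fun x hx => ?_⟩
    · by_cases hxv : x = v
      · subst hxv
        simp only [Function.update_self]
        rcases hy with hy | ⟨-, rfl⟩
        · obtain ⟨g1, g2⟩ := h.reach x hx y hy
          refine ⟨g1, fun u hu hux => ?_⟩
          have := g2 u hu hux
          omega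
        · exact ⟨h2.le, fun u hu hux => by rw [(hother h2).2.2 u hu hux]⟩
      · simp only [Function.update_of_ne hxv]
        exact h.reach x hx y (by tauto)
    · by_cases hxv : x = v
      · subst hxv
        simp only [Function.update_self, Nat.add_sub_cancel]
        exact ⟨hvw, h2, (hother h2).1, (hother h2).2.1⟩
      · simp only [Function.update_of_ne hxv] at hx ⊢
        exact h.tt x hx
  · refine ⟨h.lists, h.sat, fun x hx y hy => ?_, h.tt⟩
    rcases hy with hy | ⟨rfl, rfl⟩
    · exact h.reach x hx y hy
    · exact ⟨h2.le, fun u hu hux => by rw [(hother h2).2.2 u hu hux, h4]⟩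
  · apply hok
    obtain ⟨g1, -, g2, g3⟩ := h.tt v h3
    exact ⟨_, _, by omega, g3, (hother h2).2.1, hreach g1 g2, hreach hvw (hother h2).1⟩
  · refine ⟨h.lists, h.sat, fun x hx y hy => ?_, h.tt⟩
    rcases hy with hy | ⟨rfl, rfl⟩
    · exact h.reach x hx y hy
    · refine ⟨by omega, fun u hu hux => ?_⟩
      have : 1 < (nbl E y).length := by
        rw [← List.toFinset_card_of_nodup hnd, Finset.one_lt_card]
        exact ⟨u, by simpa [mem_nbl] using hu, x, by simpa using hm, hux⟩
      omega

/-- The induction runs over the edges visited so far, while the degrees are those of the whole of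
`E`; this is why a complete first pass has to precede. -/
theorem visInv_compute {E : List (ℕ × ℕ)} (hE : (unord E).Nodup) (hi : ∀ v, ¬ LAdj E v v) :
    VisInv E (Data.compute E) (LAdj E) := by
  have key : ∀ L : List (ℕ × ℕ), (∀ e ∈ L, e ∈ E) →
      VisInv E (Data.pass Data.visit (Data.pass Data.add Data.zero E) L) (LAdj L) := by
    intro L
    induction L using List.reverseRecOn with
    | nil =>
      intro _
      obtain ⟨h1, h2, h3⟩ := lists_pass_add E
      change VisInv E (Data.pass Data.add Data.zero E) _
      refine ⟨h1, fun v hv => ?_, by simp [LAdj], fun v hv => ?_⟩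
      · exact (hv (by rw [h2])).elim
      · exact (hv (by rw [h3])).elim
    | append_singleton L e ih =>
      intro h
      have h1 := ih fun e he => h e (by simp [he])
      have he : LAdj E e.1 e.2 := .inl (h e (by simp))
      have h2 := (h1.visit hE hi he).visit hE hi he.symm
      simp only [Data.pass, List.foldl_append, List.foldl_cons, List.foldl_nil] at h2 ⊢
      refine ⟨h2.lists, h2.sat, fun v hv w hw => h2.reach v hv w ?_, h2.tt⟩
      rcases lAdj_append.mp hw with hw | hw
      · exact .inl (.inl hw)
      · rcases lAdj_singleton.mp hw with h | h <;> tauto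
  exact key E fun _ => id

/-- As no vertex is isolated, `nb1` is a genuine neighbour and not the default zero, and degree less
than two means degree one. -/
theorem prep_compute {n : ℕ} {E : List (ℕ × ℕ)} (hE : (unord E).Nodup) (hi : ∀ v, ¬ LAdj E v v)
    (hb : Below n E) (hpos : ∀ v < n, ∃ w, LAdj E v w) : Prep n E (Data.compute E) := by
  have h := visInv_compute hE hi
  have hlen : ∀ v < n, 1 ≤ (nbl E v).length := by
    intro v hv
    obtain ⟨w, hw⟩ := hpos v hv
    exact List.length_pos_of_mem (mem_nbl.mpr hw)
  refine ⟨hb, hi, fun v hv => ?_, fun v hv h2 w hw => ?_, fun v hv h2 => ?_,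
    fun v hv h2 w hw => ?_, fun v _ => h.sat v, fun v _ h0 w hw => (h.reach v h0 w hw).2,
    fun v _ _ => h.tt v⟩ <;>
    obtain ⟨l1, l2, l3⟩ := h.lists v <;> have l4 := hlen v hv <;> have l5 := nbl_nodup hE hi v
  · rw [← mem_nbl, l2]
    match hN : nbl E v with
    | [] => rw [hN] at l4; simp at l4
    | a :: l => simp
  · rw [← mem_nbl] at hw
    obtain ⟨a, ha⟩ := List.length_eq_one_iff.mp (show (nbl E v).length = 1 by omega)
    rw [ha] at hw l2
    simp at hw l2
    rw [hw, l2]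
  · rw [← mem_nbl, l2, l3]
    match hN : nbl E v with
    | [] => rw [hN] at l4; simp at l4
    | [a] => rw [hN] at l1; simp at l1; omega
    | a :: b :: l => rw [hN] at l5; simp at l5 ⊢; tauto
  · rw [← mem_nbl] at hw
    obtain ⟨a, b, ha⟩ := List.length_eq_two.mp (show (nbl E v).length = 2 by omega)
    rw [ha] at hw l2 l3
    simp at hw l2 l3
    rw [l2, l3]
    exact hw

end GraphAnon

namespace GraphAnon

/-! ### The programs for the passes -/

theorem State.setArr_arr_eq (s : State) (a i v b : ℕ) :
    (s.setArr a i v).arr b = if b = a then Function.update (s.arr a) i v else s.arr b := by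
  by_cases h : b = a
  · subst h; simp [State.setArr]
  · simp [State.setArr, h]

/-- The data held by the memory. -/
def State.data (s : State) : Data := ⟨s.arr 4, s.arr 5, s.arr 6, s.arr 7, s.arr 8, s.arr 9⟩

/-- `Data.add` for the vertices in the registers `v` and `w`. -/
def addProg (v w : ℕ) : Prog :=
  .load 8 4 v ;; .const 9 0 ;;
  .ite (.eq 8 9) (.store 5 v w) (.const 9 1 ;; .ite (.eq 8 9) (.store 6 v w) .nop) ;;
  .incr 8 ;; .store 4 v 8

/-- `Data.visit` for the vertices in the registers `v` and `w`. -/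
def visitProg (v w : ℕ) : Prog :=
  .load 8 4 w ;; .const 9 2 ;;
  .ite (.lt 9 8) (.const 9 1 ;; .store 7 v 9)
    (.ite (.eq 8 9)
      (.load 8 5 w ;; .ite (.eq 8 v) (.load 8 6 w) .nop ;; .incr 8 ;; .load 9 8 v ;;
        .const 14 0 ;; .ite (.eq 9 14) (.store 8 v 8 ;; .store 9 v w)
          (.ite (.eq 9 8) .nop (.const 9 1 ;; .store 7 v 9)))
      .nop)

/-- Apply `p` to both orientations of each edge. -/
def passProg (p : ℕ → ℕ → Prog) : Prog :=
  .const 5 0 ;; .loop (.lt 5 1) (.load 6 0 5 ;; .load 7 1 5 ;; p 6 7 ;; p 7 6 ;; .incr 5)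

/-- Only the data and the registers from 8 on have changed. -/
def Frame (s s' : State) : Prop :=
  (∀ x < 8, s'.reg x = s.reg x) ∧ (∀ a, a < 4 ∨ 9 < a → s'.arr a = s.arr a)

theorem Frame.trans {s s' s'' : State} (h : Frame s s') (h' : Frame s' s'') : Frame s s'' :=
  ⟨fun x hx => (h'.1 x hx).trans (h.1 x hx), fun a ha => (h'.2 a ha).trans (h.2 a ha)⟩

theorem addProg_wp {v w : ℕ} (hv : v < 8) (hw : w < 8) (s : State) :
    wp (addProg v w) (fun s' => s'.data = s.data.add (s.reg v) (s.reg w) ∧ Frame s s') s := by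
  have h1 : v ≠ 8 ∧ v ≠ 9 ∧ w ≠ 8 ∧ w ≠ 9 := by omega
  have h2 : ∀ x < 8, x ≠ 8 ∧ x ≠ 9 := by omega
  have h3 : ∀ a, a < 4 ∨ 9 < a → a ≠ 4 ∧ a ≠ 5 ∧ a ≠ 6 := by omega
  simp only [addProg, wp, Test.Holds, State.data, Data.add, Frame]
  refine ⟨fun h => ?_, fun h => ⟨fun h' => ?_, fun h' => ?_⟩⟩
  · simp at h
    refine ⟨by simp [State.setArr_arr_eq, h1, h], fun x hx => ?_, fun a ha => ?_⟩
    · simp [h2 x hx]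
    · simp [State.setArr_arr_eq, h3 a ha]
  · simp at h h'
    refine ⟨by simp [State.setArr_arr_eq, h1, h'], fun x hx => ?_, fun a ha => ?_⟩
    · simp [h2 x hx]
    · simp [State.setArr_arr_eq, h3 a ha]
  · simp at h h'
    refine ⟨by simp [State.setArr_arr_eq, h1, h, h'], fun x hx => ?_, fun a ha => ?_⟩
    · simp [h2 x hx]
    · simp [State.setArr_arr_eq, h3 a ha]

theorem visitProg_wp {v w : ℕ} (hv : v < 8) (hw : w < 8) (s : State) :
    wp (visitProg v w) (fun s' => s'.data = s.data.visit (s.reg v) (s.reg w) ∧ Frame s s') s := by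
  have h1 : v ≠ 8 ∧ v ≠ 9 ∧ v ≠ 14 ∧ w ≠ 8 ∧ w ≠ 9 ∧ w ≠ 14 := by omega
  have h2 : ∀ x < 8, x ≠ 8 ∧ x ≠ 9 ∧ x ≠ 14 := by omega
  have h3 : ∀ a, a < 4 ∨ 9 < a → a ≠ 7 ∧ a ≠ 8 ∧ a ≠ 9 := by omega
  have hF : ∀ s' : State, (∀ x, x ≠ 8 → x ≠ 9 → x ≠ 14 → s'.reg x = s.reg x) →
      (∀ a, a ≠ 7 → a ≠ 8 → a ≠ 9 → s'.arr a = s.arr a) → Frame s s' := fun s' h h' =>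
    ⟨fun x hx => h x (h2 x hx).1 (h2 x hx).2.1 (h2 x hx).2.2,
      fun a ha => h' a (h3 a ha).1 (h3 a ha).2.1 (h3 a ha).2.2⟩
  simp only [visitProg, wp, Test.Holds, State.data, Data.visit, Data.other]
  refine ⟨fun ha => ?_, fun ha => ⟨fun hb => ⟨fun hc => ⟨fun he => ?_, fun he => ⟨fun hf => ?_,
    fun hf => ?_⟩⟩, fun hc => ⟨fun he => ?_, fun he => ⟨fun hf => ?_, fun hf => ?_⟩⟩⟩, fun hb => ?_⟩⟩
  all_goals
    refine ⟨?_, hF _ (fun x hx hx' hx'' => by simp [hx, hx', hx'']) fun a ha ha' ha'' => by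
      simp [State.setArr_arr_eq, ha, ha', ha'']⟩
  · simp at ha
    simp [State.setArr_arr_eq, h1, ha]
  · simp [h1] at ha hb hc he
    simp [State.setArr_arr_eq, h1, hb, hc, he]
  · simp [h1] at ha hb hc he hf
    simp [h1, hb, hc, hf]
  · simp [h1] at ha hb hc he hf
    simp [State.setArr_arr_eq, h1, hb, hc, he, hf]
  · simp [h1] at ha hb hc he
    simp [State.setArr_arr_eq, h1, hb, hc, he]
  · simp [h1] at ha hb hc he hf
    simp [h1, hb, hc, hf]
  · simp [h1] at ha hb hc he hf
    simp [State.setArr_arr_eq, h1, hb, hc, he, hf]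
  · simp at ha hb
    have : ¬ 2 < s.arr 4 (s.reg w) := by omega
    simp [hb, this]

/-- `Frame` hides the body of the loop: the registers below 8 hold the loop counter and the current
edge, the arrays below 4 the graph and the output. Array 10 is followed because the marks made later
must start from zero. -/
theorem passProg_runs {p : ℕ → ℕ → Prog} {f : Data → ℕ → ℕ → Data} {C : ℕ}
    (hp : ∀ v w, v < 8 → w < 8 → ∀ s : State,
      wp (p v w) (fun s' => s'.data = f s.data (s.reg v) (s.reg w) ∧ Frame s s') s)
    (hC : ∀ v w, cost (p v w) = C) {n : ℕ} {E : List (ℕ × ℕ)} {s : State} (hs : Rep n E [] s) :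
    Runs (passProg p) s (E.length * (2 * C + 4) + 2) fun s' =>
      s'.data = s.data.pass f E ∧ Rep n E [] s' ∧ s'.arr 10 = s.arr 10 := by
  have hrep : ∀ {s s' : State}, (∀ x < 3, s'.reg x = s.reg x) → (∀ a < 4, s'.arr a = s.arr a) →
      Rep n E [] s → Rep n E [] s' := by
    intro s s' h1 h2 h
    refine ⟨(h1 0 (by omega)).trans h.reg_zero, (h1 1 (by omega)).trans h.reg_one,
      (h1 2 (by omega)).trans h.reg_two, fun i e he => ?_, fun i e he => by simp at he⟩
    rw [h2 0 (by omega), h2 1 (by omega)]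
    exact h.edges i e he
  let I : ℕ → State → Prop := fun k s' => s'.reg 5 = k ∧ Rep n E [] s' ∧
    s'.data = s.data.pass f (E.take k) ∧ s'.arr 10 = s.arr 10
  refine Runs.mono (T := 1 + (E.length * ((2 * C + 3) + 1) + 1)) (Runs.seq (Runs.of_wp
    (p := .const 5 0) (Q := I 0) ⟨by simp, hs.setReg (by omega) 0, by simp [Data.pass]; rfl,
      rfl⟩) fun s₁ h₁ => Runs.for I (fun k s h => ⟨h.1, h.2.1.reg_one⟩) (fun k s₂ hk h₂ => ?_) h₁)
    (by ring_nf; omega) fun s' h => ⟨?_, h.2.1, h.2.2.2⟩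
  · obtain ⟨g1, g2, g3, g4⟩ := h₂
    obtain ⟨e1, e2⟩ := g2.edges k E[k] (List.getElem?_eq_getElem hk)
    refine Runs.mono (Runs.of_wp ?_) (by simp only [cost, hC]; omega) fun _ => id
    simp only [wp]
    have h3 : Rep n E [] ((s₂.setReg 6 (s₂.arr 0 (s₂.reg 5))).setReg 7
        ((s₂.setReg 6 (s₂.arr 0 (s₂.reg 5))).arr 1
          ((s₂.setReg 6 (s₂.arr 0 (s₂.reg 5))).reg 5))) :=
      (g2.setReg (by omega) _).setReg (by omega) _
    refine (hp 6 7 (by omega) (by omega) _).mono fun s₃ ⟨q1, q2⟩ =>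
      (hp 7 6 (by omega) (by omega) _).mono fun s₄ ⟨r1, r2⟩ => ?_
    have hf := q2.trans r2
    refine ⟨?_, hrep (fun x hx => ?_) (fun a ha => hf.2 a (.inl ha)) h3, ?_, ?_⟩
    · simp [hf.1 5 (by omega), g1]
    · rw [← hf.1 x (by omega), State.setReg_reg, if_neg (by omega)]
    · have k6 : ((s₂.setReg 6 (s₂.arr 0 (s₂.reg 5))).setReg 7
          ((s₂.setReg 6 (s₂.arr 0 (s₂.reg 5))).arr 1
            ((s₂.setReg 6 (s₂.arr 0 (s₂.reg 5))).reg 5))).reg 6 = E[k].1 := by simp [g1, e1]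
      have k7 : ((s₂.setReg 6 (s₂.arr 0 (s₂.reg 5))).setReg 7
          ((s₂.setReg 6 (s₂.arr 0 (s₂.reg 5))).arr 1
            ((s₂.setReg 6 (s₂.arr 0 (s₂.reg 5))).reg 5))).reg 7 = E[k].2 := by simp [g1, e2]
      change s₄.data = _
      rw [r1, q1, q2.1 6 (by omega), q2.1 7 (by omega), k6, k7]
      rw [List.take_succ_eq_append_getElem hk]
      simp only [Data.pass, List.foldl_append, List.foldl_cons, List.foldl_nil] at g3 ⊢
      rw [← g3]
      rfl
    · exact (hf.2 10 (by omega)).trans g4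
  · rw [h.2.2.1, List.take_length]

/-- The first two passes. -/
def computeProg : Prog := passProg addProg ;; passProg visitProg

theorem computeProg_runs {n : ℕ} {E : List (ℕ × ℕ)} {s : State} (hs : Rep n E [] s)
    (h0 : s.data = Data.zero) :
    Runs computeProg s (E.length * 52 + 4) fun s' =>
      s'.data = Data.compute E ∧ Rep n E [] s' ∧ s'.arr 10 = s.arr 10 := by
  refine Runs.mono (T := E.length * 20 + 2 + (E.length * 32 + 2)) (Runs.seq
    (passProg_runs (C := 8) (fun v w hv hw => addProg_wp hv hw) (fun _ _ => rfl) hs)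
    fun s₁ h₁ => Runs.mono (passProg_runs (C := 14) (fun v w hv hw => visitProg_wp hv hw)
      (fun _ _ => rfl) h₁.2.1) le_rfl fun s₂ h₂ => ⟨?_, h₂.2.1, h₂.2.2.trans h₁.2.2⟩)
    (by omega) fun _ h => h
  rw [h₂.1, h₁.1, h0, Data.compute]

end GraphAnon

namespace GraphAnon

/-! ### The program for the pass over the vertices -/

/-- Append the pair in the registers `a` and `b` to the output. -/
def emitProg (a b : ℕ) : Prog := .store 2 2 a ;; .store 3 2 b ;; .incr 2

/-- `Pool.usePair` for the vertex in register 5 and its neighbour in register 7. -/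
def usePairProg : Prog :=
  .ite (.eq 13 9) (.copy 13 5 ;; .incr 13)
    (.decr 13 ;; .load 8 5 13 ;; emitProg 13 5 ;; emitProg 13 7 ;; emitProg 8 5 ;; emitProg 8 7 ;;
      .const 13 0)

/-- `Pool.useSlot` for the vertex in register 6 and the slot in register `r`. -/
def useSlotProg (r : ℕ) : Prog :=
  .ite (.eq r 9) (.copy r 6 ;; .incr r) (.decr r ;; emitProg r 6 ;; .const r 0)

/-- Run `q` if the slot in register `r` holds the content of register 7 or 8, and use that slot
otherwise. -/
def trySlotProg (r : ℕ) (q : Prog) : Prog :=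
  .ite (.eq r 7) q (.ite (.eq r 8) q (useSlotProg r))

/-- Use the first slot that does not hold a neighbour of the vertex `d.tt v`, where `v` is in
register 5. -/
def pushProg : Prog :=
  .load 6 9 5 ;; .load 7 5 6 ;; .incr 7 ;; .load 8 6 6 ;; .incr 8 ;;
  trySlotProg 10 (trySlotProg 11 (useSlotProg 12))

/-- `Pool.step` for the vertex in register 5. -/
def stepProg : Prog :=
  .const 9 0 ;; .load 6 7 5 ;;
  .ite (.eq 6 9)
    (.load 6 8 5 ;;
      .ite (.eq 6 9)
        (.load 6 4 5 ;; .const 8 2 ;;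
          .ite (.lt 6 8)
            (.load 7 5 5 ;; .ite (.lt 5 7) usePairProg .nop)
            (.load 6 5 5 ;; .load 7 6 5 ;; emitProg 6 7))
        (.decr 6 ;; .load 8 7 6 ;;
          .ite (.lt 6 5) (.ite (.eq 8 9) .nop pushProg) pushProg))
    .nop

/-- Apply `Pool.step` to all vertices. -/
def poolProg : Prog :=
  (.const 10 0 ;; .const 11 0 ;; .const 12 0 ;; .const 13 0 ;; .const 5 0) ;;
  .loop (.lt 5 0) (stepProg ;; .incr 5)

/-- The memory holds the graph, the data and the pool, and array 10 marks the members of `A`. -/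
structure Holds (n : ℕ) (E : List (ℕ × ℕ)) (d : Data) (A : List ℕ) (M : Pool) (s : State) : Prop where
  rep : Rep n E M.out s
  data : s.data = d
  slot : ∀ j < 3, s.reg (10 + j) = M.c j
  pend : s.reg 13 = M.pend
  marks : ∀ x, s.arr 10 x = if x ∈ A then 1 else 0

section
variable {n : ℕ} {E : List (ℕ × ℕ)} {d : Data} {A : List ℕ} {M : Pool} {s : State}

theorem Holds.setReg (h : Holds n E d A M s) {x : ℕ} (hx : 3 ≤ x)
    (hx' : x < 10 ∨ 13 < x) (v : ℕ) :
    Holds n E d A M (s.setReg x v) := by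
  refine ⟨h.rep.setReg hx v, h.data, fun j hj => ?_, ?_, h.marks⟩
  · rw [State.setReg_reg, if_neg (by omega)]; exact h.slot j hj
  · rw [State.setReg_reg, if_neg (by omega)]; exact h.pend

theorem Holds.setSlot (h : Holds n E d A M s) {j : ℕ} (hj : j < 3) (v : ℕ) :
    Holds n E d A { M with c := Function.update M.c j v } (s.setReg (10 + j) v) := by
  refine ⟨h.rep.setReg (by omega) v, h.data, fun k hk => ?_, ?_, h.marks⟩
  · change _ = Function.update M.c j v k
    rw [State.setReg_reg, Function.update_apply]
    by_cases hkj : k = j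
    · simp [hkj]
    · rw [if_neg (by omega), if_neg hkj]; exact h.slot k hk
  · rw [State.setReg_reg, if_neg (by omega)]; exact h.pend

theorem Holds.setPend (h : Holds n E d A M s) (v : ℕ) :
    Holds n E d A { M with pend := v } (s.setReg 13 v) := by
  refine ⟨h.rep.setReg (by omega) v, h.data, fun k hk => ?_, ?_, h.marks⟩
  · rw [State.setReg_reg, if_neg (by omega)]; exact h.slot k hk
  · simp

theorem Stores.push {s : State} {H : List (ℕ × ℕ)} (h : Stores s 2 3 H) (x y : ℕ)
    (hr : s.reg 2 = H.length) :
    Stores (((s.setArr 2 (s.reg 2) x).setArr 3 (s.reg 2) y).setReg 2 (s.reg 2 + 1)) 2 3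
      (H ++ [(x, y)]) := by
  rw [Stores.append_singleton]
  refine ⟨fun i e he => ?_, by simp [hr], by simp [hr]⟩
  have hi : i ≠ s.reg 2 := by
    rw [hr]; exact (List.getElem?_eq_some_iff.mp he).1.ne
  have := h i e he
  simpa [hi] using this

theorem emitProg_wp (h : Holds n E d A M s) (a b : ℕ) :
    wp (emitProg a b) (fun s' => Holds n E d A { M with out := M.out ++ [(s.reg a, s.reg b)] } s' ∧
      ∀ x, 3 ≤ x → s'.reg x = s.reg x) s := by
  simp only [emitProg, wp]
  refine ⟨⟨⟨?_, ?_, ?_, ?_, ?_⟩, ?_, fun j hj => ?_, ?_, ?_⟩, fun x hx => ?_⟩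
  · simpa using h.rep.reg_zero
  · simpa using h.rep.reg_one
  · simpa using h.rep.reg_two
  · intro i e he
    simpa using h.rep.edges i e he
  · exact h.rep.output.push _ _ h.rep.reg_two
  · rw [← h.data]; simp [State.data, State.setArr_arr_eq]
  · have := h.slot j hj
    simp only [State.setReg_reg, State.setArr_reg]
    rwa [if_neg (by omega)]
  · simpa using h.pend
  · simpa [State.setArr_arr_eq] using h.marks
  · simp only [State.setReg_reg, State.setArr_reg]
    rw [if_neg (by omega)]

theorem usePairProg_wp (h : Holds n E d A M s) (h9 : s.reg 9 = 0) (h7 : s.reg 7 = d.nb1 (s.reg 5)) :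
    wp usePairProg (fun s' => Holds n E d A (M.usePair d (s.reg 5)) s' ∧ s'.reg 5 = s.reg 5) s := by
  have hp := h.pend
  refine ⟨fun h0 => ?_, fun h0 => ?_⟩
  · have h0 : M.pend = 0 := by rw [← hp, ← h9]; exact h0
    rw [Pool.usePair, if_pos h0]
    refine ⟨?_, by simp⟩
    -- Copying and then incrementing passes through a meaningless intermediate pool, which is
    -- overwritten at once.
    have := (h.setPend (s.reg 5)).setPend (s.reg 5 + 1)
    simpa [wp] using this
  · have h0 : M.pend ≠ 0 := by rw [← hp, ← h9]; exact h0
    rw [Pool.usePair, if_neg h0]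
    simp only [wp]
    have hd : s.arr 5 = d.nb1 := by rw [← h.data]; rfl
    -- Until it is cleared, register 13 holds the waiting vertex itself instead of its successor; a
    -- temporary pool keeps track of this.
    have h1 := (h.setPend (s.reg 13 - 1)).setReg (x := 8) (by omega) (by omega)
      (s.arr 5 (s.reg 13 - 1))
    simp only [State.setReg_reg, State.setReg_arr, if_true]
    refine (emitProg_wp h1 _ _).mono fun s₁ ⟨h2, r2⟩ => ?_
    refine (emitProg_wp h2 _ _).mono fun s₂ ⟨h3, r3⟩ => ?_
    refine (emitProg_wp h3 _ _).mono fun s₃ ⟨h4, r4⟩ => ?_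
    refine (emitProg_wp h4 _ _).mono fun s₄ ⟨h5, r5⟩ => ?_
    have R : ∀ x, 3 ≤ x → s₃.reg x = _ := fun x hx =>
      (r4 x hx).trans ((r3 x hx).trans (r2 x hx))
    refine ⟨?_, ?_⟩
    · have := h5.setPend 0
      simpa [r2, r3, r4, hd, hp, h7] using this
    · simp [r2, r3, r4, r5]

theorem useSlotProg_wp (h : Holds n E d A M s) (h9 : s.reg 9 = 0) {j : ℕ} (hj : j < 3) :
    wp (useSlotProg (10 + j)) (fun s' => Holds n E d A (M.useSlot (s.reg 6) j) s' ∧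
      s'.reg 5 = s.reg 5) s := by
  have hs := h.slot j hj
  have e : (5 = 10 + j) = False := by simp; omega
  have e' : (6 = 10 + j) = False := by simp; omega
  refine ⟨fun h0 => ?_, fun h0 => ?_⟩
  · have h0 : M.c j = 0 := by rw [← hs, ← h9]; exact h0
    rw [Pool.useSlot, if_pos h0]
    have := (h.setSlot hj (s.reg 6)).setSlot hj (s.reg 6 + 1)
    refine ⟨by simpa [wp] using this, by simp [e]⟩
  · have h0 : M.c j ≠ 0 := by rw [← hs, ← h9]; exact h0
    rw [Pool.useSlot, if_neg h0]
    simp only [wp]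
    have h1 := h.setSlot hj (s.reg (10 + j) - 1)
    refine (emitProg_wp h1 _ _).mono fun s₁ ⟨h2, r2⟩ => ?_
    have := h2.setSlot hj 0
    refine ⟨by simpa [hs, e'] using this, by simp [r2, e]⟩

/-- A slot is rejected by either of two tests, so the next slot is reached along two branches; the
seven leaves of the program correspond to the three values of `slotFor`. -/
theorem pushProg_wp (h : Holds n E d A M s) (h9 : s.reg 9 = 0) :
    wp pushProg (fun s' => Holds n E d A
      (M.useSlot (d.tt (s.reg 5)) (M.slotFor d (d.tt (s.reg 5)))) s' ∧ s'.reg 5 = s.reg 5) s := by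
  have hd1 : s.arr 5 = d.nb1 := by rw [← h.data]; rfl
  have hd2 : s.arr 6 = d.nb2 := by rw [← h.data]; rfl
  have hd3 : s.arr 9 = d.tt := by rw [← h.data]; rfl
  simp only [pushProg, trySlotProg, wp]
  set t := d.tt (s.reg 5) with ht
  generalize hs' : State.setReg _ 8 _ = s'
  have H : Holds n E d A M s' ∧ s'.reg 9 = 0 ∧ s'.reg 5 = s.reg 5 ∧ s'.reg 6 = t ∧
      s'.reg 7 = d.nb1 t + 1 ∧ s'.reg 8 = d.nb2 t + 1 := by
    subst hs'
    refine ⟨?_, by simp [h9], by simp, by simp [hd3, ht], by simp [hd3, hd1, ht],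
      by simp [hd3, hd2, ht]⟩
    refine Holds.setReg ?_ (by omega) (by omega) _
    refine Holds.setReg ?_ (by omega) (by omega) _
    refine Holds.setReg ?_ (by omega) (by omega) _
    refine Holds.setReg ?_ (by omega) (by omega) _
    exact Holds.setReg h (by omega) (by omega) _
  obtain ⟨H, H9, H5, H6, H7, H8⟩ := H
  have c0 := H.slot 0 (by omega)
  have c1 := H.slot 1 (by omega)
  simp only [Nat.add_zero, Nat.reduceAdd] at c0 c1
  have U := fun j hj => useSlotProg_wp H H9 (j := j) hj
  rw [H6, H5] at U
  simp only [Test.Holds, c0, c1, H7, H8]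
  have U0 : M.c 0 ≠ d.nb1 t + 1 → M.c 0 ≠ d.nb2 t + 1 → M.slotFor d t = 0 := fun h h' => by
    rw [Pool.slotFor, if_pos ⟨h, h'⟩]
  have U1 : ¬ (M.c 0 ≠ d.nb1 t + 1 ∧ M.c 0 ≠ d.nb2 t + 1) → M.c 1 ≠ d.nb1 t + 1 →
      M.c 1 ≠ d.nb2 t + 1 → M.slotFor d t = 1 := fun h h' h'' => by
    rw [Pool.slotFor, if_neg h, if_pos ⟨h', h''⟩]
  have U2 : ¬ (M.c 0 ≠ d.nb1 t + 1 ∧ M.c 0 ≠ d.nb2 t + 1) →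
      ¬ (M.c 1 ≠ d.nb1 t + 1 ∧ M.c 1 ≠ d.nb2 t + 1) → M.slotFor d t = 2 := fun h h' => by
    rw [Pool.slotFor, if_neg h, if_neg h']
  refine ⟨fun a => ⟨fun b => ?_, fun b => ⟨fun c => ?_, fun c => ?_⟩⟩, fun a => ⟨fun a' => ⟨fun b =>
    ?_, fun b => ⟨fun c => ?_, fun c => ?_⟩⟩, fun a' => ?_⟩⟩
  · rw [U2 (by tauto) (by tauto)]; exact U 2 (by omega)
  · rw [U2 (by tauto) (by tauto)]; exact U 2 (by omega)
  · rw [U1 (by tauto) b c]; exact U 1 (by omega)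
  · rw [U2 (by tauto) (by tauto)]; exact U 2 (by omega)
  · rw [U2 (by tauto) (by tauto)]; exact U 2 (by omega)
  · rw [U1 (by tauto) b c]; exact U 1 (by omega)
  · rw [U0 a a']; exact U 0 (by omega)

theorem stepProg_wp (h : Holds n E d A M s) :
    wp stepProg (fun s' => Holds n E d A (M.step d (s.reg 5)) s' ∧ s'.reg 5 = s.reg 5) s := by
  have d1 : s.arr 4 = d.deg := by rw [← h.data]; rfl
  have d2 : s.arr 5 = d.nb1 := by rw [← h.data]; rfl
  have d3 : s.arr 6 = d.nb2 := by rw [← h.data]; rfl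
  have d4 : s.arr 7 = d.ok := by rw [← h.data]; rfl
  have d5 : s.arr 8 = d.xx := by rw [← h.data]; rfl
  have K : ∀ {s : State}, Holds n E d A M s → ∀ x v, 3 ≤ x → x < 10 →
      Holds n E d A M (s.setReg x v) := fun h x v hx hx' => h.setReg hx (.inl hx') v
  simp only [stepProg, wp, Test.Holds, Pool.step]
  simp only [State.setReg_reg, State.setReg_arr, d1, d2, d3, d4, d5]
  simp only [if_true, Nat.reduceEqDiff, if_false]
  have h1 := K (K h 9 0 (by omega) (by omega)) 6 (d.ok (s.reg 5)) (by omega) (by omega)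
  refine ⟨fun a => ?_, fun a => ?_⟩
  · rw [if_pos a]
    have h2 := K h1 6 (d.xx (s.reg 5)) (by omega) (by omega)
    refine ⟨fun b => ?_, fun b => ?_⟩
    · rw [if_pos b]
      have h3 := K (K h2 6 (d.deg (s.reg 5)) (by omega) (by omega)) 8 2 (by omega) (by omega)
      refine ⟨fun c => ?_, fun c => ?_⟩
      · rw [if_pos c]
        have h4 := K h3 7 (d.nb1 (s.reg 5)) (by omega) (by omega)
        refine ⟨fun e => ?_, fun e => ?_⟩
        · rw [if_pos e]
          have := usePairProg_wp h4 (by simp) (by simp)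
          simpa using this
        · rw [if_neg e]
          exact ⟨h4, by simp⟩
      · rw [if_neg c]
        have h4 := K (K h3 6 (d.nb1 (s.reg 5)) (by omega) (by omega)) 7 (d.nb2 (s.reg 5))
          (by omega) (by omega)
        refine (emitProg_wp h4 _ _).mono fun s' h' => ?_
        simp only [State.setReg_reg] at h'
        refine ⟨by simpa using h'.1, ?_⟩
        have := h'.2 5 (by omega)
        simpa using this
    · rw [if_neg b]
      have h3 := K (K h2 6 (d.xx (s.reg 5) - 1) (by omega) (by omega)) 8
        (d.ok (d.xx (s.reg 5) - 1)) (by omega) (by omega)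
      have P := pushProg_wp h3 (by simp)
      simp only [State.setReg_reg, Nat.reduceEqDiff, if_false] at P
      refine ⟨fun c => ⟨fun e => ?_, fun e => ?_⟩, fun c => ?_⟩
      · rw [if_pos ⟨c, e⟩]
        exact ⟨h3, by simp⟩
      · rw [if_neg (by tauto)]
        exact P
      · rw [if_neg (by tauto)]
        exact P
  · rw [if_neg a]
    exact ⟨h1, by simp⟩

theorem poolProg_runs (hr : Rep n E [] s) (hd : s.data = d) (hm : ∀ x, s.arr 10 x = 0) :
    Runs poolProg s (n * 40 + 10) (Holds n E d [] (Pool.upTo d n)) := by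
  let I : ℕ → State → Prop := fun k s' => s'.reg 5 = k ∧ Holds n E d [] (Pool.upTo d k) s'
  refine Runs.mono (Q := I n) (Runs.seq (R := I 0) (Runs.of_wp ?_) fun s' h' =>
    Runs.for (T := 39) I (fun k s h => ⟨h.1, h.2.rep.reg_zero⟩) (fun k s' hk h' => ?_) h') ?_
    fun _ h => h.2
  · refine ⟨by simp, ?_, hd, fun j hj => ?_, by simp [Pool.upTo, Pool.empty], by simpa using hm⟩
    · refine Rep.setReg ?_ (by omega) _
      refine Rep.setReg ?_ (by omega) _
      refine Rep.setReg ?_ (by omega) _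
      refine Rep.setReg ?_ (by omega) _
      exact Rep.setReg hr (by omega) _
    · interval_cases j <;> simp [Pool.upTo, Pool.empty]
  · refine Runs.mono ((Runs.of_wp (stepProg_wp h'.2)).seq (T₂ := 1) fun s'' h'' => Runs.of_wp ?_)
      (by decide) fun _ => id
    rw [h'.1] at h''
    exact ⟨by simp [h''.2], h''.1.setReg (by omega) (by omega) _⟩
  · simp only [cost]
    omega

end

end GraphAnon

namespace GraphAnon

/-! ### The program that serves what is waiting -/

/-- Mark the vertex in register `x`. -/
def markProg (x : ℕ) : Prog := .const 9 1 ;; .store 10 x 9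

/-- Mark the vertex in slot `j` and its first two neighbours. -/
def markSlotProg (j : ℕ) : Prog :=
  .copy 5 (10 + j) ;; .decr 5 ;; markProg 5 ;; .load 6 5 5 ;; markProg 6 ;; .load 6 6 5 ;;
  markProg 6

/-- Mark all vertices that are to be avoided. -/
def marksProg : Prog :=
  markSlotProg 0 ;; markSlotProg 1 ;; markSlotProg 2 ;;
  .copy 5 13 ;; .decr 5 ;; markProg 5 ;; .load 6 5 5 ;; markProg 6

/-- Put a vertex that is not marked into register `r`, and mark it. -/
def findProg (r : ℕ) : Prog :=
  (.const 5 0 ;; .const 8 15 ;; .const 9 0) ;;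
  .loop (.lt 5 8) (.load 6 10 5 ;; .ite (.eq 6 9) (.copy r 5) .nop ;; .incr 5) ;; markProg r

/-- `Pool.slotEdge` for the vertices in the registers from 14 on. -/
def slotEdgeProg (j : ℕ) : Prog :=
  .ite (.eq (10 + j) 9) .nop (.copy 5 (10 + j) ;; .decr 5 ;; emitProg 5 (14 + j))

/-- `Pool.partner` for the vertices in the registers from 14 on. -/
def partnerProg (j : ℕ) : Prog :=
  .ite (.eq (10 + j) 9) (.copy 7 (14 + j)) (.copy 7 (10 + j) ;; .decr 7)

/-- `Pool.last` for the vertices in the registers from 14 on. -/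
def lastProg : Prog :=
  .const 9 0 ;;
  .ite (.eq 13 9) (slotEdgeProg 0 ;; slotEdgeProg 1 ;; slotEdgeProg 2)
    (.copy 5 13 ;; .decr 5 ;; .load 6 5 5 ;; partnerProg 0 ;; emitProg 5 7 ;; partnerProg 1 ;;
      emitProg 5 7 ;; partnerProg 2 ;; emitProg 6 7 ;; emitProg 6 17)

/-- Serve what is waiting by vertices that are not adjacent to it. -/
def finishProg : Prog :=
  marksProg ;; findProg 14 ;; findProg 15 ;; findProg 16 ;; findProg 17 ;; lastProg

section
variable {n : ℕ} {E : List (ℕ × ℕ)} {d : Data} {A : List ℕ} {M : Pool} {s : State}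

theorem markProg_wp (h : Holds n E d A M s) {x : ℕ} (hx : x ≠ 9) :
    wp (markProg x) (fun s' => Holds n E d (A ++ [s.reg x]) M s' ∧
      ∀ y, y ≠ 9 → s'.reg y = s.reg y) s := by
  have h1 := h.setReg (x := 9) (by omega) (by omega) 1
  refine ⟨⟨⟨h1.rep.reg_zero, h1.rep.reg_one, h1.rep.reg_two, fun i e he => ?_, fun i e he => ?_⟩,
    ?_, h1.slot, h1.pend, fun y => ?_⟩, fun y hy => by simp [hy]⟩
  · simpa using h1.rep.edges i e he
  · simpa using h1.rep.output i e he
  · rw [← h1.data]; simp [State.data, State.setArr_arr_eq]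
  · have := h1.marks y
    simp only [State.setReg_arr] at this
    simp only [State.setArr_arr, State.setReg_reg, State.setReg_arr, hx, this]
    by_cases hy : y = s.reg x <;> simp [hy]

theorem markSlotProg_wp (h : Holds n E d A M s) {j : ℕ} (hj : j < 3) :
    wp (markSlotProg j) (Holds n E d
      (A ++ [M.c j - 1, d.nb1 (M.c j - 1), d.nb2 (M.c j - 1)]) M) s := by
  simp only [markSlotProg, wp]
  have hs := h.slot j hj
  have h1 := (h.setReg (x := 5) (by omega) (by omega) (s.reg (10 + j))).setReg (x := 5) (by omega)
    (by omega) (s.reg (10 + j) - 1)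
  simp only [State.setReg_reg, if_true]
  refine (markProg_wp h1 (by omega)).mono fun s₁ ⟨h2, r2⟩ => ?_
  have d1 : s₁.arr 5 = d.nb1 := by rw [← h2.data]; rfl
  have h3 := h2.setReg (x := 6) (by omega) (by omega) (s₁.arr 5 (s₁.reg 5))
  refine (markProg_wp h3 (by omega)).mono fun s₂ ⟨h4, r4⟩ => ?_
  have d2 : s₂.arr 6 = d.nb2 := by rw [← h4.data]; rfl
  have h5 := h4.setReg (x := 6) (by omega) (by omega) (s₂.arr 6 (s₂.reg 5))
  refine (markProg_wp h5 (by omega)).mono fun s₃ ⟨h6, _⟩ => ?_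
  simpa [r4, r2, d1, d2, hs] using h6

theorem marksProg_wp (h : Holds n E d [] M s) :
    wp marksProg (Holds n E d (M.marks d) M) s := by
  refine (markSlotProg_wp h (j := 0) (by omega)).mono fun s₁ h1 => ?_
  refine (markSlotProg_wp h1 (j := 1) (by omega)).mono fun s₂ h2 => ?_
  refine (markSlotProg_wp h2 (j := 2) (by omega)).mono fun s₃ h3 => ?_
  have hs := h3.pend
  have h4 := (h3.setReg (x := 5) (by omega) (by omega) (s₃.reg 13)).setReg (x := 5) (by omega)
    (by omega) (s₃.reg 13 - 1)
  simp only [wp, State.setReg_reg, if_true]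
  refine (markProg_wp h4 (by omega)).mono fun s₄ ⟨h5, r5⟩ => ?_
  have d1 : s₄.arr 5 = d.nb1 := by rw [← h5.data]; rfl
  have h6 := h5.setReg (x := 6) (by omega) (by omega) (s₄.arr 5 (s₄.reg 5))
  refine (markProg_wp h6 (by omega)).mono fun s₅ ⟨h7, _⟩ => ?_
  simpa [r5, d1, hs, Pool.marks] using h7

/-- Fewer than fifteen marks cannot cover the first fifteen numbers, so constant time suffices
whatever `n` is. -/
theorem findProg_runs (h : Holds n E d A M s) (hA : A.length < 15) {r : ℕ} (hr : 13 < r) :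
    Runs (findProg r) s 96 fun s' => Holds n E d (A ++ [s'.reg r]) M s' ∧ s'.reg r < 15 ∧
      s'.reg r ∉ A ∧ ∀ x, 13 < x → x ≠ r → s'.reg x = s.reg x := by
  -- The loop does not stop at a success: register `r` ends up with the last unmarked candidate.
  let I : ℕ → State → Prop := fun k s' => s'.reg 5 = k ∧ s'.reg 8 = 15 ∧ s'.reg 9 = 0 ∧
    Holds n E d A M s' ∧ (s'.reg r < k ∧ s'.reg r ∉ A ∨ ∀ i < k, i ∈ A) ∧
    ∀ x, 13 < x → x ≠ r → s'.reg x = s.reg x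
  refine Runs.mono (Runs.seq (R := I 0) (T₁ := 3) (Runs.of_wp ?_) fun s₁ h₁ =>
    (Runs.for (T := 5) I (fun k s h => ⟨h.1, h.2.1⟩) (fun k s₂ hk h₂ => ?_) h₁).seq (T₂ := 2)
      fun s₃ h₃ => ?_) (by omega) fun _ h => h
  · refine ⟨by simp, by simp, by simp, ?_, .inr fun i hi => by omega, fun x hx _ => ?_⟩
    · exact ((h.setReg (by omega) (by omega) _).setReg (by omega) (by omega) _).setReg (by omega)
        (by omega) _
    · have : x ≠ 5 ∧ x ≠ 8 ∧ x ≠ 9 := by omega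
      simp [this]
  · obtain ⟨g5, g8, g9, gH, gr, gx⟩ := h₂
    have hr' : r ≠ 5 ∧ r ≠ 6 ∧ 5 ≠ r ∧ 6 ≠ r ∧ 8 ≠ r ∧ 9 ≠ r := by omega
    have hx' : ∀ x, 13 < x → x ≠ 5 ∧ x ≠ 6 := by omega
    have hm := gH.marks k
    refine (Runs.of_wp ?_).mono (by simp [cost]) fun _ => id
    simp only [wp, Test.Holds]
    refine ⟨fun a => ⟨?_, ?_, ?_, ?_, .inl ⟨?_, ?_⟩, fun x hx hxr => ?_⟩,
      fun a => ⟨?_, ?_, ?_, ?_, ?_, fun x hx hxr => ?_⟩⟩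
    · simp [g5, hr']
    · simp [g8, hr']
    · simp [g9, hr']
    · exact ((gH.setReg (by omega) (by omega) _).setReg (by omega) (by omega) _).setReg (by omega)
        (by omega) _
    · simp [g5, hr']
    · simp only [State.setReg_reg, g5, g9, hm] at a
      simp [g5, hr'] at a ⊢
      exact a
    · simp [hx' x hx, hxr, gx x hx hxr]
    · simp [g5]
    · simp [g8]
    · simp [g9]
    · exact (gH.setReg (by omega) (by omega) _).setReg (by omega) (by omega) _
    · simp only [State.setReg_reg, g5, g9, hm] at a
      simp at a
      rcases gr with gr | gr
      · left
        simp only [State.setReg_reg, hr', if_false]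
        exact ⟨by omega, gr.2⟩
      · right
        intro i hi
        rcases Nat.lt_succ_iff_lt_or_eq.mp hi with hi | rfl
        exacts [gr i hi, a]
    · simp [hx' x hx, gx x hx hxr]
  · obtain ⟨-, -, -, gH, gr, gx⟩ := h₃
    have gr' : s₃.reg r < 15 ∧ s₃.reg r ∉ A := by
      rcases gr with gr | gr
      · exact gr
      · exfalso
        have h1 : Finset.range 15 ⊆ A.toFinset := fun i hi =>
          List.mem_toFinset.mpr (gr i (Finset.mem_range.mp hi))
        have h2 := Finset.card_le_card h1
        have h3 := A.toFinset_card_le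
        rw [Finset.card_range] at h2
        omega
    refine Runs.of_wp ((markProg_wp gH (by omega)).mono fun s₄ ⟨h4, r4⟩ => ?_)
    rw [r4 r (by omega)]
    exact ⟨h4, gr'.1, gr'.2, fun x hx hxr => (r4 x (by omega)).trans (gx x hx hxr)⟩

theorem slotEdgeProg_wp {F : List (ℕ × ℕ)} {f : ℕ → ℕ} (h : Holds n E d A { M with out := F } s)
    (h9 : s.reg 9 = 0) (hf : ∀ j < 4, s.reg (14 + j) = f j) {j : ℕ} (hj : j < 3) :
    wp (slotEdgeProg j) (fun s' => Holds n E d A { M with out := F ++ M.slotEdge f j } s' ∧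
      s'.reg 9 = 0 ∧ ∀ j < 4, s'.reg (14 + j) = f j) s := by
  have hs : s.reg (10 + j) = M.c j := h.slot j hj
  refine ⟨fun h0 => ?_, fun h0 => ?_⟩
  · have h0 : M.c j = 0 := by rw [← hs, ← h9]; exact h0
    rw [Pool.slotEdge, if_pos h0, List.append_nil]
    exact ⟨h, h9, hf⟩
  · have h0 : M.c j ≠ 0 := by rw [← hs, ← h9]; exact h0
    rw [Pool.slotEdge, if_neg h0]
    have h1 := (h.setReg (x := 5) (by omega) (by omega) (s.reg (10 + j))).setReg (x := 5) (by omega)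
      (by omega) (s.reg (10 + j) - 1)
    simp only [wp, State.setReg_reg, if_true]
    refine (emitProg_wp h1 _ _).mono fun s₁ ⟨h2, r2⟩ => ⟨?_, ?_, fun k hk => ?_⟩
    · have e : (14 + j = 5) = False := by simp; omega
      simpa [hs, hf j (by omega), e] using h2
    · rw [r2 9 (by omega)]; simp [h9]
    · have e : (14 + k = 5) = False := by simp; omega
      rw [r2 _ (by omega)]; simp [e, hf k hk]

theorem partnerProg_wp {f : ℕ → ℕ} (h : Holds n E d A M s) (h9 : s.reg 9 = 0)
    (hf : ∀ j < 4, s.reg (14 + j) = f j) {j : ℕ} (hj : j < 3) :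
    wp (partnerProg j) (fun s' => Holds n E d A M s' ∧ s'.reg 7 = M.partner f j ∧
      ∀ y, y ≠ 7 → s'.reg y = s.reg y) s := by
  have hs : s.reg (10 + j) = M.c j := h.slot j hj
  refine ⟨fun h0 => ?_, fun h0 => ?_⟩
  · have h0 : M.c j = 0 := by rw [← hs, ← h9]; exact h0
    rw [Pool.partner, if_pos h0]
    exact ⟨h.setReg (by omega) (by omega) _, by simp [hf j (by omega)], fun y hy => by simp [hy]⟩
  · have h0 : M.c j ≠ 0 := by rw [← hs, ← h9]; exact h0
    rw [Pool.partner, if_neg h0]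
    exact ⟨(h.setReg (by omega) (by omega) _).setReg (by omega) (by omega) _, by simp [hs],
      fun y hy => by simp [hy]⟩

theorem lastProg_wp {f : ℕ → ℕ} (h : Holds n E d A M s) (hf : ∀ j < 4, s.reg (14 + j) = f j) :
    wp lastProg (Rep n E (M.out ++ M.last d f)) s := by
  have hp := h.pend
  have H := h.setReg (x := 9) (by omega) (by omega) 0
  have hf' : ∀ j < 4, (s.setReg 9 0).reg (14 + j) = f j := fun j hj => by
    have e : (14 + j = 9) = False := by simp; omega
    simp [e, hf j hj]
  refine ⟨fun h0 => ?_, fun h0 => ?_⟩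
  · have h0 : M.pend = 0 := by rw [← hp]; simpa [Test.Holds] using h0
    rw [Pool.last, if_pos h0, ← List.append_assoc, ← List.append_assoc]
    refine (slotEdgeProg_wp H (by simp) hf' (j := 0) (by omega)).mono fun s₁ ⟨h1, k1, f1⟩ => ?_
    refine (slotEdgeProg_wp h1 k1 f1 (j := 1) (by omega)).mono fun s₂ ⟨h2, k2, f2⟩ => ?_
    exact (slotEdgeProg_wp h2 k2 f2 (j := 2) (by omega)).mono fun s₃ h3 => h3.1.rep
  · have h0 : M.pend ≠ 0 := by rw [← hp]; simpa [Test.Holds] using h0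
    rw [Pool.last, if_neg h0]
    have hd : s.arr 5 = d.nb1 := by rw [← h.data]; rfl
    have h1 := ((H.setReg (x := 5) (by omega) (by omega) (s.reg 13)).setReg (x := 5) (by omega)
      (by omega) (s.reg 13 - 1)).setReg (x := 6) (by omega) (by omega) (s.arr 5 (s.reg 13 - 1))
    simp only [wp, State.setReg_reg, State.setReg_arr, if_true, Nat.reduceEqDiff, if_false]
    generalize hs' : State.setReg _ 6 _ = s' at h1
    have k1 : s'.reg 5 = M.pend - 1 ∧ s'.reg 6 = d.nb1 (M.pend - 1) ∧ s'.reg 9 = 0 := by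
      subst hs'; simp [hp, hd]
    have f1 : ∀ j < 4, s'.reg (14 + j) = f j := fun j hj => by
      have e : (14 + j = 9) = False ∧ (14 + j = 5) = False ∧ (14 + j = 6) = False := by
        simp; omega
      subst hs'; simp [e, hf j hj]
    clear hs' H hf'
    refine (partnerProg_wp h1 k1.2.2 f1 (j := 0) (by omega)).mono fun s₁ ⟨h2, k2, r2⟩ => ?_
    refine (emitProg_wp h2 _ _).mono fun s₂ ⟨h3, r3⟩ => ?_
    have R3 : ∀ y, 3 ≤ y → y ≠ 7 → s₂.reg y = s'.reg y := fun y hy hy' => by rw [r3 y hy, r2 y hy']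
    refine (partnerProg_wp h3 ((R3 9 (by omega) (by omega)).trans k1.2.2) (fun j hj =>
      (R3 _ (by omega) (by omega)).trans (f1 j hj)) (j := 1) (by omega)).mono
        fun s₃ ⟨h4, k4, r4⟩ => ?_
    refine (emitProg_wp h4 _ _).mono fun s₄ ⟨h5, r5⟩ => ?_
    have R5 : ∀ y, 3 ≤ y → y ≠ 7 → s₄.reg y = s'.reg y := fun y hy hy' => by
      rw [r5 y hy, r4 y hy', R3 y hy hy']
    refine (partnerProg_wp h5 ((R5 9 (by omega) (by omega)).trans k1.2.2) (fun j hj =>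
      (R5 _ (by omega) (by omega)).trans (f1 j hj)) (j := 2) (by omega)).mono
        fun s₅ ⟨h6, k6, r6⟩ => ?_
    refine (emitProg_wp h6 _ _).mono fun s₆ ⟨h7, r7⟩ => ?_
    refine (emitProg_wp h7 _ _).mono fun s₇ ⟨h8, _⟩ => ?_
    have := h8.rep
    have e6 : s₆.reg 6 = d.nb1 (M.pend - 1) := by
      rw [r7 6 (by omega), r6 6 (by omega), R5 6 (by omega) (by omega), k1.2.1]
    have e17 : s₆.reg 17 = f 3 := by
      rw [r7 17 (by omega), r6 17 (by omega), R5 17 (by omega) (by omega)]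
      exact f1 3 (by omega)
    have e6' : s₅.reg 6 = d.nb1 (M.pend - 1) := by
      rw [r6 6 (by omega), R5 6 (by omega) (by omega), k1.2.1]
    have e5' : s₃.reg 5 = M.pend - 1 := by
      rw [r4 5 (by omega), R3 5 (by omega) (by omega), k1.1]
    have e5 : s₁.reg 5 = M.pend - 1 := by rw [r2 5 (by omega), k1.1]
    simpa [e6, e17, e6', e5', e5, k2, k4, k6, Pool.partner] using this

/-- There are eleven marks, and each vertex found is marked in turn. So the four are distinct, and
even the last search meets only fourteen marks. -/
theorem finishProg_runs (h : Holds n E d [] M s) :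
    Runs finishProg s 500 fun s' => ∃ f : ℕ → ℕ, (∀ j < 4, f j < 15 ∧ f j ∉ M.marks d) ∧
      (∀ j < 4, ∀ k < 4, f j = f k → j = k) ∧ Rep n E (M.out ++ M.last d f) s' := by
  refine Runs.mono ((Runs.of_wp (marksProg_wp h)).seq fun s₀ h0 =>
    (findProg_runs h0 (by simp [Pool.marks]) (r := 14) (by omega)).seq fun s₁ ⟨h1, l1, m1, _⟩ =>
    (findProg_runs h1 (by simp [Pool.marks]) (r := 15) (by omega)).seq fun s₂ ⟨h2, l2, m2, r2⟩ =>
    (findProg_runs h2 (by simp [Pool.marks]) (r := 16) (by omega)).seq fun s₃ ⟨h3, l3, m3, r3⟩ =>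
    (findProg_runs h3 (by simp [Pool.marks]) (r := 17) (by omega)).seq
      (T₂ := cost lastProg) fun s₄ ⟨h4, l4, m4, r4⟩ => ?_) (by decide) fun _ h => h
  have e1 : s₄.reg 14 = s₁.reg 14 := by
    rw [r4 14 (by omega) (by omega), r3 14 (by omega) (by omega), r2 14 (by omega) (by omega)]
  have e2 : s₄.reg 15 = s₂.reg 15 := by
    rw [r4 15 (by omega) (by omega), r3 15 (by omega) (by omega)]
  have e3 : s₄.reg 16 = s₃.reg 16 := r4 16 (by omega) (by omega)
  simp only [List.mem_append, List.mem_singleton, not_or, ← e1, ← e2, ← e3] at m1 m2 m3 m4 l1 l2 l3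
  refine (Runs.of_wp (lastProg_wp h4 (f := fun j => s₄.reg (14 + j)) fun _ _ => rfl)).mono le_rfl
    fun s' h' => ⟨_, fun j hj => ?_, fun j hj k hk hjk => ?_, h'⟩
  · interval_cases j
    exacts [⟨l1, m1⟩, ⟨l2, m2.1⟩, ⟨l3, m3.1.1⟩, ⟨l4, m4.1.1.1⟩]
  · interval_cases j <;> interval_cases k <;> simp at hjk ⊢ <;> omega

end

end GraphAnon

namespace GraphAnon

/-! ### Optimal lists -/

theorem exists_unord_eq (l : List (Sym2 ℕ)) : ∃ H, unord H = l := by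
  induction l with
  | nil => exact ⟨[], rfl⟩
  | cons e l ih =>
    obtain ⟨H, rfl⟩ := ih
    induction e with
    | h x y => exact ⟨(x, y) :: H, rfl⟩

theorem unord_length (H : List (ℕ × ℕ)) : (unord H).length = H.length := List.length_map _

/-- Loops and pairs of `E` can be left out. -/
theorem Strong.of_imp {n : ℕ} {E H H' : List (ℕ × ℕ)} (hS : Strong n E H)
    (h : ∀ x y, x ≠ y → LAdj H x y → LAdj E x y ∨ LAdj H' x y) : Strong n E H' := by
  have hr : ∀ v u, Reach E H v u → Reach E H' v u := fun v u ⟨w, h1, h2, h3⟩ =>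
    ⟨w, h1, h2, h3.elim .inl (h w u h2)⟩
  intro v hv
  obtain ⟨u, u', h1, h2, h3, h4, h5⟩ := hS v hv
  exact ⟨u, u', h1, h2, h3, hr _ _ h4, hr _ _ h5⟩

theorem length_le_sq {n : ℕ} {H : List (ℕ × ℕ)} (hb : Below n H) (hn : (unord H).Nodup) :
    H.length ≤ n * n := by
  have h1 : H.toFinset ⊆ Finset.range n ×ˢ Finset.range n := fun e he => by
    simpa using hb e (List.mem_toFinset.mp he)
  have h2 := Finset.card_le_card h1
  rwa [List.toFinset_card_of_nodup (List.Nodup.of_map _ hn), Finset.card_product,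
    Finset.card_range] at h2

/-- `H` is, up to `err`, a shortest list of pairs that yields a strong transformation. -/
structure Optimal (n : ℕ) (E : List (ℕ × ℕ)) (err : ℕ) (H : List (ℕ × ℕ)) : Prop where
  below : Below n H
  strong : Strong n E H
  nonEdges : NonEdges E H
  nodup : (unord H).Nodup
  le : ∀ H', Below n H' → Strong n E H' → H.length ≤ H'.length + err

/-- Leaving out loops, old edges and repetitions keeps the list valid, so by minimality there are
none. That is why the search need not exclude them. -/
theorem Optimal.of_minimal {n : ℕ} {E H : List (ℕ × ℕ)} (hb : Below n H) (hS : Strong n E H)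
    (hle : ∀ H', Below n H' → Strong n E H' → H.length ≤ H'.length) : Optimal n E 0 H := by
  classical
  set F := (unord H).toFinset.filter fun e => ¬ e.IsDiag ∧ e ∉ unord E with hF
  obtain ⟨H', hH'⟩ := exists_unord_eq F.toList
  have hadj : ∀ x y, LAdj H' x y ↔ LAdj H x y ∧ x ≠ y ∧ ¬ LAdj E x y := by
    intro x y
    rw [← mem_unord, hH', Finset.mem_toList, hF, Finset.mem_filter, List.mem_toFinset, mem_unord,
      mem_unord, Sym2.mk_isDiag_iff]
  have h1 : H.length ≤ F.card := by
    rw [← F.length_toList, ← hH', unord_length]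
    refine hle _ (fun e he => ((hadj e.1 e.2).mp (.inl he)).1.lt hb) (hS.of_imp fun x y hxy h => ?_)
    by_cases hE : LAdj E x y
    exacts [.inl hE, .inr ((hadj x y).mpr ⟨h, hxy, hE⟩)]
  have h2 : F.card ≤ (unord H).toFinset.card := Finset.card_filter_le _ _
  have h3 := (unord H).toFinset_card_le
  rw [unord_length] at h3
  have h4 : (unord H).toFinset.card = (unord H).length := by rw [unord_length]; omega
  refine ⟨hb, hS, fun x y hxy => ?_, ?_, hle⟩
  · have h5 : F = (unord H).toFinset :=
      Finset.eq_of_subset_of_card_le (Finset.filter_subset _ _) (by omega)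
    have h6 : s(x, y) ∈ F := h5 ▸ List.mem_toFinset.mpr (mem_unord.mpr hxy)
    rw [hF, Finset.mem_filter, mem_unord, Sym2.mk_isDiag_iff] at h6
    exact h6.2
  · exact Multiset.toFinset_card_eq_card_iff_nodup.mp h4

theorem Optimal.exists {n : ℕ} {E : List (ℕ × ℕ)} (h : ∃ H, Below n H ∧ Strong n E H) :
    ∃ H, Optimal n E 0 H := by
  classical
  have h' : ∃ k, ∃ H, H.length = k ∧ Below n H ∧ Strong n E H := by
    obtain ⟨H, h⟩ := h; exact ⟨_, H, rfl, h⟩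
  obtain ⟨H, h1, h2, h3⟩ := Nat.find_spec h'
  refine ⟨H, .of_minimal h2 h3 fun H' h4 h5 => ?_⟩
  rw [h1]
  exact Nat.find_min' h' ⟨H', rfl, h4, h5⟩

/-- A short list of fresh vertices exists. -/
theorem exists_fresh {n : ℕ} (hn : 15 ≤ n) {A : List ℕ} (hA : A.length ≤ 11) :
    ∃ f : ℕ → ℕ, (∀ j < 4, f j < n ∧ f j ∉ A) ∧ ∀ j < 4, ∀ k < 4, f j = f k → j = k := by
  set l := (Finset.range n \ A.toFinset).toList with hl
  have h1 : 4 ≤ l.length := by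
    rw [hl, Finset.length_toList]
    have h1 := Finset.le_card_sdiff A.toFinset (Finset.range n)
    have h2 := A.toFinset_card_le
    rw [Finset.card_range] at h1
    omega
  refine ⟨fun j => l.getD j 0, fun j hj => ?_, fun j hj k hk h => ?_⟩
  · have h2 : l.getD j 0 ∈ l := by
      rw [List.getD_eq_getElem _ _ (by omega)]; exact List.getElem_mem _
    rw [hl, Finset.mem_toList, Finset.mem_sdiff, Finset.mem_range, List.mem_toFinset] at h2
    exact h2
  · simp only at h
    rw [List.getD_eq_getElem _ _ (by omega), List.getD_eq_getElem _ _ (by omega)] at h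
    exact (Finset.nodup_toList _).getElem_inj_iff.mp h

theorem Data.dem_le (d : Data) (v : ℕ) : d.dem v ≤ 4 := by
  unfold Data.dem; split_ifs <;> omega

section
variable {n : ℕ} {E : List (ℕ × ℕ)} {d : Data} {M : Pool}

theorem PoolInv.length_le (h : PoolInv n E d n M) : M.out.length ≤ 2 * n := by
  have h1 := h.count
  have h2 : ∑ v ∈ Finset.range n, d.dem v ≤ ∑ _v ∈ Finset.range n, 4 :=
    Finset.sum_le_sum fun v _ => d.dem_le v
  rw [Finset.sum_const, Finset.card_range, smul_eq_mul] at h2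
  omega

/-- After the last eleven pairs have been removed, few pairs suffice for an optimal list. -/
theorem PoolInv.exists_optimal (hp : Prep n E d) (h : PoolInv n E d n M)
    (hex : ∃ H, Below n H ∧ Strong n E H) :
    ∃ Y, Y.length ≤ 225 ∧ Below n Y ∧ Strong n E (M.out.take (M.out.length - 11) ++ Y) ∧
      ∀ H', Below n H' → Strong n E H' →
        (M.out.take (M.out.length - 11) ++ Y).length ≤ H'.length := by
  obtain ⟨H, hH⟩ := Optimal.exists hex
  have hsq := length_le_sq hH.below hH.nodup
  have hc := h.count
  by_cases hl : 11 ≤ M.out.length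
  · have hn : 4 ≤ n := by
      -- With at most three vertices `H` has at most nine pairs, so the demand is at most 18, while
      -- eleven greedy edges already account for 22.
      by_contra hn
      have h1 := hp.sum_dem_le hH.strong
      have : n * n ≤ 3 * 3 := Nat.mul_le_mul (by omega) (by omega)
      omega
    obtain ⟨Y, h1, h2, h3, h4⟩ := h.exists_completion hp hn (J := 11) (by omega) hl
    refine ⟨Y, by omega, h1, h2, fun H' _ hS => ?_⟩
    -- Twice the length found is at most the demand plus one, and twice any valid length is at least
    -- the demand; for integers the gap of one disappears.
    have h5 := hp.sum_dem_le hS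
    rw [List.length_append, List.length_take]
    omega
  · rw [show M.out.length - 11 = 0 by omega, List.take_zero]
    refine ⟨H, ?_, hH.below, hH.strong, hH.le⟩
    -- A tiny graph has at most `15 * 15 = 225` pairs. For a larger one, at most ten greedy edges
    -- and what is waiting make up the demand, so `PoolInv.last_spec` bounds the optimum by a small
    -- constant.
    by_cases hn : n < 15
    · have : n * n ≤ 15 * 15 := Nat.mul_le_mul (by omega) (by omega)
      omega
    · obtain ⟨f, hf, hinj⟩ := exists_fresh (n := n) (by omega) (A := M.marks d)
        (by simp [Pool.marks])
      obtain ⟨-, -, h1, h2, h3⟩ := h.last_spec hp hf hinj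
      have h4 := hH.le _ h1 h2
      have h5 : ∑ j ∈ Finset.range 3, (if M.c j = 0 then 0 else 1) ≤ 3 := by
        simp only [Finset.sum_range_succ, Finset.sum_range_zero]
        split_ifs <;> omega
      split_ifs at hc <;> omega

end

/-! ### The two algorithms on lists -/

/-- The memory holds a graph with the edges `E` in the initial state of the machine. -/
structure Input (n : ℕ) (E : List (ℕ × ℕ)) (s : State) : Prop where
  rep : Rep n E [] s
  data : s.data = Data.zero
  marks : ∀ x, s.arr 10 x = 0
  below : Below n E
  irrefl : ∀ v, ¬ LAdj E v v
  nodup : (unord E).Nodup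

/-- Make register 2 smaller by `k`. -/
def dropProg : ℕ → Prog
  | 0 => .nop
  | k + 1 => .decr 2 ;; dropProg k

theorem dropProg_runs {n : ℕ} {E H : List (ℕ × ℕ)} {s : State} (h : Rep n E H s) (k : ℕ) :
    Runs (dropProg k) s (k + 1) (Rep n E (H.take (H.length - k))) := by
  induction k generalizing s H with
  | zero => exact Runs.mono (Runs.of_wp (p := .nop) (Q := Rep n E H) h) le_rfl (by simp)
  | succ k ih =>
    have h1 : Rep n E (H.take (H.length - 1)) (s.setReg 2 (s.reg 2 - 1)) := by
      refine ⟨by simpa using h.reg_zero, by simpa using h.reg_one, ?_, h.edges, h.output.take _⟩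
      simp [h.reg_two]
    refine Runs.mono (Runs.seq (Runs.of_wp (p := .decr 2) (Q := Rep n E (H.take (H.length - 1))) h1)
      fun s' h' => ih h') (by simp only [cost]; omega) fun s' h' => ?_
    rw [List.take_take, List.length_take] at h'
    convert h' using 2
    omega

section
variable {n : ℕ} {E : List (ℕ × ℕ)} {s : State}

theorem Input.prep (h : Input n E s) (hex : ∃ H, Below n H ∧ Strong n E H) :
    Prep n E (Data.compute E) := by
  obtain ⟨H, -, hS⟩ := hex
  refine prep_compute h.nodup h.irrefl h.below fun v hv => ?_
  obtain ⟨u, u', -, -, -, ⟨w, hw, -⟩, -⟩ := hS v hv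
  exact ⟨w, hw⟩

theorem pool_runs (h : Input n E s) :
    Runs (computeProg ;; poolProg) s (E.length * 52 + n * 40 + 14)
      (Holds n E (Data.compute E) [] (Pool.upTo (Data.compute E) n)) :=
  Runs.mono (Runs.seq (computeProg_runs h.rep h.data) fun s₁ h₁ =>
    poolProg_runs h₁.2.1 h₁.1 fun x => by rw [h₁.2.2, h.marks]) (by omega) fun _ h => h

/-- The linear-time algorithm. -/
def linearProg : Prog :=
  .const 3 15 ;; .ite (.lt 0 3) (searchUpTo 225) ((computeProg ;; poolProg) ;; finishProg)

/-- Fifteen vertices are enough for four fresh ones besides the eleven marks. Below that, complete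
search takes constant time, as no list of distinct pairs has more than 225 entries. -/
theorem linearProg_runs : ∃ c, ∀ (n : ℕ) (E : List (ℕ × ℕ)) (s : State), Input n E s →
    (∃ H, Below n H ∧ Strong n E H) →
    Runs linearProg s (c * (n + E.length + 1)) fun s' => ∃ H, Rep n E H s' ∧ Optimal n E 2 H := by
  -- Only the independence of the graph matters; the huge value itself is kept opaque.
  obtain ⟨C, hC⟩ : ∃ C, C = (225 + 1) * (searchTime 225 225 + 2) := ⟨_, rfl⟩
  refine ⟨C + 600, fun n E s h hex => ?_⟩
  refine Runs.mono (T := 1 + (C + (E.length * 52 + n * 40 + 14 + 500) + 1)) (Runs.seq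
    (R := fun s' => s'.reg 3 = 15 ∧ Input n E s') (Runs.of_wp (p := .const 3 15) ⟨by simp,
      h.rep.setReg (by omega) _, h.data, h.marks, h.below, h.irrefl, h.nodup⟩)
    fun s₁ h₁ => Runs.ite (fun hb => ?_) fun hb => ?_) ?_ fun _ h => h
  · obtain ⟨h3, h₁⟩ := h₁
    have hn : n < 15 := by rw [← h₁.rep.reg_zero, ← h3]; exact hb
    have h15 : n * n ≤ 15 * 15 := Nat.mul_le_mul (by omega) (by omega)
    have hm := length_le_sq h₁.below h₁.nodup
    refine Runs.mono (searchUpTo_runs h₁.below 225 (X := 225) h₁.rep (fun e he => by simp at he)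
      (by omega) (by omega) (by simp) (by omega)) (by omega) fun s₂ h₂ => ?_
    rcases h₂ with ⟨-, L, h4, h5, h6, h7⟩ | ⟨-, -, h4⟩
    · have ho := Optimal.of_minimal h4 h5 h7
      exact ⟨L, h6, ho.below, ho.strong, ho.nonEdges, ho.nodup, fun H' hb' hS' =>
        (ho.le H' hb' hS').trans (by omega)⟩
    · obtain ⟨H, hH⟩ := Optimal.exists hex
      have := length_le_sq hH.below hH.nodup
      exact (h4 H (by omega) hH.below hH.strong).elim
  · obtain ⟨h3, h₁⟩ := h₁
    have hn : 15 ≤ n := by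
      rw [← h₁.rep.reg_zero, ← h3]; exact not_lt.mp hb
    have hp := h₁.prep hex
    have hM := PoolInv.upTo hp n le_rfl
    refine Runs.mono (Runs.seq (pool_runs h₁) fun s₂ h₂ => finishProg_runs h₂) (by omega)
      fun s₃ ⟨f, hf, hinj, h₃⟩ => ?_
    obtain ⟨h4, h5, h6, h7, h8⟩ := hM.last_spec hp (fun j hj => ⟨by have := hf j hj; omega,
      (hf j hj).2⟩) hinj
    refine ⟨_, h₃, h6, h7, h4, h5, fun H' _ hS' => ?_⟩
    have := hp.sum_dem_le hS'
    omega
  · nlinarith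

/-- The exact algorithm. -/
def exactProg : Prog := (computeProg ;; poolProg) ;; dropProg 11 ;; searchUpTo 225

/-- The depth 225 of the search is fixed, so its time is polynomial, though of enormous degree. By
`PoolInv.exists_optimal` this depth is sufficient once the last eleven greedy edges have been
dropped. -/
theorem exactProg_runs : ∃ c e, ∀ (n : ℕ) (E : List (ℕ × ℕ)) (s : State), Input n E s →
    (∃ H, Below n H ∧ Strong n E H) →
    Runs exactProg s (c * (n + E.length + 1) ^ e) fun s' =>
      ∃ H, Rep n E H s' ∧ Optimal n E 0 H := by
  obtain ⟨c, e, hT⟩ := searchTime_le 225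
  refine ⟨500 + 600 + 226 * (c * 300 ^ e), e + 1, fun n E s h hex => ?_⟩
  have hp := h.prep hex
  have hM := PoolInv.upTo hp n le_rfl
  have hl := hM.length_le
  have hbelow := hM.below hp le_rfl
  obtain ⟨Y, hY1, hY2, hY3, hY4⟩ := hM.exists_optimal hp hex
  have hpool := pool_runs h
  generalize Pool.upTo (Data.compute E) n = M at *
  set B := M.out.take (M.out.length - 11) with hB
  have hBl : B.length ≤ 2 * n := by rw [hB, List.length_take]; omega
  have hBb : Below n B := fun e he => hbelow e (List.mem_of_mem_take he)
  have hdrop : ∀ s', Holds n E (Data.compute E) [] M s' → Runs (dropProg 11) s' 12 (Rep n E B) :=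
    fun s' h' => dropProg_runs h'.rep 11
  -- The bound `X` must exceed the length of the output throughout the search: at most `2 * n` kept
  -- pairs and up to 225 additional ones.
  refine Runs.mono (Runs.seq hpool fun s₁ h₁ => Runs.seq (hdrop s₁ h₁)
    fun s₂ h₂ => searchUpTo_runs h.below 225 (X := 2 * n + E.length + 226) h₂ hBb (by omega)
      (by omega) (by omega) (by omega)) ?_ fun s₃ h₃ => ?_
  · have h1 := hT (2 * n + E.length + 226)
    -- The factor 300 absorbs the additive constant 227.
    have h2 : (2 * n + E.length + 226 + 1) ^ e ≤ 300 ^ e * (n + E.length + 1) ^ e := by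
      rw [← mul_pow]
      exact Nat.pow_le_pow_left (by omega) e
    have h3 : 1 ≤ (n + E.length + 1) ^ e := Nat.one_le_pow _ _ (by omega)
    rw [pow_succ]
    set S := (n + E.length + 1) ^ e
    have h4 : searchTime 225 (2 * n + E.length + 226) ≤ c * 300 ^ e * S :=
      h1.trans (by rw [mul_assoc]; exact Nat.mul_le_mul_left c h2)
    generalize c * 300 ^ e = C at h4 ⊢
    generalize searchTime 225 (2 * n + E.length + 226) = T at h4 ⊢
    have h5 : C * S ≤ C * S * (n + E.length + 1) := Nat.le_mul_of_pos_right _ (by omega)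
    have h6 : n + E.length + 1 ≤ S * (n + E.length + 1) := Nat.le_mul_of_pos_left _ h3
    have h7 : (500 + 600 + 226 * C) * (S * (n + E.length + 1)) =
        1100 * (S * (n + E.length + 1)) + 226 * (C * S * (n + E.length + 1)) := by ring
    rw [h7]
    omega
  · rcases h₃ with ⟨-, L, h4, h5, h6, h7⟩ | ⟨-, -, h4⟩
    -- The search is optimal only among extensions of `B`, but `B ++ Y` is one of these and is
    -- shortest among all valid lists.
    · refine ⟨_, h6, .of_minimal (hBb.append h4) h5 fun H' hb hS => le_trans ?_ (hY4 H' hb hS)⟩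
      rw [List.length_append, List.length_append]
      have := h7 Y hY2 hY3
      omega
    · exact (h4 Y hY1 hY2 hY3).elim

end

end GraphAnon

namespace GraphAnon

/-! ### Graphs and lists -/

/-- The list of pairs of natural numbers. -/
def toNat {n : ℕ} (L : List (Fin n × Fin n)) : List (ℕ × ℕ) := L.map fun e => (e.1.val, e.2.val)

section
variable {n : ℕ}

theorem lAdj_toNat {L : List (Fin n × Fin n)} {x y : Fin n} :
    LAdj (toNat L) x y ↔ s(x, y) ∈ L.map fun e => s(e.1, e.2) := by
  simp only [LAdj, toNat, List.mem_map, Prod.mk.injEq, Sym2.eq_iff, Prod.exists, Fin.val_inj]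
  constructor
  · rintro (⟨a, b, h, rfl, rfl⟩ | ⟨a, b, h, rfl, rfl⟩)
    exacts [⟨_, _, h, .inl ⟨rfl, rfl⟩⟩, ⟨_, _, h, .inr ⟨rfl, rfl⟩⟩]
  · rintro ⟨a, b, h, ⟨rfl, rfl⟩ | ⟨rfl, rfl⟩⟩
    exacts [.inl ⟨_, _, h, rfl, rfl⟩, .inr ⟨_, _, h, rfl, rfl⟩]

theorem below_toNat (L : List (Fin n × Fin n)) : Below n (toNat L) := by
  intro e he
  obtain ⟨f, -, rfl⟩ := List.mem_map.mp he
  exact ⟨f.1.2, f.2.2⟩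

theorem unord_toNat (L : List (Fin n × Fin n)) :
    unord (toNat L) = (L.map fun e => s(e.1, e.2)).map (Sym2.map Fin.val) := by
  simp [unord, toNat, Function.comp_def]

theorem nodup_unord_toNat {L : List (Fin n × Fin n)} :
    (unord (toNat L)).Nodup ↔ (L.map fun e => s(e.1, e.2)).Nodup := by
  rw [unord_toNat, List.nodup_map_iff (Sym2.map.injective Fin.val_injective)]

theorem exists_toNat {H : List (ℕ × ℕ)} (hb : Below n H) :
    ∃ L : List (Fin n × Fin n), toNat L = H := by
  induction H with
  | nil => exact ⟨[], rfl⟩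
  | cons e H ih =>
    obtain ⟨L, rfl⟩ := ih fun f hf => hb f (List.mem_cons_of_mem _ hf)
    have he := hb e List.mem_cons_self
    exact ⟨(⟨e.1, he.1⟩, ⟨e.2, he.2⟩) :: L, rfl⟩

theorem exists_isEdgeList (S : Set (Sym2 (Fin n))) : ∃ L, IsEdgeList L S := by
  classical
  refine ⟨S.toFinset.toList.map Quot.out, ?_, fun e => ?_⟩
  all_goals
    rw [List.map_map, show (fun e : Fin n × Fin n => s(e.1, e.2)) ∘ Quot.out = id from
      funext fun e => Quot.out_eq e, List.map_id]
  · exact Finset.nodup_toList _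
  · simp

theorem IsEdgeList.ncard {L : List (Fin n × Fin n)} {S : Set (Sym2 (Fin n))}
    (h : IsEdgeList L S) : S.ncard = L.length := by
  classical
  have h1 : S = ((L.map fun e => s(e.1, e.2)).toFinset : Set (Sym2 (Fin n))) := by
    ext e; simp only [List.coe_toFinset, Set.mem_ofPred_eq, h.2]
  rw [h1, Set.ncard_coe_finset, List.toFinset_card_of_nodup h.1, List.length_map]

theorem IsEdgeList.adj_iff {L : List (Fin n × Fin n)} {G : SimpleGraph (Fin n)}
    (h : IsEdgeList L G.edgeSet) {x y : Fin n} : LAdj (toNat L) x y ↔ G.Adj x y := by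
  rw [lAdj_toNat, h.2, SimpleGraph.mem_edgeSet]

theorem exists_two_iff {P : Fin n → Prop} {v : Fin n} :
    (∃ U : Finset (Fin n), v ∉ U ∧ 2 ≤ U.card ∧ ∀ u ∈ U, P u) ↔
      ∃ u u', u ≠ u' ∧ u ≠ v ∧ u' ≠ v ∧ P u ∧ P u' := by
  constructor
  · rintro ⟨U, hv, hc, h⟩
    obtain ⟨u, hu, u', hu', hne⟩ := Finset.one_lt_card.mp hc
    exact ⟨u, u', hne, fun e => hv (e ▸ hu), fun e => hv (e ▸ hu'), h u hu, h u' hu'⟩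
  · rintro ⟨u, u', hne, h1, h2, h3, h4⟩
    refine ⟨{u, u'}, by simp [h1.symm, h2.symm], by rw [Finset.card_pair hne], fun w hw => ?_⟩
    rcases Finset.mem_insert.mp hw with rfl | hw
    · exact h3
    · rw [Finset.mem_singleton.mp hw]; exact h4

theorem one_le_encard_iff {S : Set (Fin n)} : ((1 : ℕ) : ℕ∞) ≤ S.encard ↔ S.Nonempty := by
  rw [Nat.cast_one, Set.one_le_encard_iff_nonempty]

/-- Strong transformations in terms of lists. -/
theorem strong_iff {G G' : SimpleGraph (Fin n)} {L : List (Fin n × Fin n)} {H : List (ℕ × ℕ)}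
    (hL : IsEdgeList L G.edgeSet) (hb : Below n H)
    (hH : ∀ x y : Fin n, G'.Adj x y ↔ G.Adj x y ∨ x ≠ y ∧ LAdj H x y) :
    Strong n (toNat L) H ↔ IsStrongTransformation 2 1 G G' := by
  have hle : G ≤ G' := fun x y h => (hH x y).mpr (.inl h)
  have key : ∀ v u : Fin n, Reach (toNat L) H v u ↔
      (G.neighborSet v ∩ G'.neighborSet u).Nonempty := by
    intro v u
    constructor
    · rintro ⟨w, h1, h2, h3⟩
      lift w to Fin n using (h1.lt (below_toNat L)).2
      rw [hL.adj_iff] at h1 h3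
      refine ⟨w, h1, ((hH w u).mpr ?_).symm⟩
      exact h3.imp id fun h => ⟨fun e => h2 (congrArg _ e), h⟩
    · rintro ⟨w, h1, h2⟩
      refine ⟨w, hL.adj_iff.mpr h1, fun e => h2.ne (Fin.ext e.symm), ?_⟩
      rw [hL.adj_iff]
      exact ((hH w u).mp h2.symm).imp id And.right
  have key' : (∀ v : Fin n, ∃ U : Finset (Fin n), v ∉ U ∧ 2 ≤ U.card ∧
      ∀ u ∈ U, ((1 : ℕ) : ℕ∞) ≤ (G.neighborSet v ∩ G'.neighborSet u).encard) ↔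
      Strong n (toNat L) H := by
    simp only [one_le_encard_iff, exists_two_iff, ← key]
    constructor
    · intro h v hv
      obtain ⟨u, u', h1, h2, h3, h4⟩ := h ⟨v, hv⟩
      exact ⟨u, u', Fin.val_ne_of_ne h1, fun e => h2 (Fin.ext e), fun e => h3 (Fin.ext e), h4⟩
    · intro h v
      obtain ⟨u, u', h1, h2, h3, h4, h5⟩ := h v v.2
      have hlt : ∀ {u}, Reach (toNat L) H v u → u < n := by
        rintro u ⟨w, -, -, h | h⟩
        exacts [(h.lt (below_toNat L)).2, (h.lt hb).2]
      lift u to Fin n using hlt h4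
      lift u' to Fin n using hlt h5
      exact ⟨u, u', fun e => h1 (congrArg _ e), fun e => h2 (congrArg _ e),
        fun e => h3 (congrArg _ e), h4, h5⟩
  -- Old neighbours are new neighbours, so the witnesses of the strong condition also prove
  -- anonymity.
  refine ⟨fun h => ⟨hle, fun v => ?_, key'.mpr h⟩, fun h => key'.mp h.strong⟩
  obtain ⟨U, h1, h2, h3⟩ := key'.mpr h v
  exact ⟨U, h1, h2, fun u hu => (h3 u hu).trans (Set.encard_le_encard
    (Set.inter_subset_inter_left _ fun w hw => hle hw))⟩

theorem exists_list_of_transformation {G G' : SimpleGraph (Fin n)} {L : List (Fin n × Fin n)}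
    (hL : IsEdgeList L G.edgeSet) (h : IsStrongTransformation 2 1 G G') :
    ∃ H, Below n H ∧ Strong n (toNat L) H ∧ H.length = addedEdges G G' := by
  obtain ⟨F, hF⟩ := exists_isEdgeList (G'.edgeSet \ G.edgeSet)
  refine ⟨toNat F, below_toNat F, (strong_iff hL (below_toNat F) fun x y => ?_).mpr h, ?_⟩
  · rw [lAdj_toNat, hF.2, Set.mem_sdiff, SimpleGraph.mem_edgeSet, SimpleGraph.mem_edgeSet]
    constructor
    · intro hxy
      by_cases hG : G.Adj x y
      exacts [.inl hG, .inr ⟨hxy.ne, hxy, hG⟩]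
    · rintro (hxy | ⟨-, hxy, -⟩)
      exacts [h.le hxy, hxy]
  · rw [addedEdges, hF.ncard, toNat, List.length_map]

theorem input_inputState {G : SimpleGraph (Fin n)} {L : List (Fin n × Fin n)}
    (hL : IsEdgeList L G.edgeSet) : Input n (toNat L) (inputState L) := by
  refine ⟨⟨rfl, by simp [inputState, toNat], rfl, fun i e he => ?_, fun i e he => by simp at he⟩,
    rfl, fun x => rfl, below_toNat L, fun v hv => ?_, nodup_unord_toNat.mpr hL.1⟩
  · rw [toNat, List.getElem?_map, Option.map_eq_some_iff] at he
    obtain ⟨f, hf, rfl⟩ := he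
    simp [inputState, hf]
  · lift v to Fin n using (hv.lt (below_toNat L)).1
    exact (hL.adj_iff.mp hv).ne rfl

/-- An optimal list contains no loops, old edges or repetitions, so its length is exactly the number
of added edges. Every competing graph yields a list of its added edges, so comparison with all lists
covers all graphs. -/
theorem solves_of_runs {P : Prog} {err : ℕ} {T : ℕ → ℕ → ℕ}
    (h : ∀ (n : ℕ) (E : List (ℕ × ℕ)) (s : State), Input n E s →
      (∃ H, Below n H ∧ Strong n E H) →
      Runs P s (T n E.length) fun s' => ∃ H, Rep n E H s' ∧ Optimal n E err H) :
    SolvesStrongAnonymization P 2 1 err T := by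
  intro n G L hL ⟨G₀, hG₀⟩
  obtain ⟨H₀, hb₀, hS₀, -⟩ := exists_list_of_transformation hL hG₀
  obtain ⟨t, s, he, ht, H, hR, hO⟩ := h n (toNat L) (inputState L) (input_inputState hL)
    ⟨H₀, hb₀, hS₀⟩
  obtain ⟨L', rfl⟩ := exists_toNat hO.below
  set G' : SimpleGraph (Fin n) :=
    { Adj := fun x y => G.Adj x y ∨ LAdj (toNat L') x y
      symm := ⟨fun x y hxy => hxy.imp SimpleGraph.Adj.symm LAdj.symm⟩
      loopless := ⟨fun x hx => hx.elim (fun h => h.ne rfl) fun h => (hO.nonEdges _ _ h).1 rfl⟩ }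
    with hG'
  have hS : IsStrongTransformation 2 1 G G' := (strong_iff hL hO.below fun x y => by
    refine or_congr_right ⟨fun h => ⟨fun e => (hO.nonEdges _ _ h).1 (congrArg _ e), h⟩, And.right⟩).mp
      hO.strong
  have hE : IsEdgeList L' (G'.edgeSet \ G.edgeSet) := by
    refine ⟨nodup_unord_toNat.mp hO.nodup, fun e => ?_⟩
    induction e with
    | h x y =>
      rw [← lAdj_toNat, Set.mem_sdiff, SimpleGraph.mem_edgeSet, SimpleGraph.mem_edgeSet]
      constructor
      · intro h
        exact ⟨.inr h, fun hG => (hO.nonEdges _ _ h).2 (hL.adj_iff.mpr hG)⟩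
      · rintro ⟨h | h, h'⟩
        exacts [(h' h).elim, h]
  refine ⟨t, s, G', L', he, by simpa [toNat] using ht, ⟨?_, fun i hi => ?_⟩, hE, hS, fun G₁ h₁ => ?_⟩
  · simpa [toNat] using hR.reg_two
  · have := hR.output i (L'[i].1, L'[i].2) (by simp [toNat, hi])
    simpa using this
  · obtain ⟨H₁, hb, hS, hl⟩ := exists_list_of_transformation hL h₁
    have := hO.le H₁ hb hS
    rw [← hl, addedEdges, hE.ncard]
    simpa [toNat] using this

end

end GraphAnon

theorem mainTheorem2 :
    (∃ (P : GraphAnon.Prog) (c : ℕ),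
      GraphAnon.SolvesStrongAnonymization P 2 1 2 (fun n m => c * (n + m + 1))) ∧
    (∃ (P : GraphAnon.Prog) (c d : ℕ),
      GraphAnon.SolvesStrongAnonymization P 2 1 0 (fun n m => c * (n + m + 1) ^ d)) := by
  obtain ⟨c, h⟩ := GraphAnon.linearProg_runs
  obtain ⟨c', e, h'⟩ := GraphAnon.exactProg_runs
  exact ⟨⟨_, c, GraphAnon.solves_of_runs h⟩, ⟨_, c', e, GraphAnon.solves_of_runs h'⟩⟩
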